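/- Let $\mathbb{H}=L^2([0,1],\mathbb{R})$ with inner product $\langle f,g\rangle=\int_0^1 f(t)g(t)\,dt$, norm $\|\cdot\|$ and its Borel $\sigma$-algebra. Let $Q$ be a Borel probability measure on $\mathbb{H}$ that is symmetric (invariant under $f\mapsto -f$) and satisfies $\int_{\mathbb{H}}\|f\|^4\,Q(df)<\infty$. For $x_1,\dots,x_n\in\mathbb{H}$ put $\overline{x}_n=\frac1n\sum_{j=1}^n x_j$, let $\mathcal{C}_n=\mathcal C_n(x_1,\dots,x_n)$ be the sample covariance operator $\mathcal{C}_nf=\frac1n\sum_{j=1}^n\langle x_j-\overline{x}_n,f\rangle(x_j-\overline{x}_n)$, and define $$T_n(x_1,\dots,x_n)=\int_{\mathbb{H}}\Big|\frac1n\sum_{j=1}^n e^{i\langle f,x_j\rangle}-\exp\Big(i\langle \overline{x}_n,f\rangle-\tfrac12\langle\mathcal{C}_nf,f\rangle\Big)\Big|^2\,Q(df).$$ Let $X_1,X_2,\dots$ be iid copies of an arbitrary (not necessarily Gaussian) random element $X$ of $\mathbb{H}$ with $\mathbb{E}\|X\|^2<\infty$. Let $\mu=\mathbb{E}X$, let $\mathcal{C}f=\mathbb{E}(\langle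 X-\mu,f\rangle X)$ be the covariance operator of $X$, and put $\sigma_{f,g}=\langle\mathcal{C}f,g\rangle$, $\sigma_f^2=\sigma_{f,f}$. Let $L^2_Q=L^2(\mathbb{H},Q;\mathbb{R})$ with norm $\|\cdot\|_Q$. Then there is a centred Gaussian random element $\mathcal{V}$ of $L^2_Q$ with covariance kernel $$K(f,g)=\exp\Big(-\tfrac12(\sigma_f^2+\sigma_g^2)\Big)\Big\{\exp(\sigma_{f,g})-1-\sigma_{f,g}-\tfrac12\sigma_{f,g}^2\Big\},$$ that is, $\mathbb{E}[\langle\mathcal{V},\Phi\rangle_Q\langle\mathcal{V},\Psi\rangle_Q]=\int_{\mathbb H}\int_{\mathbb H} K(f,g)\Phi(f)\Psi(g)\,Q(dg)\,Q(df)$ for all $\Phi,\Psi\in L^2_Q$, such that for almost every realization of the data sequence $X_1,X_2,\dots$ the following holds: if, for each $n$, given the data, $X^*_{n,1},\dots,X^*_{n,n}$ are iid with the centred Gaussian law $\mathrm{N}(0,\mathcal{C}_n(X_1,\dots,X_n))$ on $\mathbb{H}$, and $T_n^*=T_n(X^*_{n,1},\dots,X^*_{n,n})$, then $$nT_n^*\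 \xrightarrow{\ \mathcal{D}\ }\ \|\mathcal{V}\|_Q^2\qquad(n\to\infty).$$ -/

import Mathlib

open MeasureTheory ProbabilityTheory Filter Topology
open scoped RealInnerProductSpace ENNReal

noncomputable section

namespace FunctionalBHEP

/-- Real `L²` spaces carry their Borel `σ`-algebra. -/
instance instMeasurableSpaceL2 {α : Type*} [MeasurableSpace α] (μ : Measure α) :
    MeasurableSpace (Lp ℝ 2 μ) := borel _

instance instBorelSpaceL2 {α : Type*} [MeasurableSpace α] (μ : Measure α) :
    BorelSpace (Lp ℝ 2 μ) := ⟨rfl⟩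

/-- The separable Hilbert space `L²([0,1], ℝ)`. -/
abbrev HilbertL2 : Type := Lp ℝ 2 ((volume : Measure ℝ).restrict (Set.Icc (0 : ℝ) 1))

variable {H : Type*} [NormedAddCommGroup H] [InnerProductSpace ℝ H]

/-- The covariance operator `f ↦ E(⟨X - E X, f⟩ X)` of a square integrable random element `X`. -/
def covOp {Ω : Type*} [MeasurableSpace Ω] (X : Ω → H) (P : Measure Ω) (f : H) : H :=
  ∫ ω, ⟪X ω - ∫ ω', X ω' ∂P, f⟫ • X ω ∂P

/-- The sample mean. -/
def sampleMean {n : ℕ} (x : Fin n → H) : H := (n : ℝ)⁻¹ • ∑ j, x j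

/-- The sample covariance operator (with normalization `1 / n`). -/
def sampleCovOp {n : ℕ} (x : Fin n → H) (f : H) : H :=
  (n : ℝ)⁻¹ • ∑ j, ⟪x j - sampleMean x, f⟫ • (x j - sampleMean x)

/-- The empirical characteristic functional. -/
def empCharFun {n : ℕ} (x : Fin n → H) (f : H) : ℂ :=
  (n : ℂ)⁻¹ * ∑ j, Complex.exp (Complex.I * (⟪f, x j⟫ : ℝ))

/-- The characteristic functional of the Gaussian law with expectation `m` and covariance
operator `C`. -/
def gaussCharFun (m : H) (C : H → H) (f : H) : ℂ :=
  Complex.exp (Complex.I * (⟪m, f⟫ : ℝ) - (⟪C f, f⟫ : ℝ) / 2)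

/-- The test statistic `T_n`: the weighted `L²` distance between the empirical characteristic
functional and the characteristic functional of the fitted Gaussian law. -/
def testStat [MeasurableSpace H] (Q : Measure H) {n : ℕ} (x : Fin n → H) : ℝ :=
  ∫ f, ‖empCharFun x f - gaussCharFun (sampleMean x) (sampleCovOp x) f‖ ^ 2 ∂Q

/-- `γ` is a centred Gaussian law whose covariance form
`(f, g) ↦ ∫ ⟨f, x⟩ ⟨g, x⟩ γ(dx)` is `B`. -/
structure IsCentredGaussian [MeasurableSpace H] [BorelSpace H]
    (γ : Measure H) (B : H → H → ℝ) : Prop where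
  isGaussian : IsGaussian γ
  mean_eq_zero : ∫ x, x ∂γ = 0
  cov_eq : ∀ f g, covarianceBilin γ f g = B f g

/-- The covariance kernel of the limiting Gaussian element, in terms of `σ_{f,g} = ⟨C f, g⟩`. -/
def limitKernel (C : H → H) (f g : H) : ℝ :=
  Real.exp (-(1 / 2) * (⟪C f, f⟫ + ⟪C g, g⟫)) *
    (Real.exp ⟪C f, g⟫ - 1 - ⟪C f, g⟫ - (1 / 2) * ⟪C f, g⟫ ^ 2)

/-- The bilinear form on `L²(Q)` of the integral operator with kernel `K`. -/
def kernelForm {α : Type*} [MeasurableSpace α] (Q : Measure α) (K : α → α → ℝ)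
    (Φ Ψ : Lp ℝ 2 Q) : ℝ :=
  ∫ f, ∫ g, K f g * Φ f * Ψ g ∂Q ∂Q

/-- For every sample, the centred Gaussian law whose covariance operator is the sample
covariance operator exists. -/
theorem exists_isCentredGaussian_sampleCovOp [MeasurableSpace H] [BorelSpace H] [CompleteSpace H]
    [SecondCountableTopology H] {n : ℕ} (x : Fin n → H) :
    ∃ γ : Measure H, IsCentredGaussian γ (fun f g ↦ ⟪sampleCovOp x f, g⟫) := by
  let L : EuclideanSpace ℝ (Fin n) →L[ℝ] H :=
    ∑ j, (EuclideanSpace.proj (𝕜 := ℝ) j).smulRight ((√(n : ℝ))⁻¹ • (x j - sampleMean x))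
  have hL (j : Fin n) : L (EuclideanSpace.single j 1) = (√(n : ℝ))⁻¹ • (x j - sampleMean x) := by
    simp [L]
  have hadj (u : H) (j : Fin n) :
      (L.adjoint u) j = (√(n : ℝ))⁻¹ * ⟪x j - sampleMean x, u⟫ := by
    have h := L.adjoint_inner_right (EuclideanSpace.single j 1) u
    rw [hL, EuclideanSpace.inner_single_left, real_inner_smul_left] at h
    simpa using h
  refine ⟨(stdGaussian (EuclideanSpace ℝ (Fin n))).map L, inferInstance, ?_, fun f g ↦ ?_⟩
  · rw [integral_map (by fun_prop) (by fun_prop),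
      L.integral_comp_comm (φ := fun y ↦ y) IsGaussian.integrable_id, integral_id_stdGaussian,
      map_zero]
  · rw [covarianceBilin_map IsGaussian.memLp_two_id, covarianceBilin_stdGaussian]
    change inner ℝ (L.adjoint f) (L.adjoint g) = _
    have hn : (√(n : ℝ))⁻¹ * (√(n : ℝ))⁻¹ = (n : ℝ)⁻¹ := by
      rw [← mul_inv, Real.mul_self_sqrt (Nat.cast_nonneg n)]
    simp only [PiLp.inner_apply, hadj, sampleCovOp, real_inner_smul_left,
      sum_inner, Finset.mul_sum, RCLike.inner_apply, conj_trivial, ← hn]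
    refine Finset.sum_congr rfl fun j _ ↦ ?_
    ring

end FunctionalBHEP

end

open FunctionalBHEP

/-! Let `z(f)` be the difference between the empirical and the fitted Gaussian characteristic
functional. Replacing `f` by `-f` conjugates `z`, so for symmetric `Q` the product `Re z · Im z`
integrates to zero and `T_n` is the squared norm of `Re z + Im z` in the real space `L²(Q)`
(`testStat_eq`). The task becomes a limit theorem in that Hilbert space.

At fixed `f` only the numbers `⟪f, x j⟫` matter; under the bootstrap law they are iid centred
normal, with variance `v` say. Expanding the fitted characteristic function around `e^{-v/2}` gives
`√n (Re z + Im z)` as `n^{-1/2}` times a sum of iid centred terms `score v ⟪f, x j⟫`, up to an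
error. `linError_sq_le` bounds this error pathwise and `integral_linError_sq_le` bounds its mean
square in two ways: by a multiple of `v + v²`, which the fourth moment of `Q` makes integrable in
`f`, and by a multiple of `(v² + v⁴)/n`, which tends to zero for each `f`. Dominated convergence
then removes the error (`tendsto_integral_linError`).

The main term is a normalized sum of iid elements of `L²(Q)` whose law varies with `n`.
`tendstoInDistribution_norm_normSum_sq` handles it: finitely many coordinates converge by
characteristic functions, and convergence of the traces makes the other coordinates negligible
uniformly in `n`. Its moment hypotheses hold because `e^{-v/2}` bounds the scores uniformly in `v`
(`abs_score_sqrt_mul_le`). Its covariance hypotheses hold because the covariance of the scores,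
found by differentiating the Gaussian characteristic function (`hasMean_score_mul_score`), is the
kernel of the theorem, a continuous function of the covariance form.

The data enter only through almost sure convergence and boundedness of the sample covariances
(`ae_tendsto_sampleCovOp`). The limit element is a Gaussian series with the covariance of the scores
(`exists_isGaussian_covarianceBilin_eq`). -/

noncomputable section

set_option linter.unusedSectionVars false

namespace FunctionalBHEP

/-! ### Elementary tensors in vector-valued `L²`. -/

section TensorLp

variable {E : Type*} [NormedAddCommGroup E] [InnerProductSpace ℝ E]
  {α : Type*} [MeasurableSpace α] {μ : Measure α}

/-- The square integrable function `a ↦ u a • x`. -/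
def tensorLp (u : Lp ℝ 2 μ) (x : E) : Lp E 2 μ :=
  (ContinuousLinearMap.toSpanSingleton ℝ x).compLp u

lemma coeFn_tensorLp (u : Lp ℝ 2 μ) (x : E) : tensorLp u x =ᵐ[μ] fun a ↦ u a • x := by
  filter_upwards [(ContinuousLinearMap.toSpanSingleton ℝ x).coeFn_compLp' u] with a ha
  rw [tensorLp, ha, ContinuousLinearMap.toSpanSingleton_apply]

/-- Tested against `x`, the vector coefficient of `Y` along `u` is therefore the ordinary Fourier
coefficient of the scalar function `⟪x, Y⟫`. -/
lemma inner_tensorLp_left (u : Lp ℝ 2 μ) (x : E) (Y : Lp E 2 μ) :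
    ⟪tensorLp u x, Y⟫ = ⟪u, (innerSL ℝ x).compLp Y⟫ := by
  rw [L2.inner_def, L2.inner_def]
  refine integral_congr_ae ?_
  filter_upwards [coeFn_tensorLp u x, (innerSL ℝ x).coeFn_compLp' Y] with a h1 h2
  rw [h1, h2, real_inner_smul_left, innerSL_apply_apply]
  simp [mul_comm]

lemma inner_tensorLp_tensorLp (u v : Lp ℝ 2 μ) (x y : E) :
    ⟪tensorLp u x, tensorLp v y⟫ = ⟪u, v⟫ * ⟪x, y⟫ := by
  rw [L2.inner_def, L2.inner_def, ← integral_mul_const]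
  refine integral_congr_ae ?_
  filter_upwards [coeFn_tensorLp u x, coeFn_tensorLp v y] with a h1 h2
  rw [h1, h2, real_inner_smul_left, real_inner_smul_right]
  simp
  ring

/-- For a unit vector `u` of `L²`, the isometry `x ↦ u • x`. -/
def tensorLpIsometry (u : Lp ℝ 2 μ) (hu : ‖u‖ = 1) : E →ₗᵢ[ℝ] Lp E 2 μ where
  toFun x := tensorLp u x
  map_add' x y := by
    refine Lp.ext ?_
    filter_upwards [coeFn_tensorLp u x, coeFn_tensorLp u y, coeFn_tensorLp u (x + y),
      Lp.coeFn_add (tensorLp u x) (tensorLp u y)] with a h1 h2 h3 h4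
    rw [h3, h4, Pi.add_apply, h1, h2, smul_add]
  map_smul' c x := by
    refine Lp.ext ?_
    filter_upwards [coeFn_tensorLp u x, coeFn_tensorLp u (c • x),
      Lp.coeFn_smul c (tensorLp u x)] with a h1 h2 h3
    rw [h2, RingHom.id_apply, h3, Pi.smul_apply, h1, smul_comm]
  norm_map' x := by
    have h := inner_tensorLp_tensorLp u u x x
    simp only [real_inner_self_eq_norm_sq, hu, one_pow, one_mul] at h
    exact (pow_left_inj₀ (norm_nonneg _) (norm_nonneg _) two_ne_zero).1 h

lemma tensorLpIsometry_apply (u : Lp ℝ 2 μ) (hu : ‖u‖ = 1) (x : E) :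
    tensorLpIsometry u hu x = tensorLp u x := rfl

/-- Needed for two orthonormal families: independent standard normals, to sum a Gaussian series, and
a Hilbert basis of `L²(ν)`, to find the coefficients of that series. -/
lemma orthogonalFamily_tensorLpIsometry {ι : Type*} {u : ι → Lp ℝ 2 μ} (hu : Orthonormal ℝ u) :
    OrthogonalFamily ℝ (fun _ : ι ↦ E) (fun i ↦ tensorLpIsometry (u i) (hu.1 i)) := by
  intro i j hij x y
  rw [tensorLpIsometry_apply, tensorLpIsometry_apply, inner_tensorLp_tensorLp, hu.2 hij, zero_mul]

end TensorLp

/-- Bessel's inequality for the coefficients along an orthogonal family of subspaces. -/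
lemma summable_norm_sq_adjoint {ι E F : Type*} [NormedAddCommGroup E] [InnerProductSpace ℝ E]
    [CompleteSpace E] [NormedAddCommGroup F] [InnerProductSpace ℝ F] [CompleteSpace F]
    {V : ι → E →ₗᵢ[ℝ] F} (hV : OrthogonalFamily ℝ (fun _ : ι ↦ E) V) (y : F) :
    Summable fun i ↦ ‖(V i).toContinuousLinearMap.adjoint y‖ ^ 2 := by
  classical
  refine summable_of_sum_le (c := ‖y‖ ^ 2) (fun i ↦ sq_nonneg _) fun s ↦ ?_
  set a : ι → E := fun i ↦ (V i).toContinuousLinearMap.adjoint y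
  have h1 : ‖∑ i ∈ s, V i (a i)‖ ^ 2 = ∑ i ∈ s, ‖a i‖ ^ 2 := hV.norm_sum a s
  have h2 : ∑ i ∈ s, ‖a i‖ ^ 2 = ⟪∑ i ∈ s, V i (a i), y⟫ := by
    rw [sum_inner]
    refine Finset.sum_congr rfl fun i _ ↦ ?_
    rw [← real_inner_self_eq_norm_sq]
    exact ContinuousLinearMap.adjoint_inner_right _ _ _
  have h3 := real_inner_le_norm (∑ i ∈ s, V i (a i)) y
  rw [← h2, ← h1] at h3
  rw [← h1]
  -- Cauchy–Schwarz gives `‖S‖² ≤ ‖S‖ ‖y‖` for the partial sum `S`; cancelling a factor needs `S ≠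
  -- 0`.
  rcases (norm_nonneg (∑ i ∈ s, V i (a i))).eq_or_lt with h0 | h0
  · rw [← h0]; simp
  · have : ‖∑ i ∈ s, V i (a i)‖ ≤ ‖y‖ := by
      rw [sq] at h3
      exact le_of_mul_le_mul_left h3 h0
    gcongr

/-! ### Characteristic functions and `L²` distance. -/

section CharFun

variable {E : Type*} [NormedAddCommGroup E] [InnerProductSpace ℝ E] [MeasurableSpace E]
  [BorelSpace E] [SecondCountableTopology E]

lemma charFun_map_apply {Ω : Type*} [MeasurableSpace Ω] {P : Measure Ω} {X : Ω → E}
    (hX : AEMeasurable X P) (t : E) :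
    charFun (P.map X) t = ∫ ω, Complex.exp ((⟪X ω, t⟫ : ℝ) * Complex.I) ∂P := by
  rw [charFun_apply, integral_map hX (by fun_prop)]

/-- Follows from `|e^{is} - 1| ≤ |s|`, Cauchy–Schwarz and the comparison of `L¹` and `L²` norms. It
carries characteristic functions through `L²` limits of random elements. -/
lemma norm_charFun_map_sub_le {Ω : Type*} [MeasurableSpace Ω] {P : Measure Ω}
    [IsProbabilityMeasure P] (X Y : Lp E 2 P) (t : E) :
    ‖charFun (P.map X) t - charFun (P.map Y) t‖ ≤ ‖X - Y‖ * ‖t‖ := by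
  have hint (Z : Lp E 2 P) :
      Integrable (fun ω ↦ Complex.exp ((⟪Z ω, t⟫ : ℝ) * Complex.I)) P := by
    refine Integrable.of_bound ?_ 1 (ae_of_all _ fun ω ↦ ?_)
    · have := (Lp.aestronglyMeasurable Z).aemeasurable
      exact (by fun_prop : AEMeasurable _ P).aestronglyMeasurable
    · rw [Complex.norm_exp_ofReal_mul_I]
  have hZ : Integrable (X - Y : Lp E 2 P) P := (Lp.memLp _).integrable one_le_two
  rw [charFun_map_apply (Lp.aestronglyMeasurable X).aemeasurable,
    charFun_map_apply (Lp.aestronglyMeasurable Y).aemeasurable, ← integral_sub (hint X) (hint Y)]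
  calc ‖∫ ω, (Complex.exp ((⟪X ω, t⟫ : ℝ) * Complex.I)
          - Complex.exp ((⟪Y ω, t⟫ : ℝ) * Complex.I)) ∂P‖
      ≤ ∫ ω, ‖(X - Y : Lp E 2 P) ω‖ * ‖t‖ ∂P := by
        refine norm_integral_le_of_norm_le (hZ.norm.mul_const _) ?_
        filter_upwards [Lp.coeFn_sub X Y] with ω hω
        rw [hω, Pi.sub_apply]
        refine le_trans ?_ (norm_inner_le_norm (𝕜 := ℝ) _ _)
        rw [inner_sub_left]
        have h := Real.norm_exp_I_mul_ofReal_sub_one_le (x := ⟪X ω, t⟫ - ⟪Y ω, t⟫)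
        have e : Complex.exp ((⟪X ω, t⟫ : ℝ) * Complex.I)
            - Complex.exp ((⟪Y ω, t⟫ : ℝ) * Complex.I)
            = Complex.exp ((⟪Y ω, t⟫ : ℝ) * Complex.I) *
              (Complex.exp (Complex.I * ((⟪X ω, t⟫ - ⟪Y ω, t⟫ : ℝ) : ℂ)) - 1) := by
          rw [mul_sub, mul_one, ← Complex.exp_add]
          congr 2
          push_cast
          ring
        rw [e, norm_mul, Complex.norm_exp_ofReal_mul_I, one_mul]
        exact h
    _ = (∫ ω, ‖(X - Y : Lp E 2 P) ω‖ ∂P) * ‖t‖ := integral_mul_const _ _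
    _ ≤ ‖X - Y‖ * ‖t‖ := by
        gcongr
        rw [← toReal_enorm (X - Y), Lp.enorm_def,
          integral_norm_eq_lintegral_enorm (Lp.aestronglyMeasurable _),
          ← eLpNorm_one_eq_lintegral_enorm]
        exact ENNReal.toReal_mono (Lp.eLpNorm_ne_top _)
          (eLpNorm_le_eLpNorm_of_exponent_le one_le_two (Lp.aestronglyMeasurable _))

end CharFun

/-! ### Gaussian series in a Hilbert space. -/

section Existence

variable (ι : Type*)

/-- The law of independent standard normal variables indexed by `ι`. -/
abbrev stdNormals : Measure (ι → ℝ) := Measure.infinitePi fun _ ↦ gaussianReal 0 1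

variable {ι}

lemma memLp_eval_stdNormals (i : ι) : MemLp (fun ω : ι → ℝ ↦ ω i) 2 (stdNormals ι) :=
  (memLp_id_gaussianReal (μ := 0) (v := 1) 2).comp_measurePreserving
    (measurePreserving_eval_infinitePi _ i)

lemma integral_eval_stdNormals (i : ι) (g : ℝ → ℝ) (hg : Measurable g) :
    ∫ ω, g (ω i) ∂(stdNormals ι) = ∫ x, g x ∂(gaussianReal 0 1) := by
  rw [← Measure.infinitePi_map_eval (fun _ : ι ↦ gaussianReal 0 1) i,
    integral_map (measurable_pi_apply i).aemeasurable hg.aestronglyMeasurable]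

lemma iIndepFun_eval_stdNormals : iIndepFun (fun (i : ι) (ω : ι → ℝ) ↦ ω i) (stdNormals ι) :=
  iIndepFun_infinitePi (P := fun _ : ι ↦ gaussianReal 0 1) (X := fun _ x ↦ x) (by fun_prop)

lemma integral_sq_gaussianReal (v : NNReal) : ∫ x, x ^ 2 ∂(gaussianReal 0 v) = v := by
  have h := variance_fun_id_gaussianReal (μ := 0) (v := v)
  rwa [variance_of_integral_eq_zero (by fun_prop) integral_id_gaussianReal] at h

lemma orthonormal_eval_stdNormals :
    Orthonormal ℝ fun i : ι ↦ (memLp_eval_stdNormals i).toLp := by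
  have key (i j : ι) : ⟪(memLp_eval_stdNormals i).toLp, (memLp_eval_stdNormals j).toLp⟫
      = ∫ ω, ω i * ω j ∂(stdNormals ι) := by
    rw [L2.inner_def]
    refine integral_congr_ae ?_
    filter_upwards [(memLp_eval_stdNormals i).coeFn_toLp, (memLp_eval_stdNormals j).coeFn_toLp]
      with ω h1 h2
    rw [h1, h2]
    simp [mul_comm]
  refine ⟨fun i ↦ ?_, fun i j hij ↦ ?_⟩
  · have h := key i i
    simp only [← sq] at h
    rw [integral_eval_stdNormals i (fun x ↦ x ^ 2) (by fun_prop), integral_sq_gaussianReal,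
      real_inner_self_eq_norm_sq] at h
    exact (pow_left_inj₀ (norm_nonneg _) zero_le_one two_ne_zero).1 (by simpa using h)
  · have h := (iIndepFun_eval_stdNormals (ι := ι)).indepFun hij
    change ⟪(memLp_eval_stdNormals i).toLp, (memLp_eval_stdNormals j).toLp⟫ = 0
    rw [key, h.integral_fun_mul_eq_mul_integral (memLp_eval_stdNormals i).1
      (memLp_eval_stdNormals j).1, integral_eval_stdNormals i (fun x ↦ x) (by fun_prop),
      integral_id_gaussianReal, zero_mul]

variable {E : Type*} [NormedAddCommGroup E] [InnerProductSpace ℝ E] [MeasurableSpace E]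
  [BorelSpace E] [SecondCountableTopology E]

lemma charFun_map_sum_stdNormals (a : ι → E) (s : Finset ι) (t : E) :
    charFun ((stdNormals ι).map fun ω ↦ ∑ i ∈ s, ω i • a i) t
      = Complex.exp (-((∑ i ∈ s, ⟪a i, t⟫ ^ 2 : ℝ) : ℂ) / 2) := by
  have hind : iIndepFun (fun (i : ι) (ω : ι → ℝ) ↦ ω i • a i) (stdNormals ι) :=
    iIndepFun_eval_stdNormals.comp (fun i x ↦ x • a i) (by fun_prop)
  rw [iIndepFun.charFun_map_fun_finsetSum_eq_prod (fun i _ ↦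
    ((measurable_pi_apply i).smul_const (a i)).aemeasurable) (hind.restrict s),
    Finset.prod_apply]
  have hterm (i : ι) : charFun ((stdNormals ι).map fun ω ↦ ω i • a i) t
      = Complex.exp (-((⟪a i, t⟫ ^ 2 : ℝ) : ℂ) / 2) := by
    have h : (stdNormals ι).map (fun ω ↦ ω i • a i) = (gaussianReal 0 1).map (fun x ↦ x • a i) := by
      rw [← Measure.infinitePi_map_eval (fun _ : ι ↦ gaussianReal 0 1) i,
        Measure.map_map (by fun_prop) (by fun_prop)]
      rfl
    have h2 := charFun_gaussianReal (μ := 0) (v := 1) ⟪a i, t⟫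
    rw [charFun_apply_real] at h2
    rw [h, charFun_map_apply (by fun_prop)]
    simp only [real_inner_smul_left]
    calc _ = _ := by
          refine integral_congr_ae (ae_of_all _ fun x ↦ ?_)
          change _ = Complex.exp (⟪a i, t⟫ * x * Complex.I)
          push_cast; ring_nf
      _ = _ := h2
      _ = _ := by push_cast; congr 1; simp; ring
  rw [Finset.prod_congr rfl fun i _ ↦ hterm i, ← Complex.exp_sum]
  congr 1
  push_cast
  rw [← Finset.sum_div, Finset.sum_neg_distrib]

/-- A summable family of vectors is the family of coefficients of a Gaussian series. -/
lemma exists_charFun_eq_of_summable [CompleteSpace E] {a : ι → E}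
    (ha : Summable fun i ↦ ‖a i‖ ^ 2) :
    ∃ γ : Measure E, IsProbabilityMeasure γ ∧
      ∀ t c, HasSum (fun i ↦ ⟪a i, t⟫ ^ 2) c → charFun γ t = Complex.exp (-(c : ℂ) / 2) := by
  have hort := orthogonalFamily_tensorLpIsometry (E := E) (orthonormal_eval_stdNormals (ι := ι))
  -- Square summable coefficients make the Gaussian series converge in `L²`; its finite partial sums
  -- have explicit characteristic functions, which pass to the limit.
  obtain ⟨V, hV⟩ := (hort.summable_iff_norm_sq_summable a).2 ha
  refine ⟨(stdNormals ι).map V,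
    Measure.isProbabilityMeasure_map (Lp.aestronglyMeasurable V).aemeasurable, fun t c hc ↦ ?_⟩
  have h1 : Tendsto (fun s : Finset ι ↦ charFun ((stdNormals ι).map
      (∑ i ∈ s, tensorLpIsometry _ (orthonormal_eval_stdNormals.1 i) (a i) :
        Lp E 2 (stdNormals ι))) t) atTop (𝓝 (charFun ((stdNormals ι).map V) t)) := by
    rw [tendsto_iff_norm_sub_tendsto_zero]
    have h0 := (tendsto_iff_norm_sub_tendsto_zero.1 hV).mul_const ‖t‖
    rw [zero_mul] at h0
    exact squeeze_zero (fun _ ↦ norm_nonneg _) (fun s ↦ norm_charFun_map_sub_le _ _ t) h0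
  have h2 (s : Finset ι) : charFun ((stdNormals ι).map
      (∑ i ∈ s, tensorLpIsometry _ (orthonormal_eval_stdNormals.1 i) (a i) :
        Lp E 2 (stdNormals ι))) t = Complex.exp (-((∑ i ∈ s, ⟪a i, t⟫ ^ 2 : ℝ) : ℂ) / 2) := by
    rw [← charFun_map_sum_stdNormals]
    congr 1
    refine Measure.map_congr ?_
    have h3 : ∀ᵐ ω ∂(stdNormals ι), ∀ i ∈ s,
        (tensorLp (memLp_eval_stdNormals i).toLp (a i) : Lp E 2 (stdNormals ι)) ω
          = ω i • a i := by
      rw [Filter.eventually_all_finset]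
      intro i _
      filter_upwards [coeFn_tensorLp (memLp_eval_stdNormals i).toLp (a i),
        (memLp_eval_stdNormals i).coeFn_toLp] with ω h4 h5
      rw [h4, h5]
    filter_upwards [h3, Lp.coeFn_finsetSum s (fun i ↦ tensorLpIsometry _
      (orthonormal_eval_stdNormals.1 i) (a i))] with ω h4 h5
    rw [h5, Finset.sum_apply]
    exact Finset.sum_congr rfl h4
  simp only [h2] at h1
  refine tendsto_nhds_unique h1 ?_
  have h3 : Continuous fun r : ℝ ↦ Complex.exp (-(r : ℂ) / 2) := by fun_prop
  exact (h3.tendsto c).comp hc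

end Existence

/-- For every law with finite second moment on a separable Hilbert space there is a centred
Gaussian law with the same covariance. -/
theorem exists_isGaussian_covarianceBilin_eq {E : Type*} [NormedAddCommGroup E]
    [InnerProductSpace ℝ E] [MeasurableSpace E] [BorelSpace E] [SecondCountableTopology E]
    [CompleteSpace E] (ν : Measure E) [IsProbabilityMeasure ν] (hν : MemLp id 2 ν) :
    ∃ γ : Measure E, IsGaussian γ ∧ ∫ x, x ∂γ = 0 ∧ covarianceBilin γ = covarianceBilin ν := by
  -- With a basis `b` of `L²(ν)` and the centred identity `Y`, the vector coefficients of `Y` are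
  -- square summable by Bessel. Parseval for `⟪t, Y⟫` shows that their squared products with `t` sum
  -- to the variance in direction `t`.
  obtain ⟨w, b, -⟩ := exists_hilbertBasis ℝ (Lp ℝ 2 ν)
  have hY : MemLp (fun x ↦ x - ∫ y, y ∂ν) 2 ν := hν.sub (memLp_const _)
  set V := fun i ↦ tensorLpIsometry (E := E) (b i) (b.orthonormal.1 i)
  have hV : OrthogonalFamily ℝ (fun _ : w ↦ E) V := orthogonalFamily_tensorLpIsometry b.orthonormal
  obtain ⟨γ, hγ, hchar⟩ := exists_charFun_eq_of_summable (summable_norm_sq_adjoint hV hY.toLp)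
  have key (t : E) : charFun γ t
      = Complex.exp (⟪t, (0 : E)⟫ * Complex.I - covarianceBilin ν t t / 2) := by
    rw [hchar t (covarianceBilin ν t t)]
    · simp [neg_div]
    · have h1 (i : w) : ⟪(V i).toContinuousLinearMap.adjoint hY.toLp, t⟫
          = ⟪(innerSL ℝ t).compLp hY.toLp, b i⟫ := by
        rw [ContinuousLinearMap.adjoint_inner_left, real_inner_comm]
        exact (inner_tensorLp_left _ _ _).trans (real_inner_comm _ _)
      have h2 : ⟪(innerSL ℝ t).compLp hY.toLp, (innerSL ℝ t).compLp hY.toLp⟫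
          = covarianceBilin ν t t := by
        rw [covarianceBilin_apply hν, L2.inner_def]
        refine integral_congr_ae ?_
        filter_upwards [(innerSL ℝ t).coeFn_compLp' hY.toLp, hY.coeFn_toLp] with x h3 h4
        rw [h3, h4]
        simp [sq]
      rw [← h2]
      have h3 := b.hasSum_inner_mul_inner ((innerSL ℝ t).compLp hY.toLp)
        ((innerSL ℝ t).compLp hY.toLp)
      refine h3.congr_fun fun i ↦ ?_
      rw [h1, sq, real_inner_comm (b i)]
  -- Mean and covariance can be read off a characteristic function of Gaussian form.
  have hG := gaussian_charFun_congr (μ := γ) 0 (covarianceBilin ν) isPosSemidef_covarianceBilin key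
  exact ⟨γ, isGaussian_iff_gaussian_charFun.2 ⟨0, _, isPosSemidef_covarianceBilin, key⟩,
    hG.1.symm, hG.2.symm⟩

/-! ### Second moments as traces. -/

section Trace

variable {E : Type*} [NormedAddCommGroup E] [InnerProductSpace ℝ E] [MeasurableSpace E]
  [BorelSpace E] [SecondCountableTopology E]

/-- Parseval's identity for the second moment. -/
lemma hasSum_integral_inner_sq {ι : Type*} [Countable ι] {ν : Measure E}
    (hν : MemLp id 2 ν) (b : HilbertBasis ι ℝ E) :
    HasSum (fun i ↦ ∫ x, ⟪b i, x⟫ ^ 2 ∂ν) (∫ x, ‖x‖ ^ 2 ∂ν) := by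
  have h (x : E) : HasSum (fun i ↦ ⟪b i, x⟫ ^ 2) (‖x‖ ^ 2) := by
    rw [← real_inner_self_eq_norm_sq]
    refine (b.hasSum_inner_mul_inner x x).congr_fun fun i ↦ ?_
    rw [sq, real_inner_comm]
  -- The terms are nonnegative, so each dominates itself, and the sum of these bounds is `‖x‖²`.
  refine hasSum_integral_of_dominated_convergence (fun i x ↦ ⟪b i, x⟫ ^ 2)
    (fun i ↦ by fun_prop) (fun i ↦ ae_of_all _ fun x ↦ ?_) (ae_of_all _ fun x ↦ (h x).summable) ?_
    (ae_of_all _ h)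
  · rw [Real.norm_of_nonneg (sq_nonneg _)]
  · simp only [fun x ↦ (h x).tsum_eq]
    exact hν.integrable_norm_pow two_ne_zero

/-- A separable Hilbert space has a countable Hilbert basis. -/
lemma exists_countable_hilbertBasis (E : Type*) [NormedAddCommGroup E] [InnerProductSpace ℝ E]
    [CompleteSpace E] [SecondCountableTopology E] :
    ∃ (w : Set E) (_ : HilbertBasis w ℝ E), Countable w := by
  obtain ⟨w, b, hb⟩ := exists_hilbertBasis ℝ E
  refine ⟨w, b, Pairwise.countable_of_isOpen_disjoint (s := fun i : w ↦ Metric.ball (b i) (1 / 2))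
    (fun i j hij ↦ ?_) (fun _ ↦ Metric.isOpen_ball) (fun i ↦ ⟨b i, Metric.mem_ball_self (by simp)⟩)⟩
  -- Distinct basis vectors are `√2` apart, and a separable space contains only countably many
  -- disjoint balls.
  refine Metric.ball_disjoint_ball ?_
  have h := norm_sub_sq_real (b i) (b j)
  rw [b.orthonormal.1, b.orthonormal.1, b.orthonormal.2 hij] at h
  rw [dist_eq_norm]
  nlinarith [norm_nonneg (b i - b j)]

end Trace

/-! ### Convergence in distribution by approximation in mean. -/

section Approximation

variable {Ωb : ℕ → Type*} [∀ n, MeasurableSpace (Ωb n)] {Pb : (n : ℕ) → Measure (Ωb n)}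
  [∀ n, IsProbabilityMeasure (Pb n)] {Ω' : Type*} [MeasurableSpace Ω'] {P' : Measure Ω'}
  [IsProbabilityMeasure P']

/-- The Lipschitz constant gives the estimate; boundedness of `F` serves only integrability. -/
lemma abs_integral_comp_sub_le {Ω : Type*} [MeasurableSpace Ω] {P : Measure Ω}
    [IsProbabilityMeasure P] {F : ℝ → ℝ} {M : ℝ} (hM : ∀ x y, dist (F x) (F y) ≤ M) {L : NNReal}
    (hL : LipschitzWith L F) {R A : Ω → ℝ} (hR : AEMeasurable R P) (hA : AEMeasurable A P)
    (hint : Integrable (fun ω ↦ R ω - A ω) P) :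
    |∫ ω, F (R ω) ∂P - ∫ ω, F (A ω) ∂P| ≤ L * ∫ ω, |R ω - A ω| ∂P := by
  have hF (Z : Ω → ℝ) (hZ : AEMeasurable Z P) : Integrable (fun ω ↦ F (Z ω)) P := by
    refine Integrable.of_bound (hL.continuous.measurable.comp_aemeasurable hZ).aestronglyMeasurable
      (M + |F 0|) (ae_of_all _ fun ω ↦ ?_)
    have h := hM (Z ω) 0
    rw [Real.dist_eq] at h
    rw [Real.norm_eq_abs]
    have := abs_sub_abs_le_abs_sub (F (Z ω)) (F 0)
    linarith
  rw [← integral_sub (hF R hR) (hF A hA), ← integral_const_mul, ← Real.norm_eq_abs]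
  refine norm_integral_le_of_norm_le (hint.abs.const_mul _) (ae_of_all _ fun ω ↦ ?_)
  have h := hL.dist_le_mul (R ω) (A ω)
  rwa [Real.dist_eq, Real.dist_eq] at h

/-- Convergence in distribution follows from approximation in mean, uniformly in the index, by
random variables converging in distribution. -/
theorem tendstoInDistribution_of_approx {R : (n : ℕ) → Ωb n → ℝ} {Z : Ω' → ℝ}
    (hR : ∀ n, AEMeasurable (R n) (Pb n)) (hZ : AEMeasurable Z P')
    (h : ∀ ε > 0, ∃ (A : (n : ℕ) → Ωb n → ℝ) (W : Ω' → ℝ),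
      TendstoInDistribution A atTop W Pb P' ∧
      (∀ᶠ n in atTop, Integrable (fun ω ↦ R n ω - A n ω) (Pb n) ∧
        ∫ ω, |R n ω - A n ω| ∂(Pb n) ≤ ε) ∧
      Integrable (fun ω ↦ Z ω - W ω) P' ∧ ∫ ω, |Z ω - W ω| ∂P' ≤ ε) :
    TendstoInDistribution R atTop Z Pb P' := by
  refine ⟨hR, hZ, ?_⟩
  refine tendsto_iff_forall_lipschitz_integral_tendsto.2 ?_
  rintro F ⟨M, hM⟩ ⟨L, hL⟩
  have hFm : Measurable F := hL.continuous.measurable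
  rw [Metric.tendsto_atTop']
  intro δ hδ
  -- Passing from `R` to `A`, from `A` to `W` and from `W` to `Z` costs at most `δ / 4` each; `L +
  -- 1` avoids dividing by zero.
  obtain ⟨A, W, hAW, hRA, hint, hZW⟩ := h (δ / (4 * (L + 1))) (by positivity)
  have h1 := tendsto_iff_forall_lipschitz_integral_tendsto.1 hAW.tendsto
  have h2 := (Metric.tendsto_nhds.1 (h1 F ⟨M, hM⟩ ⟨L, hL⟩)) (δ / 4) (by positivity)
  obtain ⟨N, hN⟩ := eventually_atTop.1 (h2.and hRA)
  refine ⟨N, fun n hn ↦ ?_⟩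
  obtain ⟨h3, h4, h5⟩ := hN n hn.le
  simp only [ProbabilityMeasure.coe_mk] at h3 ⊢
  rw [integral_map (hAW.forall_aemeasurable n) hFm.aestronglyMeasurable,
    integral_map hAW.aemeasurable_limit hFm.aestronglyMeasurable, Real.dist_eq] at h3
  rw [integral_map (hR n) hFm.aestronglyMeasurable, integral_map hZ hFm.aestronglyMeasurable,
    Real.dist_eq]
  have h6 := abs_integral_comp_sub_le hM hL (hR n) (hAW.forall_aemeasurable n) h4
  have h7 := abs_integral_comp_sub_le hM hL hZ hAW.aemeasurable_limit hint
  have h8 : (L : ℝ) * (δ / (4 * (L + 1))) ≤ δ / 4 := by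
    rw [mul_div_assoc', div_le_div_iff₀ (by positivity) (by positivity)]
    nlinarith [L.coe_nonneg]
  have h9 := mul_le_mul_of_nonneg_left h5 L.coe_nonneg
  have h10 := mul_le_mul_of_nonneg_left hZW L.coe_nonneg
  rw [abs_lt] at h3 ⊢
  rw [abs_le] at h6 h7
  constructor <;> linarith

end Approximation

/-! ### Normalized sums: characteristic functions and second moments. -/

section CentralLimit

/-- Taylor's formula when `|y| ≤ 1`; otherwise `|y|³` dominates each term separately. The constant
is not sharp. -/
lemma norm_exp_mul_I_sub_le (y : ℝ) :
    ‖Complex.exp (y * Complex.I) - (1 + y * Complex.I - (y : ℂ) ^ 2 / 2)‖ ≤ 5 * |y| ^ 3 := by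
  have hn : ‖(y * Complex.I : ℂ)‖ = |y| := by simp
  rcases le_total |y| 1 with hy | hy
  · have h := Complex.exp_bound (x := y * Complex.I) (by rwa [hn]) (n := 3) (by norm_num)
    rw [hn] at h
    have e : ∑ m ∈ Finset.range 3, (y * Complex.I : ℂ) ^ m / (m.factorial : ℂ)
        = 1 + y * Complex.I - (y : ℂ) ^ 2 / 2 := by
      simp only [Finset.sum_range_succ, Finset.range_zero, Finset.sum_empty, Nat.factorial,
        mul_pow, Complex.I_sq]
      push_cast
      ring
    rw [e] at h
    refine h.trans ?_
    have := pow_nonneg (abs_nonneg y) 3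
    norm_num [Nat.factorial]
    linarith
  · calc _ ≤ ‖Complex.exp (y * Complex.I)‖ + (‖(1 : ℂ)‖ + ‖(y * Complex.I : ℂ)‖
          + ‖(y : ℂ) ^ 2 / 2‖) := by
          refine (norm_sub_le _ _).trans ?_
          gcongr
          refine (norm_sub_le _ _).trans ?_
          gcongr
          exact norm_add_le _ _
      _ = 1 + (1 + |y| + |y| ^ 2 / 2) := by
          rw [Complex.norm_exp_ofReal_mul_I, hn, norm_one]
          simp
      _ ≤ 5 * |y| ^ 3 := by
          have h1 : 1 ≤ |y| ^ 2 := one_le_pow₀ hy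
          have h2 : |y| ^ 2 ≤ |y| ^ 3 := pow_le_pow_right₀ hy (by norm_num)
          have h3 : |y| ≤ |y| ^ 3 := le_self_pow₀ hy (by norm_num)
          linarith

variable {E : Type*} [NormedAddCommGroup E] [InnerProductSpace ℝ E] [MeasurableSpace E]
  [BorelSpace E] [SecondCountableTopology E] [CompleteSpace E]

lemma covarianceBilin_of_mean_zero {ν : Measure E} [IsProbabilityMeasure ν] (h2 : MemLp id 2 ν)
    (h0 : ∫ x, x ∂ν = 0) (u v : E) : covarianceBilin ν u v = ∫ x, ⟪u, x⟫ * ⟪v, x⟫ ∂ν := by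
  rw [covarianceBilin_apply h2]
  simp [h0]

lemma integral_inner_eq_zero {ν : Measure E} [IsProbabilityMeasure ν] (h2 : MemLp id 2 ν)
    (h0 : ∫ x, x ∂ν = 0) (u : E) : ∫ x, ⟪u, x⟫ ∂ν = 0 := by
  have h := integral_inner (𝕜 := ℝ) (f := fun x : E ↦ x) (h2.integrable one_le_two) u
  rw [h, h0, inner_zero_right]

/-- Integrate the third-order Taylor bound: centring removes the linear term, and the quadratic term
is the variance. -/
lemma norm_charFun_sub_le {ν : Measure E} [IsProbabilityMeasure ν] (h3 : MemLp id 3 ν)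
    (h0 : ∫ x, x ∂ν = 0) (u : E) :
    ‖charFun ν u - (1 - covarianceBilin ν u u / 2)‖ ≤ 5 * ‖u‖ ^ 3 * ∫ x, ‖x‖ ^ 3 ∂ν := by
  have h2 : MemLp id 2 ν := h3.mono_exponent (by norm_num)
  have hi1 : Integrable (fun x ↦ ⟪u, x⟫) ν := (h2.integrable one_le_two).const_inner u
  have hi2 : Integrable (fun x ↦ ⟪u, x⟫ ^ 2) ν := (h2.const_inner u).integrable_sq
  have e : charFun ν u - (1 - covarianceBilin ν u u / 2)
      = ∫ x, (Complex.exp ((⟪u, x⟫ : ℝ) * Complex.I)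
        - (1 + (⟪u, x⟫ : ℝ) * Complex.I - ((⟪u, x⟫ : ℝ) : ℂ) ^ 2 / 2)) ∂ν := by
    have hc2 : Integrable (fun x ↦ ((⟪u, x⟫ : ℝ) : ℂ) ^ 2 / 2) ν := by
      have := hi2.ofReal (𝕜 := ℂ)
      simpa using this.div_const 2
    have hc1 : Integrable (fun x ↦ ((⟪u, x⟫ : ℝ) : ℂ) * Complex.I) ν :=
      (hi1.ofReal (𝕜 := ℂ)).mul_const _
    have hc0 : Integrable (fun x ↦ Complex.exp ((⟪u, x⟫ : ℝ) * Complex.I)) ν := by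
      refine Integrable.of_bound (by fun_prop) 1 (ae_of_all _ fun x ↦ ?_)
      rw [Complex.norm_exp_ofReal_mul_I]
    rw [integral_sub hc0, integral_sub, integral_add (integrable_const _) hc1, integral_mul_const,
      integral_complex_ofReal, integral_inner_eq_zero h2 h0]
    · rw [integral_div, charFun_apply, covarianceBilin_of_mean_zero h2 h0]
      simp only [← sq, ← Complex.ofReal_pow]
      rw [integral_complex_ofReal]
      simp [real_inner_comm]
    · exact (integrable_const _).add hc1
    · exact hc2
    · exact ((integrable_const _).add hc1).sub hc2
  have hi3 : Integrable (fun x ↦ ‖x‖ ^ 3) ν := h3.integrable_norm_pow three_ne_zero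
  rw [e, ← integral_const_mul]
  refine norm_integral_le_of_norm_le (hi3.const_mul _) (ae_of_all _ fun x ↦ ?_)
  refine (norm_exp_mul_I_sub_le _).trans ?_
  rw [mul_assoc, ← mul_pow]
  gcongr
  exact abs_real_inner_le_norm u x

/-- The normalized sum of `n` vectors. -/
def normSum {n : ℕ} (x : Fin n → E) : E := (√(n : ℝ))⁻¹ • ∑ j, x j

variable {Ω : Type*} [MeasurableSpace Ω] {P : Measure Ω} [IsProbabilityMeasure P]
  {n : ℕ} {Y : Fin n → Ω → E} {ν : Measure E} [IsProbabilityMeasure ν]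

lemma aemeasurable_normSum (hY : ∀ j, AEMeasurable (Y j) P) :
    AEMeasurable (fun ω ↦ normSum fun j ↦ Y j ω) P := by
  unfold normSum
  fun_prop

lemma charFun_map_normSum (hind : iIndepFun Y P) (hY : ∀ j, AEMeasurable (Y j) P)
    (hν : ∀ j, P.map (Y j) = ν) (u : E) :
    charFun (P.map fun ω ↦ normSum fun j ↦ Y j ω) u = charFun ν ((√(n : ℝ))⁻¹ • u) ^ n := by
  have h := (hind.comp (fun _ x ↦ (√(n : ℝ))⁻¹ • x)
    (by fun_prop)).charFun_map_fun_sum_eq_prod (fun j ↦ (hY j).const_smul _)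
  unfold normSum
  simp only [Finset.smul_sum]
  refine (congrFun h u).trans ?_
  rw [Finset.prod_apply]
  have h1 (j : Fin n) : charFun (P.map ((fun x ↦ (√(n : ℝ))⁻¹ • x) ∘ Y j)) u
      = charFun ν ((√(n : ℝ))⁻¹ • u) := by
    rw [charFun_map_apply (by exact (hY j).const_smul _), ← hν j, charFun_map_apply (hY j)]
    simp [real_inner_smul_left, real_inner_smul_right]
  refine (Finset.prod_congr rfl fun j _ ↦ h1 j).trans ?_
  simp

lemma memLp_normSum (hY : ∀ j, AEMeasurable (Y j) P) (hν : ∀ j, P.map (Y j) = ν)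
    (h2 : MemLp id 2 ν) : MemLp (fun ω ↦ normSum fun j ↦ Y j ω) 2 P := by
  have h (j : Fin n) : MemLp (Y j) 2 P := by
    rw [← hν j] at h2
    exact (memLp_map_measure_iff (by fun_prop) (hY j)).1 h2
  exact (memLp_finsetSum Finset.univ fun j _ ↦ h j).const_smul _

lemma integral_inner_normSum_sq (hn : n ≠ 0) (hind : iIndepFun Y P)
    (hY : ∀ j, AEMeasurable (Y j) P) (hν : ∀ j, P.map (Y j) = ν)
    (h2 : MemLp id 2 ν) (h0 : ∫ x, x ∂ν = 0) (u : E) :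
    ∫ ω, ⟪u, normSum fun j ↦ Y j ω⟫ ^ 2 ∂P = covarianceBilin ν u u := by
  have hm (j : Fin n) : MemLp (fun ω ↦ ⟪u, Y j ω⟫) 2 P := by
    have h2' := h2
    rw [← hν j] at h2'
    exact ((memLp_map_measure_iff (by fun_prop) (hY j)).1 h2').const_inner u
  have hz (j : Fin n) : ∫ ω, ⟪u, Y j ω⟫ ∂P = 0 := by
    rw [← integral_map (f := fun x ↦ ⟪u, x⟫) (hY j) (by fun_prop), hν j,
      integral_inner_eq_zero h2 h0]
  have hv (j : Fin n) : Var[fun ω ↦ ⟪u, Y j ω⟫; P] = covarianceBilin ν u u := by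
    rw [variance_of_integral_eq_zero (hm j).1.aemeasurable (hz j),
      covarianceBilin_of_mean_zero h2 h0, ← hν j, integral_map (hY j) (by fun_prop)]
    simp [sq]
  have hvs := IndepFun.variance_sum (s := Finset.univ) (X := fun j ω ↦ ⟪u, Y j ω⟫) (μ := P)
    (fun j _ ↦ hm j) (fun i _ j _ hij ↦
      (hind.indepFun hij).comp (φ := fun x ↦ ⟪u, x⟫) (ψ := fun x ↦ ⟪u, x⟫)
        (by fun_prop) (by fun_prop))
  simp only [hv, Finset.sum_const, Finset.card_univ, Fintype.card_fin] at hvs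
  rw [variance_of_integral_eq_zero] at hvs
  · have e (ω : Ω) : ⟪u, normSum fun j ↦ Y j ω⟫ ^ 2
        = (n : ℝ)⁻¹ * (∑ j, fun ω ↦ ⟪u, Y j ω⟫) ω ^ 2 := by
      rw [normSum, real_inner_smul_right, inner_sum, mul_pow, inv_pow,
        Real.sq_sqrt (Nat.cast_nonneg n), Finset.sum_apply]
    simp only [e]
    rw [integral_const_mul, hvs, nsmul_eq_mul, inv_mul_cancel_left₀ (Nat.cast_ne_zero.2 hn)]
  · exact Finset.aemeasurable_sum _ fun j _ ↦ (hm j).1.aemeasurable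
  · simp only [Finset.sum_apply]
    rw [integral_finsetSum _ fun j _ ↦ (hm j).integrable one_le_two]
    simp [hz]

/-- Parseval reduces the claim to single coordinates, where variances of independent summands add.
-/
lemma integral_norm_normSum_sq (hn : n ≠ 0) (hind : iIndepFun Y P)
    (hY : ∀ j, AEMeasurable (Y j) P) (hν : ∀ j, P.map (Y j) = ν)
    (h2 : MemLp id 2 ν) (h0 : ∫ x, x ∂ν = 0) :
    ∫ ω, ‖normSum fun j ↦ Y j ω‖ ^ 2 ∂P = ∫ x, ‖x‖ ^ 2 ∂ν := by
  obtain ⟨w, b, hw⟩ := exists_countable_hilbertBasis E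
  have hS := aemeasurable_normSum hY
  have hS2 : MemLp id 2 (P.map fun ω ↦ normSum fun j ↦ Y j ω) :=
    (memLp_map_measure_iff (by fun_prop) hS).2 (memLp_normSum hY hν h2)
  have h1 := hasSum_integral_inner_sq hS2 b
  have h3 := hasSum_integral_inner_sq h2 b
  rw [integral_map hS (by fun_prop)] at h1
  refine h1.unique (h3.congr_fun fun i ↦ ?_)
  rw [integral_map hS (by fun_prop), integral_inner_normSum_sq hn hind hY hν h2 h0,
    covarianceBilin_of_mean_zero h2 h0]
  simp [sq]

end CentralLimit

/-! ### Central limit theorem for triangular arrays in a Hilbert space. -/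

section HilbertCLT

variable {E : Type*} [NormedAddCommGroup E] [InnerProductSpace ℝ E] [MeasurableSpace E]
  [BorelSpace E] [SecondCountableTopology E] [CompleteSpace E]
  {Ωb : ℕ → Type*} [∀ n, MeasurableSpace (Ωb n)] {Pb : (n : ℕ) → Measure (Ωb n)}
  [∀ n, IsProbabilityMeasure (Pb n)] {Y : (n : ℕ) → Fin n → Ωb n → E}
  {ν : ℕ → Measure E} [∀ n, IsProbabilityMeasure (ν n)] {γ : Measure E}

/-- The coordinates along finitely many vectors of a Hilbert basis. -/
def coordMap {ι : Type*} (b : HilbertBasis ι ℝ E) (s : Finset ι) : E →L[ℝ] EuclideanSpace ℝ s :=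
  (EuclideanSpace.equiv s ℝ).symm.toContinuousLinearMap ∘L
    ContinuousLinearMap.pi fun i : s ↦ innerSL ℝ (b i)

lemma norm_coordMap_sq {ι : Type*} (b : HilbertBasis ι ℝ E) (s : Finset ι) (x : E) :
    ‖coordMap b s x‖ ^ 2 = ∑ i ∈ s, ⟪b i, x⟫ ^ 2 := by
  rw [EuclideanSpace.norm_sq_eq, ← Finset.sum_coe_sort s]
  refine Finset.sum_congr rfl fun i _ ↦ ?_
  simp [coordMap]

lemma norm_coordMap_sq_le {ι : Type*} (b : HilbertBasis ι ℝ E) (s : Finset ι) (x : E) :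
    ‖coordMap b s x‖ ^ 2 ≤ ‖x‖ ^ 2 := by
  rw [norm_coordMap_sq]
  refine (Finset.sum_congr rfl fun i _ ↦ ?_).trans_le (b.orthonormal.sum_inner_products_le x)
  simp

/-- By Bessel the difference is nonnegative, so the absolute value can be dropped and the truncation
error in mean is trace minus partial trace. -/
lemma integral_norm_sq_sub_coordMap {ι : Type*} (b : HilbertBasis ι ℝ E) (s : Finset ι)
    {Ω : Type*} [MeasurableSpace Ω] {P : Measure Ω} [IsProbabilityMeasure P] {Z : Ω → E}
    (hZ : MemLp Z 2 P) : Integrable (fun ω ↦ ‖Z ω‖ ^ 2 - ‖coordMap b s (Z ω)‖ ^ 2) P ∧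
      ∫ ω, |‖Z ω‖ ^ 2 - ‖coordMap b s (Z ω)‖ ^ 2| ∂P
        = ∫ ω, ‖Z ω‖ ^ 2 ∂P - ∑ i ∈ s, ∫ ω, ⟪b i, Z ω⟫ ^ 2 ∂P := by
  have h4 : Integrable (fun ω ↦ ‖Z ω‖ ^ 2) P := hZ.integrable_norm_pow two_ne_zero
  have h5 (i : ι) : Integrable (fun ω ↦ ⟪b i, Z ω⟫ ^ 2) P := (hZ.const_inner (b i)).integrable_sq
  have h6 : Integrable (fun ω ↦ ‖coordMap b s (Z ω)‖ ^ 2) P := by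
    simp only [norm_coordMap_sq]
    exact integrable_finsetSum _ fun i _ ↦ h5 i
  refine ⟨h4.sub h6, ?_⟩
  simp only [fun ω ↦ abs_of_nonneg (sub_nonneg.2 (norm_coordMap_sq_le b s (Z ω)))]
  rw [integral_sub h4 h6]
  simp only [norm_coordMap_sq]
  rw [integral_finsetSum _ fun i _ ↦ h5 i]

/-- With `φ` the characteristic function of one summand, `n (φ(u/√n) - 1)` tends to minus half the
limiting variance, since the uniform third moment bound makes the Taylor error `O(n^{-1/2})`. Then
`(1 + z_n/n)^n → e^z` when `z_n → z`. -/
lemma tendsto_charFun_normSum [IsGaussian γ] (hind : ∀ n, iIndepFun (Y n) (Pb n))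
    (hY : ∀ n j, AEMeasurable (Y n j) (Pb n)) (hν : ∀ n j, (Pb n).map (Y n j) = ν n)
    (h3 : ∀ n, MemLp id 3 (ν n)) (h0 : ∀ n, ∫ x, x ∂(ν n) = 0)
    {C : ℝ} (hC : ∀ n, ∫ x, ‖x‖ ^ 3 ∂(ν n) ≤ C) (hγ : ∫ x, x ∂γ = 0)
    (hcov : ∀ u, Tendsto (fun n ↦ covarianceBilin (ν n) u u) atTop (𝓝 (covarianceBilin γ u u)))
    (u : E) :
    Tendsto (fun n ↦ charFun ((Pb n).map fun ω ↦ normSum fun j ↦ Y n j ω) u) atTop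
      (𝓝 (charFun γ u)) := by
  simp only [fun n ↦ charFun_map_normSum (hind n) (hY n) (hν n) u]
  have hγ' : γ[id] = 0 := hγ
  rw [IsGaussian.charFun_eq', hγ', inner_zero_right]
  have key : Tendsto (fun n : ℕ ↦ (n : ℂ) * (charFun (ν n) ((√(n : ℝ))⁻¹ • u) - 1)) atTop
      (𝓝 ((0 : ℝ) * Complex.I - covarianceBilin γ u u / 2)) := by
    have h1 : Tendsto (fun n : ℕ ↦ (n : ℂ) * (charFun (ν n) ((√(n : ℝ))⁻¹ • u)
        - (1 - covarianceBilin (ν n) ((√(n : ℝ))⁻¹ • u) ((√(n : ℝ))⁻¹ • u) / 2))) atTop (𝓝 0) := by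
      have h4 : Tendsto (fun n : ℕ ↦ 5 * ‖u‖ ^ 3 * C * (√(n : ℝ))⁻¹) atTop (𝓝 0) := by
        rw [← mul_zero (5 * ‖u‖ ^ 3 * C)]
        exact (tendsto_inv_atTop_zero.comp <| Real.tendsto_sqrt_atTop.comp
          tendsto_natCast_atTop_atTop).const_mul _
      refine squeeze_zero_norm (fun n ↦ ?_) h4
      rw [norm_mul, Complex.norm_natCast]
      have h5 := norm_charFun_sub_le (h3 n) (h0 n) ((√(n : ℝ))⁻¹ • u)
      rw [norm_smul, Real.norm_of_nonneg (by positivity)] at h5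
      rcases Nat.eq_zero_or_pos n with rfl | hn
      · simp
      have hs : 0 < √(n : ℝ) := Real.sqrt_pos.2 (by exact_mod_cast hn)
      have hsq : √(n : ℝ) ^ 2 = n := Real.sq_sqrt (Nat.cast_nonneg n)
      calc _ ≤ (n : ℝ) * (5 * ((√(n : ℝ))⁻¹ * ‖u‖) ^ 3 * C) := by
            refine mul_le_mul_of_nonneg_left (h5.trans ?_) (Nat.cast_nonneg n)
            exact mul_le_mul_of_nonneg_left (hC n) (by positivity)
        _ = 5 * ‖u‖ ^ 3 * C * (√(n : ℝ))⁻¹ := by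
            nth_rewrite 1 [← hsq]
            field_simp
    have h2 : Tendsto (fun n : ℕ ↦ -((covarianceBilin (ν n) u u : ℝ) : ℂ) / 2) atTop
        (𝓝 ((0 : ℝ) * Complex.I - covarianceBilin γ u u / 2)) := by
      have h6 : ((0 : ℝ) * Complex.I - covarianceBilin γ u u / 2 : ℂ)
          = -((covarianceBilin γ u u : ℝ) : ℂ) / 2 := by
        push_cast; ring
      rw [h6]
      have h7 : Continuous fun r : ℝ ↦ -(r : ℂ) / 2 := by fun_prop
      exact (h7.tendsto _).comp (hcov u)
    have h8 := h1.add h2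
    rw [zero_add] at h8
    refine h8.congr' ?_
    filter_upwards [eventually_ne_atTop 0] with n hn
    have hs : ((√(n : ℝ))⁻¹ : ℝ) * (√(n : ℝ))⁻¹ = (n : ℝ)⁻¹ := by
      rw [← mul_inv, Real.mul_self_sqrt (Nat.cast_nonneg n)]
    have hn' : (n : ℂ) ≠ 0 := Nat.cast_ne_zero.2 hn
    have h9 : covarianceBilin (ν n) ((√(n : ℝ))⁻¹ • u) ((√(n : ℝ))⁻¹ • u)
        = (n : ℝ)⁻¹ * covarianceBilin (ν n) u u := by
      rw [← hs]
      simp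
      ring
    rw [h9]
    push_cast
    field_simp
    ring
  have h := Complex.tendsto_one_add_pow_exp_of_tendsto key
  simpa using h

/-- **Central limit theorem** for the squared norm of normalized sums of a triangular array of
rowwise iid random elements of a separable Hilbert space. -/
theorem tendstoInDistribution_norm_normSum_sq [IsGaussian γ]
    (hind : ∀ n, iIndepFun (Y n) (Pb n))
    (hY : ∀ n j, AEMeasurable (Y n j) (Pb n)) (hν : ∀ n j, (Pb n).map (Y n j) = ν n)
    (h3 : ∀ n, MemLp id 3 (ν n)) (h0 : ∀ n, ∫ x, x ∂(ν n) = 0)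
    {C : ℝ} (hC : ∀ n, ∫ x, ‖x‖ ^ 3 ∂(ν n) ≤ C) (hγ : ∫ x, x ∂γ = 0)
    (hcov : ∀ u, Tendsto (fun n ↦ covarianceBilin (ν n) u u) atTop (𝓝 (covarianceBilin γ u u)))
    (htr : Tendsto (fun n ↦ ∫ x, ‖x‖ ^ 2 ∂(ν n)) atTop (𝓝 (∫ x, ‖x‖ ^ 2 ∂γ))) :
    TendstoInDistribution (fun n (ω : Ωb n) ↦ ‖normSum fun j ↦ Y n j ω‖ ^ 2) atTop
      (fun x : E ↦ ‖x‖ ^ 2) Pb γ := by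
  obtain ⟨w, b, hw⟩ := exists_countable_hilbertBasis E
  have hS (n : ℕ) := aemeasurable_normSum (hY n)
  have h2 (n : ℕ) : MemLp id 2 (ν n) := (h3 n).mono_exponent (by norm_num)
  have hγ2 : MemLp id 2 γ := IsGaussian.memLp_two_id
  refine tendstoInDistribution_of_approx (fun n ↦ (hS n).norm.pow_const 2) (by fun_prop)
    fun ε hε ↦ ?_
  have htrace := hasSum_integral_inner_sq hγ2 b
  -- Finitely many coordinates carry all but `ε` of the limiting trace.
  obtain ⟨s, hs⟩ := (htrace.eventually (lt_mem_nhds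
    (show ∫ x, ‖x‖ ^ 2 ∂γ - ε < ∫ x, ‖x‖ ^ 2 ∂γ by linarith))).exists
  let L := coordMap b s
  refine ⟨fun n ω ↦ ‖L (normSum fun j ↦ Y n j ω)‖ ^ 2, fun x ↦ ‖L x‖ ^ 2, ?_, ?_, ?_⟩
  · have hdist : TendstoInDistribution (fun n ω ↦ L (normSum fun j ↦ Y n j ω)) atTop
        (fun x ↦ L x) Pb γ := by
      refine ⟨fun n ↦ L.continuous.measurable.comp_aemeasurable (hS n), by fun_prop, ?_⟩
      refine ProbabilityMeasure.tendsto_iff_tendsto_charFun.2 fun t ↦ ?_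
      simp only [ProbabilityMeasure.coe_mk]
      have h7 := tendsto_charFun_normSum hind hY hν h3 h0 hC hγ hcov (L.adjoint t)
      have h8 : charFun (γ.map fun x ↦ L x) t = charFun γ (L.adjoint t) := by
        rw [charFun_map_apply (by fun_prop), charFun_apply]
        simp only [ContinuousLinearMap.adjoint_inner_right]
      rw [h8]
      refine h7.congr fun n ↦ ?_
      rw [charFun_map_apply (hS n), charFun_map_apply (X := fun ω ↦ L (normSum fun j ↦ Y n j ω))
        (L.continuous.measurable.comp_aemeasurable (hS n))]
      simp only [ContinuousLinearMap.adjoint_inner_right]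
    exact hdist.continuous_comp (g := fun y ↦ ‖y‖ ^ 2) (by fun_prop)
  -- Trace and partial trace both converge, so the mean of the discarded part is eventually below
  -- `ε`; this replaces a tightness argument.
  · have h9 : Tendsto (fun n ↦ ∫ x, ‖x‖ ^ 2 ∂(ν n) - ∑ i ∈ s, covarianceBilin (ν n) (b i) (b i))
        atTop (𝓝 (∫ x, ‖x‖ ^ 2 ∂γ - ∑ i ∈ s, covarianceBilin γ (b i) (b i))) :=
      htr.sub (tendsto_finsetSum _ fun i _ ↦ hcov (b i))
    have h10 : ∫ x, ‖x‖ ^ 2 ∂γ - ∑ i ∈ s, covarianceBilin γ (b i) (b i) < ε := by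
      simp only [covarianceBilin_of_mean_zero hγ2 hγ, ← sq]
      linarith
    filter_upwards [h9.eventually_lt_const h10, eventually_ne_atTop 0] with n hn hn0
    obtain ⟨h11, h12⟩ := integral_norm_sq_sub_coordMap b s (memLp_normSum (hY n) (hν n) (h2 n))
    refine ⟨h11, ?_⟩
    rw [h12, integral_norm_normSum_sq hn0 (hind n) (hY n) (hν n) (h2 n) (h0 n)]
    simp only [fun u ↦ integral_inner_normSum_sq hn0 (hind n) (hY n) (hν n) (h2 n) (h0 n) u]
    exact hn.le
  · obtain ⟨h11, h12⟩ := integral_norm_sq_sub_coordMap b s hγ2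
    refine ⟨h11, ?_⟩
    simp only [id] at h12
    rw [h12]
    linarith

end HilbertCLT

/-! ### Bookkeeping for integrals of linear combinations. -/

section HasMean

variable {α : Type*} [MeasurableSpace α] {μ : Measure α} {f g : α → ℝ} {a b : ℝ}

/-- `f` is integrable with integral `a`. -/
def HasMean (μ : Measure α) (f : α → ℝ) (a : ℝ) : Prop := Integrable f μ ∧ ∫ x, f x ∂μ = a

lemma HasMean.add (hf : HasMean μ f a) (hg : HasMean μ g b) :
    HasMean μ (fun x ↦ f x + g x) (a + b) :=
  ⟨hf.1.add hg.1, by rw [integral_add hf.1 hg.1, hf.2, hg.2]⟩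

lemma HasMean.sub (hf : HasMean μ f a) (hg : HasMean μ g b) :
    HasMean μ (fun x ↦ f x - g x) (a - b) :=
  ⟨hf.1.sub hg.1, by rw [integral_sub hf.1 hg.1, hf.2, hg.2]⟩

lemma HasMean.const_mul (hf : HasMean μ f a) (c : ℝ) : HasMean μ (fun x ↦ c * f x) (c * a) :=
  ⟨hf.1.const_mul c, by rw [integral_const_mul, hf.2]⟩

lemma HasMean.congr (hf : HasMean μ f a) (h : ∀ x, f x = g x) (hab : a = b) : HasMean μ g b := by
  obtain rfl : f = g := funext h
  rwa [← hab]

lemma hasMean_const [IsProbabilityMeasure μ] (c : ℝ) : HasMean μ (fun _ ↦ c) c :=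
  ⟨integrable_const c, by simp⟩

end HasMean

/-! ### The influence function and its moments under normal laws. -/

section StandardNormal

/-- The linear functional `z ↦ Re z + Im z`. -/
def reAddIm : ℂ →L[ℝ] ℝ := Complex.reCLM + Complex.imCLM

lemma reAddIm_apply (z : ℂ) : reAddIm z = z.re + z.im := rfl

lemma reAddIm_sq_le (z : ℂ) : reAddIm z ^ 2 ≤ 2 * ‖z‖ ^ 2 := by
  rw [reAddIm_apply, Complex.sq_norm, Complex.normSq_apply]
  nlinarith [sq_nonneg (z.re - z.im)]

/-- The influence function of the limiting process at a point where the projected law has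
variance `v`. -/
def score (v a : ℝ) : ℝ :=
  Real.cos a + Real.sin a - Real.exp (-v / 2) * (1 + a - (a ^ 2 - v) / 2)

/-- The factor `e^{-v/2}` absorbs the growth in `v`, through `e^{-v/2} v ≤ 2` and `e^{-v/2} √v ≤
3/2`. As the bound is free of `v`, the fourth moments of the influence function are bounded
uniformly over all directions and all covariances. -/
lemma abs_score_sqrt_mul_le {v : ℝ} (hv : 0 ≤ v) (x : ℝ) :
    |score v (√v * x)| ≤ 5 * (1 + x ^ 2) := by
  have h1 := Real.abs_cos_le_one (√v * x)
  have h2 := Real.abs_sin_le_one (√v * x)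
  have he : 0 < Real.exp (-v / 2) := Real.exp_pos _
  have he1 : Real.exp (-v / 2) ≤ 1 := Real.exp_le_one_iff.2 (by linarith)
  have hev : Real.exp (-v / 2) * v ≤ 2 := by
    have h3 := Real.add_one_le_exp (v / 2)
    have h4 : Real.exp (-v / 2) * Real.exp (v / 2) = 1 := by
      rw [← Real.exp_add, neg_div, neg_add_cancel, Real.exp_zero]
    nlinarith
  have hs : √v ^ 2 = v := Real.sq_sqrt hv
  have hs0 := Real.sqrt_nonneg v
  have hes : Real.exp (-v / 2) * √v ≤ 3 / 2 := by nlinarith [sq_nonneg (√v - 1)]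
  have hes0 : 0 ≤ Real.exp (-v / 2) * √v := by positivity
  have hev0 : 0 ≤ Real.exp (-v / 2) * v := by positivity
  have e : Real.exp (-v / 2) * (1 + √v * x - ((√v * x) ^ 2 - v) / 2)
      = Real.exp (-v / 2) + (Real.exp (-v / 2) * √v) * x
        - (Real.exp (-v / 2) * v) * (x ^ 2 - 1) / 2 := by
    rw [mul_pow, hs]; ring
  rw [score, e]
  set p := Real.exp (-v / 2) * √v
  set q := Real.exp (-v / 2) * v
  have hx : |p * x| ≤ 3 / 2 * ((1 + x ^ 2) / 2) := by
    rw [abs_mul, abs_of_nonneg hes0]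
    have : |x| ≤ (1 + x ^ 2) / 2 := by nlinarith [sq_nonneg (|x| - 1), sq_abs x]
    exact mul_le_mul hes this (abs_nonneg _) (by norm_num)
  have hq : |q * (x ^ 2 - 1)| ≤ 2 * (1 + x ^ 2) := by
    rw [abs_mul, abs_of_nonneg hev0]
    refine mul_le_mul hev ?_ (abs_nonneg _) (by norm_num)
    rw [abs_le]
    constructor <;> nlinarith [sq_nonneg x]
  rw [abs_le] at *
  constructor <;> nlinarith [sq_nonneg x]

lemma integral_gaussianReal_eq (v : NNReal) (g : ℝ → ℝ) (hg : Measurable g) :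
    ∫ x, g x ∂(gaussianReal 0 v) = ∫ x, g (√v * x) ∂(gaussianReal 0 1) := by
  have h := gaussianReal_map_const_mul (μ := 0) (v := 1) √v
  rw [mul_zero, mul_one] at h
  have h2 : NNReal.mk (√(v : ℝ) ^ 2) (sq_nonneg _) = v :=
    NNReal.eq (Real.sq_sqrt v.coe_nonneg)
  rw [h2] at h
  rw [← h, integral_map (by fun_prop) hg.aestronglyMeasurable]

lemma integrable_gaussianReal_iff (v : NNReal) (g : ℝ → ℝ) (hg : Measurable g) :
    Integrable g (gaussianReal 0 v) ↔ Integrable (fun x ↦ g (√v * x)) (gaussianReal 0 1) := by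
  have h := gaussianReal_map_const_mul (μ := 0) (v := 1) √v
  rw [mul_zero, mul_one] at h
  have h2 : NNReal.mk (√(v : ℝ) ^ 2) (sq_nonneg _) = v :=
    NNReal.eq (Real.sq_sqrt v.coe_nonneg)
  rw [h2] at h
  rw [← h, integrable_map_measure hg.aestronglyMeasurable (by fun_prop)]
  rfl

lemma integrable_abs_pow_gaussianReal (v : NNReal) (k : ℕ) :
    Integrable (fun x ↦ |x| ^ k) (gaussianReal 0 v) := by
  have h : MemLp id (k : ℝ≥0∞) (gaussianReal 0 v) := memLp_id_gaussianReal' _ (by simp)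
  exact h.integrable_norm_pow'

lemma integrable_pow_gaussianReal (v : NNReal) (k : ℕ) :
    Integrable (fun x ↦ x ^ k) (gaussianReal 0 v) :=
  (integrable_abs_pow_gaussianReal v k).mono' (by fun_prop) (ae_of_all _ fun x ↦ by simp)

/-- A bound for the fourth moment of the influence function, uniform in the variance. -/
def scoreBound : ℝ := ∫ x, (5 * (1 + x ^ 2)) ^ 4 ∂(gaussianReal 0 1)

lemma integrable_scoreBound :
    Integrable (fun x : ℝ ↦ (5 * (1 + x ^ 2)) ^ 4) (gaussianReal 0 1) := by
  have h (k : ℕ) := integrable_pow_gaussianReal 1 k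
  have e : (fun x : ℝ ↦ (5 * (1 + x ^ 2)) ^ 4) = fun x ↦
      625 * x ^ 0 + 2500 * x ^ 2 + 3750 * x ^ 4 + 2500 * x ^ 6 + 625 * x ^ 8 := by
    ext x; ring
  rw [e]
  exact (((((h 0).const_mul 625).add ((h 2).const_mul 2500)).add ((h 4).const_mul 3750)).add
    ((h 6).const_mul 2500)).add ((h 8).const_mul 625)

@[fun_prop]
lemma continuous_score {X : Type*} [TopologicalSpace X] {f g : X → ℝ} (hf : Continuous f)
    (hg : Continuous g) : Continuous fun x ↦ score (f x) (g x) := by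
  unfold score
  fun_prop

@[fun_prop]
lemma measurable_score (v : ℝ) : Measurable (score v) :=
  (by fun_prop : Continuous fun x ↦ score v x).measurable

lemma integrable_score_pow_four (v : NNReal) :
    Integrable (fun x ↦ score v x ^ 4) (gaussianReal 0 v) := by
  have hm := measurable_score v
  rw [integrable_gaussianReal_iff v _ (by fun_prop)]
  refine integrable_scoreBound.mono' (Continuous.aestronglyMeasurable (by fun_prop)) (ae_of_all _ fun x ↦ ?_)
  rw [norm_pow, Real.norm_eq_abs]
  gcongr
  exact abs_score_sqrt_mul_le v.coe_nonneg x

lemma integral_score_pow_four_le (v : NNReal) :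
    ∫ x, score v x ^ 4 ∂(gaussianReal 0 v) ≤ scoreBound := by
  have hm := measurable_score v
  have h := integrable_score_pow_four v
  rw [integrable_gaussianReal_iff v _ (by fun_prop)] at h
  rw [integral_gaussianReal_eq v _ (by fun_prop)]
  refine integral_mono h integrable_scoreBound fun x ↦ ?_
  rw [← Even.pow_abs (by decide : Even 4)]
  have := abs_score_sqrt_mul_le v.coe_nonneg x
  gcongr

end StandardNormal

/-! ### Moments of sums of independent centred variables. -/

section FourthMoment

variable {Ω : Type*} [MeasurableSpace Ω] {P : Measure Ω} [IsProbabilityMeasure P]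

lemma integrable_pow_of_memLp_four {X : Ω → ℝ} (hX : MemLp X 4 P) {k : ℕ} (hk : k ≤ 4) :
    Integrable (fun ω ↦ X ω ^ k) P := by
  have h : MemLp X (k : ℝ≥0∞) P := hX.mono_exponent (by exact_mod_cast hk)
  refine h.integrable_norm_pow'.mono' (by have := hX.1; fun_prop) (ae_of_all _ fun ω ↦ ?_)
  rw [norm_pow]

lemma hasMean_pow_mul_pow {X Y : Ω → ℝ} (hX : MemLp X 4 P) (hY : MemLp Y 4 P)
    (h : IndepFun X Y P) {k l : ℕ} (hk : k ≤ 4) (hl : l ≤ 4) :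
    HasMean P (fun ω ↦ X ω ^ k * Y ω ^ l) ((∫ ω, X ω ^ k ∂P) * ∫ ω, Y ω ^ l ∂P) := by
  have h1 := integrable_pow_of_memLp_four hX hk
  have h2 := integrable_pow_of_memLp_four hY hl
  have h3 : IndepFun (fun ω ↦ X ω ^ k) (fun ω ↦ Y ω ^ l) P :=
    h.comp (φ := fun x ↦ x ^ k) (ψ := fun x ↦ x ^ l) (by fun_prop) (by fun_prop)
  exact ⟨h3.integrable_mul h1 h2, h3.integral_fun_mul_eq_mul_integral h1.1 h2.1⟩

/-- This is nonnegativity of the variance of `X²`. -/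
lemma sq_integral_sq_le {X : Ω → ℝ} (hX : MemLp X 4 P) :
    (∫ ω, X ω ^ 2 ∂P) ^ 2 ≤ ∫ ω, X ω ^ 4 ∂P := by
  have h1 := integrable_pow_of_memLp_four hX (k := 2) (by norm_num)
  have h2 : MemLp (fun ω ↦ X ω ^ 2) 2 P := by
    rw [memLp_two_iff_integrable_sq h1.1]
    simpa only [← pow_mul] using integrable_pow_of_memLp_four hX (k := 4) le_rfl
  have h := variance_nonneg (fun ω ↦ X ω ^ 2) P
  rw [variance_eq_sub h2] at h
  simp only [Pi.pow_apply, ← pow_mul] at h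
  linarith

lemma integral_add_sq_of_indep {X Y : Ω → ℝ} (hX : MemLp X 4 P) (hY : MemLp Y 4 P)
    (h : IndepFun X Y P) (hY0 : ∫ ω, Y ω ∂P = 0) :
    ∫ ω, (X ω + Y ω) ^ 2 ∂P = ∫ ω, X ω ^ 2 ∂P + ∫ ω, Y ω ^ 2 ∂P := by
  have h20 := hasMean_pow_mul_pow hX hY h (k := 2) (l := 0) (by norm_num) (by norm_num)
  have h11 := hasMean_pow_mul_pow hX hY h (k := 1) (l := 1) (by norm_num) (by norm_num)
  have h02 := hasMean_pow_mul_pow hX hY h (k := 0) (l := 2) (by norm_num) (by norm_num)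
  refine (((h20.add (h11.const_mul 2)).add h02).congr (fun ω ↦ by ring) ?_).2
  simp [hY0]

lemma integral_add_pow_four_of_indep {X Y : Ω → ℝ} (hX : MemLp X 4 P) (hY : MemLp Y 4 P)
    (h : IndepFun X Y P) (hX0 : ∫ ω, X ω ∂P = 0) (hY0 : ∫ ω, Y ω ∂P = 0) :
    ∫ ω, (X ω + Y ω) ^ 4 ∂P
      = ∫ ω, X ω ^ 4 ∂P + 6 * ((∫ ω, X ω ^ 2 ∂P) * ∫ ω, Y ω ^ 2 ∂P) + ∫ ω, Y ω ^ 4 ∂P := by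
  have h40 := hasMean_pow_mul_pow hX hY h (k := 4) (l := 0) (by norm_num) (by norm_num)
  have h31 := hasMean_pow_mul_pow hX hY h (k := 3) (l := 1) (by norm_num) (by norm_num)
  have h22 := hasMean_pow_mul_pow hX hY h (k := 2) (l := 2) (by norm_num) (by norm_num)
  have h13 := hasMean_pow_mul_pow hX hY h (k := 1) (l := 3) (by norm_num) (by norm_num)
  have h04 := hasMean_pow_mul_pow hX hY h (k := 0) (l := 4) (by norm_num) (by norm_num)
  refine (((((h40.add (h31.const_mul 4)).add (h22.const_mul 6)).add (h13.const_mul 4)).add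
    h04).congr (fun ω ↦ by ring) ?_).2
  simp [hX0, hY0]

/-- The second and fourth moments of sums of independent centred variables. -/
lemma moments_sum_of_iIndepFun {ι : Type*} {Y : ι → Ω → ℝ} (hind : iIndepFun Y P)
    (hY : ∀ j, MemLp (Y j) 4 P) (h0 : ∀ j, ∫ ω, Y j ω ∂P = 0) {m₂ m₄ : ℝ}
    (h2 : ∀ j, ∫ ω, Y j ω ^ 2 ∂P = m₂) (h4 : ∀ j, ∫ ω, Y j ω ^ 4 ∂P = m₄) (s : Finset ι) :
    ∫ ω, (∑ j ∈ s, Y j ω) ^ 2 ∂P = s.card * m₂ ∧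
      ∫ ω, (∑ j ∈ s, Y j ω) ^ 4 ∂P ≤ 3 * s.card ^ 2 * m₄ := by
  classical
  induction s using Finset.induction_on with
  | empty => simp
  | insert j s hj ih =>
    have hS : MemLp (fun ω ↦ ∑ j ∈ s, Y j ω) 4 P := memLp_finsetSum s fun j _ ↦ hY j
    have hS0 : ∫ ω, ∑ j ∈ s, Y j ω ∂P = 0 := by
      rw [integral_finsetSum _ fun j _ ↦ (hY j).integrable (by norm_num)]
      simp [h0]
    have hSj : IndepFun (fun ω ↦ ∑ j ∈ s, Y j ω) (Y j) P := by
      have h := hind.indepFun_finsetSum_of_notMem₀ (fun j ↦ (hY j).1.aemeasurable) hj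
      convert h using 1
      ext ω
      simp
    have e (ω : Ω) : ∑ i ∈ insert j s, Y i ω = ∑ i ∈ s, Y i ω + Y j ω := by
      rw [Finset.sum_insert hj, add_comm]
    have h5 := sq_integral_sq_le (hY j)
    rw [h2, h4] at h5
    simp only [e, Finset.card_insert_of_notMem hj]
    refine ⟨?_, ?_⟩
    · rw [integral_add_sq_of_indep hS (hY j) hSj (h0 j), ih.1, h2]
      push_cast
      ring
    · rw [integral_add_pow_four_of_indep hS (hY j) hSj hS0 (h0 j), ih.1, h2, h4]
      have h6 := ih.2
      have h7 : (0 : ℝ) ≤ s.card := Nat.cast_nonneg _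
      -- With `k` the cardinality of `s`, the cross term `6 k m₂²` is at most `6 k m₄`, and `3k² +
      -- 6k + 1 ≤ 3(k + 1)²`.
      have h8 : (s.card : ℝ) * m₂ * m₂ ≤ s.card * m₄ := by nlinarith
      push_cast
      nlinarith [sq_nonneg m₂]

end FourthMoment

/-! ### Pathwise bounds for the linearization error. -/

section Remainder

lemma norm_exp_add_sub_exp_le {w : ℂ} {δ r : ℝ} (h : w.re + δ ≤ r) (hδ : 0 ≤ δ) :
    ‖Complex.exp (w + δ) - Complex.exp w‖ ≤ Real.exp r * δ := by
  have e : Complex.exp (w + δ) - Complex.exp w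
      = Complex.exp w * (((Real.exp δ - 1 : ℝ)) : ℂ) := by
    rw [Complex.exp_add]
    push_cast
    ring
  have h1 := Real.add_one_le_exp (-δ)
  have h2 : Real.exp (-δ) * Real.exp δ = 1 := by
    rw [← Real.exp_add, neg_add_cancel, Real.exp_zero]
  have h3 := Real.exp_pos δ
  have h4 : Real.exp δ - 1 ≤ Real.exp δ * δ := by nlinarith
  have h5 : 0 ≤ Real.exp δ - 1 := by linarith [Real.add_one_le_exp δ]
  rw [e, norm_mul, Complex.norm_exp, Complex.norm_real, Real.norm_of_nonneg h5]
  calc Real.exp w.re * (Real.exp δ - 1) ≤ Real.exp w.re * (Real.exp δ * δ) := by gcongr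
    _ = Real.exp (w.re + δ) * δ := by rw [Real.exp_add]; ring
    _ ≤ Real.exp r * δ := by gcongr

/-- Taylor for `‖w‖ ≤ 1`, the triangle inequality beyond. Both bounds are needed: the quadratic one
produces the rate in `n`, the linear one leads to a majorant that the fourth moment of `Q` can
integrate. -/
lemma norm_exp_sub_one_sub_le {w : ℂ} {r : ℝ} (hr : 0 ≤ r) (h : w.re ≤ r) :
    ‖Complex.exp w - 1 - w‖ ≤ Real.exp r * (3 * ‖w‖) ∧
      ‖Complex.exp w - 1 - w‖ ≤ Real.exp r * (3 * ‖w‖ ^ 2) := by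
  have hr1 : 1 ≤ Real.exp r := Real.one_le_exp hr
  rcases le_total ‖w‖ 1 with hw | hw
  · have h1 := Complex.norm_exp_sub_one_sub_id_le hw
    have h2 : ‖w‖ ^ 2 ≤ ‖w‖ := by nlinarith [norm_nonneg w]
    constructor <;> nlinarith [norm_nonneg w, sq_nonneg ‖w‖]
  · have h1 : ‖Complex.exp w - 1 - w‖ ≤ Real.exp r + 1 + ‖w‖ := by
      refine (norm_sub_le _ _).trans ?_
      gcongr
      refine (norm_sub_le _ _).trans ?_
      rw [norm_one, Complex.norm_exp]
      gcongr
    have h2 : ‖w‖ ≤ ‖w‖ ^ 2 := by nlinarith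
    constructor <;> nlinarith

variable {n : ℕ}

/-- The difference of the empirical and the fitted Gaussian characteristic functions at `1` of a
real sample. -/
def sampleDev (a : Fin n → ℝ) : ℂ :=
  (n : ℂ)⁻¹ * ∑ j, Complex.exp (Complex.I * (a j : ℝ)) -
    Complex.exp (Complex.I * ((n : ℝ)⁻¹ * ∑ j, a j : ℝ) -
      ((n : ℝ)⁻¹ * ∑ j, (a j - (n : ℝ)⁻¹ * ∑ j, a j) ^ 2 : ℝ) / 2)

/-- The error in the linearization of the normalized deviation. -/
def linError (v : ℝ) (a : Fin n → ℝ) : ℝ :=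
  √(n : ℝ) * reAddIm (sampleDev a) - (√(n : ℝ))⁻¹ * ∑ j, score v (a j)

lemma sum_sub_mean_sq (hn : n ≠ 0) (a : Fin n → ℝ) :
    (n : ℝ)⁻¹ * ∑ j, (a j - (n : ℝ)⁻¹ * ∑ j, a j) ^ 2
      = (n : ℝ)⁻¹ * ∑ j, a j ^ 2 - ((n : ℝ)⁻¹ * ∑ j, a j) ^ 2 := by
  have hn' : (n : ℝ) ≠ 0 := Nat.cast_ne_zero.2 hn
  set m := (n : ℝ)⁻¹ * ∑ j, a j with hm
  have hs : ∑ j, a j = n * m := by rw [hm, mul_inv_cancel_left₀ hn']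
  have e (j : Fin n) : (a j - m) ^ 2 = a j ^ 2 - (2 * m) * a j + m ^ 2 := by ring
  simp only [e, Finset.sum_add_distrib, Finset.sum_sub_distrib, ← Finset.mul_sum, hs]
  simp only [Finset.sum_const, Finset.card_univ, Fintype.card_fin, nsmul_eq_mul]
  field_simp
  ring

/-- Let `m` be the sample mean, `s` the mean of `a j ^ 2 - v`, and `w = i m - s/2`. The sample
variance is `v + s - m²`, so the fitted characteristic function equals `e^{-v/2} exp(w + m²/2)`,
while the scores correspond to its linearization `e^{-v/2} (1 + w)`. The error splits into `exp(w +
m²/2) - exp w` and `exp w - 1 - w`. -/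
lemma linError_sq_le (hn : n ≠ 0) {v : ℝ} (hv : 0 ≤ v) (a : Fin n → ℝ) :
    linError v a ^ 2 ≤ n * (((n : ℝ)⁻¹ * ∑ j, a j) ^ 4 + 36 *
        (((n : ℝ)⁻¹ * ∑ j, a j) ^ 2 + ((n : ℝ)⁻¹ * ∑ j, (a j ^ 2 - v)) ^ 2 / 4)) ∧
      linError v a ^ 2 ≤ n * (((n : ℝ)⁻¹ * ∑ j, a j) ^ 4 + 36 *
        (((n : ℝ)⁻¹ * ∑ j, a j) ^ 2 + ((n : ℝ)⁻¹ * ∑ j, (a j ^ 2 - v)) ^ 2 / 4) ^ 2) := by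
  have hn' : (n : ℝ) ≠ 0 := Nat.cast_ne_zero.2 hn
  have hn0 : (0 : ℝ) ≤ n := Nat.cast_nonneg n
  have hvar := sum_sub_mean_sq hn a
  have hvar0 : 0 ≤ (n : ℝ)⁻¹ * ∑ j, (a j - (n : ℝ)⁻¹ * ∑ j, a j) ^ 2 :=
    mul_nonneg (by positivity) (Finset.sum_nonneg fun j _ ↦ sq_nonneg _)
  have hq0 : 0 ≤ (n : ℝ)⁻¹ * ∑ j, a j ^ 2 :=
    mul_nonneg (by positivity) (Finset.sum_nonneg fun j _ ↦ sq_nonneg _)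
  have hb : (n : ℝ)⁻¹ * ∑ j, (a j ^ 2 - v) = (n : ℝ)⁻¹ * ∑ j, a j ^ 2 - v := by
    rw [Finset.sum_sub_distrib, mul_sub]
    simp [hn']
  have hscore : (√(n : ℝ))⁻¹ * ∑ j, score v (a j) = √(n : ℝ) * reAddIm
      ((n : ℂ)⁻¹ * ∑ j, Complex.exp (Complex.I * (a j : ℝ)) - (Real.exp (-v / 2) : ℂ) *
        (1 + (Complex.I * ((n : ℝ)⁻¹ * ∑ j, a j : ℝ)
          - ((n : ℝ)⁻¹ * ∑ j, (a j ^ 2 - v) : ℝ) / 2))) := by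
    have h1 : (√(n : ℝ))⁻¹ = √(n : ℝ) * (n : ℝ)⁻¹ := by
      rw [← div_eq_mul_inv, Real.sqrt_div_self', one_div]
    have h2 (j : Fin n) : score v (a j) = reAddIm (Complex.exp (Complex.I * (a j : ℝ))
        - (Real.exp (-v / 2) : ℂ) * (1 + (Complex.I * (a j : ℝ) - ((a j ^ 2 - v : ℝ) : ℂ) / 2))) := by
      rw [reAddIm_apply, mul_comm Complex.I, Complex.exp_mul_I, ← Complex.ofReal_cos,
        ← Complex.ofReal_sin, score]
      have h3 : ((Real.exp (-v / 2) : ℂ) * (1 + ((a j : ℝ) * Complex.I - ((a j ^ 2 - v : ℝ) : ℂ) / 2)))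
          = ((Real.exp (-v / 2) * (1 - (a j ^ 2 - v) / 2) : ℝ) : ℂ)
            + ((Real.exp (-v / 2) * a j : ℝ) : ℂ) * Complex.I := by
        push_cast; ring
      rw [h3]
      simp only [Complex.sub_re, Complex.sub_im, Complex.add_re, Complex.add_im,
        Complex.ofReal_re, Complex.ofReal_im, Complex.re_ofReal_mul, Complex.im_ofReal_mul,
        Complex.I_re, Complex.I_im]
      ring
    rw [h1, mul_assoc]
    congr 1
    simp only [h2]
    rw [← map_sum, ← smul_eq_mul, ← map_smul]
    congr 1
    rw [Finset.sum_sub_distrib, ← Finset.mul_sum, Finset.sum_add_distrib, Finset.sum_sub_distrib,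
      ← Finset.mul_sum, ← Finset.sum_div]
    simp only [Finset.sum_const, Finset.card_univ, Fintype.card_fin, nsmul_eq_mul, mul_one,
      Complex.real_smul]
    have hn'' : (n : ℂ) ≠ 0 := Nat.cast_ne_zero.2 hn
    push_cast
    field_simp
  set m := (n : ℝ)⁻¹ * ∑ j, a j with hm
  set q := (n : ℝ)⁻¹ * ∑ j, a j ^ 2 with hq
  set s := (n : ℝ)⁻¹ * ∑ j, (a j ^ 2 - v) with hs
  set w : ℂ := Complex.I * (m : ℝ) - (s : ℝ) / 2 with hw
  have hwre : w.re = -s / 2 := by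
    rw [hw, show (Complex.I * (m : ℝ) - (s : ℝ) / 2 : ℂ)
      = ((-s / 2 : ℝ) : ℂ) + (m : ℝ) * Complex.I by push_cast; ring]
    simp [neg_div]
  have hwn : ‖w‖ ^ 2 = m ^ 2 + s ^ 2 / 4 := by
    rw [hw, show (Complex.I * (m : ℝ) - (s : ℝ) / 2 : ℂ)
      = ((-s / 2 : ℝ) : ℂ) + (m : ℝ) * Complex.I by push_cast; ring, Complex.sq_norm,
      Complex.normSq_add_mul_I]
    ring
  -- `Re w + m²/2` is half of `v` minus the sample variance, hence at most `v/2`. The resulting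
  -- `e^{v/2}` cancels against `e^{-v/2}`, so no exponential moments of `Q` are needed.
  have h1 := norm_exp_add_sub_exp_le (w := w) (δ := m ^ 2 / 2) (r := v / 2)
    (by rw [hwre]; linarith) (by positivity)
  have h2 := norm_exp_sub_one_sub_le (w := w) (r := v / 2) (by positivity)
    (by rw [hwre]; linarith)
  set z : ℂ := Complex.exp (Complex.I * (m : ℝ)
    - ((n : ℝ)⁻¹ * ∑ j, (a j - m) ^ 2 : ℝ) / 2) with hz
  have hzw : z = (Real.exp (-v / 2) : ℂ) * Complex.exp (w + ((m ^ 2 / 2 : ℝ) : ℂ)) := by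
    rw [hz, hvar, Complex.ofReal_exp, ← Complex.exp_add, hw, hb]
    congr 1
    push_cast
    ring
  have hev : Real.exp (-v / 2) * Real.exp (v / 2) = 1 := by
    rw [← Real.exp_add, neg_div, neg_add_cancel, Real.exp_zero]
  have herr : linError v a = √(n : ℝ) * reAddIm ((Real.exp (-v / 2) : ℂ) * (1 + w) - z) := by
    rw [linError, hscore, ← mul_sub, ← map_sub, sampleDev, ← hm, ← hz]
    congr 2
    ring
  have hsq : linError v a ^ 2 ≤ n * (2 * ‖(Real.exp (-v / 2) : ℂ) * (1 + w) - z‖ ^ 2) := by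
    rw [herr, mul_pow, Real.sq_sqrt hn0]
    gcongr
    exact reAddIm_sq_le _
  have hbound (B : ℝ) (hB : ‖Complex.exp w - 1 - w‖ ≤ Real.exp (v / 2) * B) :
      ‖(Real.exp (-v / 2) : ℂ) * (1 + w) - z‖ ≤ m ^ 2 / 2 + B := by
    rw [hzw, ← mul_sub, norm_mul, Complex.norm_real, Real.norm_of_nonneg (Real.exp_pos _).le]
    have e : 1 + w - Complex.exp (w + ((m ^ 2 / 2 : ℝ) : ℂ))
        = -((Complex.exp (w + ((m ^ 2 / 2 : ℝ) : ℂ)) - Complex.exp w)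
          + (Complex.exp w - 1 - w)) := by ring
    rw [e, norm_neg]
    calc _ ≤ Real.exp (-v / 2) * (Real.exp (v / 2) * (m ^ 2 / 2) + Real.exp (v / 2) * B) := by
          gcongr
          exact (norm_add_le _ _).trans (add_le_add h1 hB)
      _ = (Real.exp (-v / 2) * Real.exp (v / 2)) * (m ^ 2 / 2 + B) := by ring
      _ = _ := by rw [hev, one_mul]
  have hfin (B : ℝ) (hB0 : 0 ≤ B) (hB : ‖Complex.exp w - 1 - w‖ ≤ Real.exp (v / 2) * B) :
      linError v a ^ 2 ≤ n * (m ^ 4 + 4 * B ^ 2) := by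
    refine hsq.trans ?_
    gcongr
    -- `2 (m²/2 + B)² ≤ m⁴ + 4 B²`; the choices `B = 3‖w‖` and `B = 3‖w‖²` then give the factor
    -- `36`.
    have h3 := pow_le_pow_left₀ (norm_nonneg _) (hbound B hB) 2
    nlinarith [sq_nonneg (m ^ 2 / 2 - B)]
  constructor
  · refine (hfin _ (by positivity) h2.1).trans_eq ?_
    rw [mul_pow 3, hwn]
    ring
  · refine (hfin _ (by positivity) h2.2).trans_eq ?_
    rw [mul_pow 3, hwn]
    ring

end Remainder

instance instSecondCountableTopologyL2 {α : Type*} [MeasurableSpace α]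
    [MeasurableSpace.CountablyGenerated α] (μ : Measure α) [SFinite μ] :
    SecondCountableTopology (Lp ℝ 2 μ) :=
  haveI : Fact ((2 : ℝ≥0∞) ≠ ∞) := ⟨by simp⟩
  inferInstance

/-! ### Mean square of the linearization error for normal samples. -/

section LinErrorMoments

/-- A constant bounding the mean square of the linearization error. -/
def linBound : ℝ :=
  219 * ∫ x, x ^ 4 ∂(gaussianReal 0 1) + 36 + 9 * ∫ x, (x ^ 2 - 1) ^ 2 ∂(gaussianReal 0 1)
    + 14 * ∫ x, (x ^ 2 - 1) ^ 4 ∂(gaussianReal 0 1)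

lemma integrable_sq_sub_pow_gaussianReal (v : NNReal) (c : ℝ) :
    Integrable (fun x ↦ (x ^ 2 - c) ^ 4) (gaussianReal 0 v) := by
  have h (k : ℕ) := integrable_pow_gaussianReal v k
  have e : (fun x : ℝ ↦ (x ^ 2 - c) ^ 4) = fun x ↦
      x ^ 8 - 4 * c * x ^ 6 + 6 * c ^ 2 * x ^ 4 - 4 * c ^ 3 * x ^ 2 + c ^ 4 := by
    ext x; ring
  rw [e]
  exact (((((h 8).sub ((h 6).const_mul _)).add ((h 4).const_mul _)).sub ((h 2).const_mul _))).add
    (integrable_const _)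

variable {Ω : Type*} [MeasurableSpace Ω] {P : Measure Ω} [IsProbabilityMeasure P] {n : ℕ}

lemma continuous_sampleDev : Continuous fun a : Fin n → ℝ ↦ sampleDev a := by
  unfold sampleDev
  fun_prop

lemma continuous_linError {X : Type*} [TopologicalSpace X] {f : X → ℝ} {g : X → Fin n → ℝ}
    (hf : Continuous f) (hg : Continuous g) : Continuous fun x ↦ linError (f x) (g x) := by
  unfold linError
  have h := continuous_sampleDev.comp hg
  have h1 (j : Fin n) : Continuous fun x ↦ g x j := (continuous_apply j).comp hg
  simp only [Function.comp_def] at h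
  fun_prop

lemma memLp_four_of_integrable {X : Ω → ℝ} (hm : AEMeasurable X P)
    (h : Integrable (fun ω ↦ X ω ^ 4) P) : MemLp X 4 P := by
  rw [← integrable_norm_rpow_iff hm.aestronglyMeasurable (by norm_num) (by norm_num)]
  refine h.congr (ae_of_all _ fun ω ↦ ?_)
  have : (4 : ℝ≥0∞).toReal = (4 : ℕ) := by norm_num
  simp only [this, Real.rpow_natCast, Real.norm_eq_abs]
  rw [Even.pow_abs (by decide)]

/-- The linearization error of a normal sample is small in mean square. -/
lemma integral_linError_sq_le (hn : n ≠ 0) {v : NNReal} {a : Fin n → Ω → ℝ}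
    (ha : ∀ j, AEMeasurable (a j) P) (hind : iIndepFun a P)
    (hlaw : ∀ j, P.map (a j) = gaussianReal 0 v) :
    Integrable (fun ω ↦ linError v (fun j ↦ a j ω) ^ 2) P ∧
      ∫ ω, linError v (fun j ↦ a j ω) ^ 2 ∂P ≤ linBound * (v + v ^ 2) ∧
      ∫ ω, linError v (fun j ↦ a j ω) ^ 2 ∂P ≤ linBound * (v ^ 2 + v ^ 4) / n := by
  have hn0 : (n : ℝ) ≠ 0 := Nat.cast_ne_zero.2 hn
  have hnpos : (0 : ℝ) < n := by positivity
  have hn1 : (1 : ℝ) ≤ n := by exact_mod_cast Nat.one_le_iff_ne_zero.2 hn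
  have hvs : √(v : ℝ) ^ 2 = v := Real.sq_sqrt v.coe_nonneg
  have hv0 : (0 : ℝ) ≤ v := v.coe_nonneg
  have htr (j : Fin n) (g : ℝ → ℝ) (hg : Measurable g) :
      ∫ ω, g (a j ω) ∂P = ∫ x, g (√v * x) ∂(gaussianReal 0 1) := by
    rw [← integral_gaussianReal_eq v g hg, ← hlaw j,
      integral_map (ha j) hg.aestronglyMeasurable]
  have hint (j : Fin n) (g : ℝ → ℝ) (hg : Measurable g) (h : Integrable g (gaussianReal 0 v)) :
      Integrable (fun ω ↦ g (a j ω)) P := by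
    rw [← hlaw j] at h
    exact (integrable_map_measure hg.aestronglyMeasurable (ha j)).1 h
  set m4 := ∫ x, x ^ 4 ∂(gaussianReal 0 1) with hm4
  set k2 := ∫ x, (x ^ 2 - 1) ^ 2 ∂(gaussianReal 0 1) with hk2
  set k4 := ∫ x, (x ^ 2 - 1) ^ 4 ∂(gaussianReal 0 1) with hk4
  have hm40 : 0 ≤ m4 := integral_nonneg fun x ↦ by positivity
  have hk20 : 0 ≤ k2 := integral_nonneg fun x ↦ by positivity
  have hk40 : 0 ≤ k4 := integral_nonneg fun x ↦ by positivity
  have hA4 (j : Fin n) : MemLp (a j) 4 P := memLp_four_of_integrable (ha j)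
    (hint j (fun x ↦ x ^ 4) (by fun_prop) (integrable_pow_gaussianReal v 4))
  have hB4 (j : Fin n) : MemLp (fun ω ↦ a j ω ^ 2 - v) 4 P :=
    memLp_four_of_integrable (by have := ha j; fun_prop)
      (hint j (fun x ↦ (x ^ 2 - v) ^ 4) (by fun_prop) (integrable_sq_sub_pow_gaussianReal v v))
  have hA0 (j : Fin n) : ∫ ω, a j ω ∂P = 0 := by
    rw [htr j (fun x ↦ x) (by fun_prop), integral_const_mul, integral_id_gaussianReal, mul_zero]
  have hA2 (j : Fin n) : ∫ ω, a j ω ^ 2 ∂P = v := by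
    rw [htr j (fun x ↦ x ^ 2) (by fun_prop)]
    simp only [mul_pow, hvs]
    rw [integral_const_mul, integral_sq_gaussianReal]
    simp
  have hA4' (j : Fin n) : ∫ ω, a j ω ^ 4 ∂P = v ^ 2 * m4 := by
    rw [htr j (fun x ↦ x ^ 4) (by fun_prop), hm4, ← integral_const_mul]
    refine integral_congr_ae (ae_of_all _ fun x ↦ ?_)
    simp only
    rw [mul_pow, show √(v : ℝ) ^ 4 = (√(v : ℝ) ^ 2) ^ 2 by ring, hvs]
  have hB0 (j : Fin n) : ∫ ω, (a j ω ^ 2 - v) ∂P = 0 := by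
    rw [integral_sub (hint j (fun x ↦ x ^ 2) (by fun_prop) (integrable_pow_gaussianReal v 2))
      (integrable_const _), hA2]
    simp
  have hBpow (j : Fin n) (k : ℕ) : ∫ ω, (a j ω ^ 2 - v) ^ k ∂P
      = v ^ k * ∫ x, (x ^ 2 - 1) ^ k ∂(gaussianReal 0 1) := by
    rw [htr j (fun x ↦ (x ^ 2 - v) ^ k) (by fun_prop), ← integral_const_mul]
    refine integral_congr_ae (ae_of_all _ fun x ↦ ?_)
    simp only
    rw [mul_pow, hvs, ← mul_pow]
    ring
  obtain ⟨hS2, hS4⟩ := moments_sum_of_iIndepFun hind hA4 hA0 hA2 hA4' Finset.univ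
  have hindB : iIndepFun (fun j ω ↦ a j ω ^ 2 - v) P :=
    hind.comp (fun _ x ↦ x ^ 2 - v) (by fun_prop)
  obtain ⟨hT2, hT4⟩ := moments_sum_of_iIndepFun hindB hB4 hB0 (fun j ↦ hBpow j 2)
    (fun j ↦ hBpow j 4) Finset.univ
  rw [← hk2] at hT2
  rw [← hk4] at hT4
  simp only [Finset.card_univ, Fintype.card_fin] at hS2 hS4 hT2 hT4
  have hSm : MemLp (fun ω ↦ ∑ j, a j ω) 4 P := memLp_finsetSum _ fun j _ ↦ hA4 j
  have hTm : MemLp (fun ω ↦ ∑ j, (a j ω ^ 2 - v)) 4 P := memLp_finsetSum _ fun j _ ↦ hB4 j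
  have iS2 := integrable_pow_of_memLp_four hSm (k := 2) (by norm_num)
  have iS4 := integrable_pow_of_memLp_four hSm (k := 4) le_rfl
  have iT2 := integrable_pow_of_memLp_four hTm (k := 2) (by norm_num)
  have iT4 := integrable_pow_of_memLp_four hTm (k := 4) le_rfl
  have b1 (ω : Ω) : linError v (fun j ↦ a j ω) ^ 2 ≤ (n : ℝ)⁻¹ ^ 3 * (∑ j, a j ω) ^ 4
      + 36 * (n : ℝ)⁻¹ * (∑ j, a j ω) ^ 2 + 9 * (n : ℝ)⁻¹ * (∑ j, (a j ω ^ 2 - v)) ^ 2 := by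
    refine (linError_sq_le hn hv0 _).1.trans_eq ?_
    field_simp
    ring
  -- `36 (x + y)² ≤ 72 x² + 72 y²` with `x = (S/n)²` and `y = (T/n)²/4`, where `S` and `T` are the
  -- two sums; adding `(S/n)⁴` gives `73`, and `72/16 = 9/2`.
  have b2 (ω : Ω) : linError v (fun j ↦ a j ω) ^ 2 ≤ 73 * (n : ℝ)⁻¹ ^ 3 * (∑ j, a j ω) ^ 4
      + 9 / 2 * (n : ℝ)⁻¹ ^ 3 * (∑ j, (a j ω ^ 2 - v)) ^ 4 := by
    refine (linError_sq_le hn hv0 _).2.trans ?_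
    set S := ∑ j, a j ω
    set T := ∑ j, (a j ω ^ 2 - (v : ℝ))
    have e : 73 * (n : ℝ)⁻¹ ^ 3 * S ^ 4 + 9 / 2 * (n : ℝ)⁻¹ ^ 3 * T ^ 4
        = n * (73 * ((n : ℝ)⁻¹ * S) ^ 4 + 9 / 2 * ((n : ℝ)⁻¹ * T) ^ 4) := by
      field_simp
    rw [e]
    refine mul_le_mul_of_nonneg_left ?_ hnpos.le
    nlinarith [sq_nonneg (((n : ℝ)⁻¹ * S) ^ 2 - ((n : ℝ)⁻¹ * T) ^ 2 / 4)]
  have hi1 := (iS4.const_mul ((n : ℝ)⁻¹ ^ 3)).add (iS2.const_mul (36 * (n : ℝ)⁻¹))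
  have hI : Integrable (fun ω ↦ linError v (fun j ↦ a j ω) ^ 2) P := by
    refine (hi1.add (iT2.const_mul (9 * (n : ℝ)⁻¹))).mono' ?_ (ae_of_all _ fun ω ↦ ?_)
    · have hc := (continuous_linError (n := n) (f := fun _ : Fin n → ℝ ↦ (v : ℝ)) (g := id)
        continuous_const continuous_id).pow 2
      exact (hc.measurable.comp_aemeasurable (aemeasurable_pi_lambda _ ha)).aestronglyMeasurable
    · rw [Real.norm_of_nonneg (sq_nonneg _)]
      exact b1 ω
  refine ⟨hI, ?_, ?_⟩
  · have m := ((HasMean.const_mul ⟨iS4, rfl⟩ ((n : ℝ)⁻¹ ^ 3)).add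
      (HasMean.const_mul ⟨iS2, rfl⟩ (36 * (n : ℝ)⁻¹))).add
        (HasMean.const_mul ⟨iT2, rfl⟩ (9 * (n : ℝ)⁻¹))
    refine (integral_mono hI m.1 b1).trans (m.2.le.trans ?_)
    rw [hS2, hT2]
    calc _ ≤ (n : ℝ)⁻¹ ^ 3 * (3 * (n : ℝ) ^ 2 * (v ^ 2 * m4)) + 36 * (n : ℝ)⁻¹ * (n * v)
          + 9 * (n : ℝ)⁻¹ * (n * (v ^ 2 * k2)) := by gcongr
      _ = 3 * (v ^ 2 * m4) * (n : ℝ)⁻¹ + 36 * v + 9 * (v ^ 2 * k2) := by field_simp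
      _ ≤ 3 * (v ^ 2 * m4) * 1 + 36 * v + 9 * (v ^ 2 * k2) := by
          gcongr
          exact inv_le_one_of_one_le₀ hn1
      _ ≤ linBound * (v + v ^ 2) := by
          rw [linBound, ← hm4, ← hk2, ← hk4]
          have h1 : 0 ≤ (v : ℝ) ^ 2 * m4 := by positivity
          have h2 : 0 ≤ (v : ℝ) ^ 2 * k2 := by positivity
          have h3 : 0 ≤ (v : ℝ) * m4 := by positivity
          have h4 : 0 ≤ (v : ℝ) * k2 := by positivity
          have h5 : 0 ≤ (v : ℝ) * k4 := by positivity
          have h6 : 0 ≤ (v : ℝ) ^ 2 * k4 := by positivity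
          nlinarith [sq_nonneg (v : ℝ)]
  · have m := (HasMean.const_mul ⟨iS4, rfl⟩ (73 * (n : ℝ)⁻¹ ^ 3)).add
      (HasMean.const_mul ⟨iT4, rfl⟩ (9 / 2 * (n : ℝ)⁻¹ ^ 3))
    refine (integral_mono hI m.1 b2).trans (m.2.le.trans ?_)
    calc _ ≤ 73 * (n : ℝ)⁻¹ ^ 3 * (3 * (n : ℝ) ^ 2 * (v ^ 2 * m4))
          + 9 / 2 * (n : ℝ)⁻¹ ^ 3 * (3 * (n : ℝ) ^ 2 * (v ^ 4 * k4)) := by gcongr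
      -- `219 = 3 · 73`, and `27/2 = 3 · 9/2` is rounded up to the `14` in `linBound`.
      _ = (219 * (v ^ 2 * m4) + 27 / 2 * (v ^ 4 * k4)) / n := by field_simp; ring
      _ ≤ linBound * (v ^ 2 + v ^ 4) / n := by
          gcongr
          rw [linBound, ← hm4, ← hk2, ← hk4]
          have h1 : 0 ≤ (v : ℝ) ^ 2 * m4 := by positivity
          have h2 : 0 ≤ (v : ℝ) ^ 2 * k2 := by positivity
          have h3 : 0 ≤ (v : ℝ) ^ 4 * m4 := by positivity
          have h4 : 0 ≤ (v : ℝ) ^ 4 * k2 := by positivity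
          have h5 : 0 ≤ (v : ℝ) ^ 2 * k4 := by positivity
          have h6 : 0 ≤ (v : ℝ) ^ 4 * k4 := by positivity
          nlinarith [sq_nonneg (v : ℝ), sq_nonneg ((v : ℝ) ^ 2)]

end LinErrorMoments

/-! ### Mixed moments by differentiating the Gaussian characteristic function. -/

section GaussianMixedMoments

variable {H : Type*} [NormedAddCommGroup H] [InnerProductSpace ℝ H] [MeasurableSpace H]
  [BorelSpace H] [SecondCountableTopology H] [CompleteSpace H] {γ : Measure H} [IsGaussian γ]

/-- The exponential has modulus one, so `‖β w‖` dominates the derivative for every `t`. The weight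
`w` is general so that the result can be iterated. -/
lemma hasDerivAt_integral_mul_cexp {μ : Measure H} {w : H → ℂ} {α β : H → ℝ}
    (hw : Measurable w) (hα : Measurable α) (hβ : Measurable β) (hwi : Integrable w μ)
    (hwβ : Integrable (fun x ↦ (β x : ℂ) * w x) μ) (t : ℝ) :
    HasDerivAt (fun t : ℝ ↦ ∫ x, w x * Complex.exp (Complex.I * (α x + t * β x : ℝ)) ∂μ)
      (∫ x, (Complex.I * ((β x : ℂ) * w x)) * Complex.exp (Complex.I * (α x + t * β x : ℝ)) ∂μ)
      t := by
  have hn (s : ℝ) : ‖Complex.exp (Complex.I * (s : ℝ))‖ = 1 := by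
    rw [mul_comm, Complex.norm_exp_ofReal_mul_I]
  refine (hasDerivAt_integral_of_dominated_loc_of_deriv_le (𝕜 := ℝ) (E := ℂ)
    (F := fun (t : ℝ) x ↦ w x * Complex.exp (Complex.I * (α x + t * β x : ℝ)))
    (F' := fun (t : ℝ) x ↦ (Complex.I * ((β x : ℂ) * w x)) *
      Complex.exp (Complex.I * (α x + t * β x : ℝ))) (s := Set.univ)
    (bound := fun x ↦ ‖(β x : ℂ) * w x‖) univ_mem (Eventually.of_forall fun s ↦ ?_) ?_ ?_
    (ae_of_all _ fun x s _ ↦ ?_) hwβ.norm (ae_of_all _ fun x s _ ↦ ?_)).2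
  · exact Measurable.aestronglyMeasurable (by fun_prop)
  · refine hwi.norm.mono' (Measurable.aestronglyMeasurable (by fun_prop)) (ae_of_all _ fun x ↦ ?_)
    rw [norm_mul, hn, mul_one]
  · exact Measurable.aestronglyMeasurable (by fun_prop)
  · rw [norm_mul, hn, mul_one, norm_mul, Complex.norm_I, one_mul]
  · have h1 : HasDerivAt (fun s : ℝ ↦ ((α x + s * β x : ℝ) : ℂ)) (β x : ℂ) s := by
      have h2 : HasDerivAt (fun s : ℝ ↦ α x + s * β x) (β x) s := by
        simpa using ((hasDerivAt_id s).mul_const (β x)).const_add (α x)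
      exact h2.ofReal_comp
    convert! ((h1.const_mul Complex.I).cexp).const_mul (w x) using 1
    ring

lemma integrable_inner_pow_mul_pow (f g : H) (k l : ℕ) :
    Integrable (fun x ↦ ⟪f, x⟫ ^ k * ⟪g, x⟫ ^ l) γ := by
  have h : MemLp id ((k + l : ℕ) : ℝ≥0∞) γ := IsGaussian.memLp_id γ _ (by simp)
  refine (h.integrable_norm_pow'.const_mul (‖f‖ ^ k * ‖g‖ ^ l)).mono' (by fun_prop)
    (ae_of_all _ fun x ↦ ?_)
  rw [norm_mul, norm_pow, norm_pow]
  calc _ ≤ (‖f‖ * ‖x‖) ^ k * (‖g‖ * ‖x‖) ^ l := by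
        gcongr <;> exact norm_inner_le_norm _ _
    _ = ‖f‖ ^ k * ‖g‖ ^ l * ‖id x‖ ^ (k + l) := by rw [id, pow_add]; ring

lemma integrable_inner_pow_mul_cexp (f g : H) (k l : ℕ) (α : H → ℝ) (hα : Measurable α) :
    Integrable (fun x ↦ ((⟪f, x⟫ ^ k * ⟪g, x⟫ ^ l : ℝ) : ℂ) * Complex.exp (Complex.I * (α x : ℝ)))
      γ := by
  refine (integrable_inner_pow_mul_pow f g k l).norm.mono'
    (Measurable.aestronglyMeasurable (by fun_prop)) (ae_of_all _ fun x ↦ ?_)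
  rw [norm_mul, mul_comm Complex.I, Complex.norm_exp_ofReal_mul_I, mul_one, Complex.norm_real]

variable (hγ : ∫ x, x ∂γ = 0)
include hγ

lemma integral_cexp_inner (f : H) : ∫ x, Complex.exp (Complex.I * (⟪f, x⟫ : ℝ)) ∂γ
    = Real.exp (-covarianceBilin γ f f / 2) := by
  have h := IsGaussian.charFun_eq' (μ := γ) f
  have hγ' : γ[id] = 0 := hγ
  rw [hγ', charFun_apply] at h
  simp only [inner_zero_right] at h
  push_cast at h ⊢
  rw [zero_mul, zero_sub] at h
  rw [neg_div, ← h]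
  refine integral_congr_ae (ae_of_all _ fun x ↦ ?_)
  simp only
  rw [mul_comm, real_inner_comm]

lemma integral_cexp_inner_add (f g : H) (t : ℝ) :
    ∫ x, Complex.exp (Complex.I * (⟪f, x⟫ + t * ⟪g, x⟫ : ℝ)) ∂γ
      = Real.exp (-(covarianceBilin γ f f + 2 * t * covarianceBilin γ f g
        + t ^ 2 * covarianceBilin γ g g) / 2) := by
  have h := integral_cexp_inner hγ (f + t • g)
  simp only [inner_add_left, real_inner_smul_left] at h
  rw [h]
  congr 3
  simp only [map_add, map_smul, add_apply, smul_apply,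
    smul_eq_mul, covarianceBilin_comm g f]
  ring

/-- Differentiate the characteristic function along `f + t • g`; keeping `t` free permits a second
differentiation. -/
lemma integral_inner_mul_cexp (f g : H) (t : ℝ) :
    ∫ x, (Complex.I * ((⟪g, x⟫ : ℝ) * 1)) * Complex.exp (Complex.I * (⟪f, x⟫ + t * ⟪g, x⟫ : ℝ)) ∂γ
      = ((-(covarianceBilin γ f g + t * covarianceBilin γ g g) *
        Real.exp (-(covarianceBilin γ f f + 2 * t * covarianceBilin γ f g
        + t ^ 2 * covarianceBilin γ g g) / 2) : ℝ) : ℂ) := by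
  have h1 := hasDerivAt_integral_mul_cexp (μ := γ) (w := fun _ ↦ 1) (α := fun x ↦ ⟪f, x⟫)
    (β := fun x ↦ ⟪g, x⟫) (by fun_prop) (by fun_prop) (by fun_prop) (integrable_const _)
    (by simpa using (integrable_inner_pow_mul_pow (γ := γ) g g 1 0).ofReal (𝕜 := ℂ)) t
  simp only [one_mul, integral_cexp_inner_add hγ] at h1
  refine h1.unique ?_
  have h2 : HasDerivAt (fun t : ℝ ↦ -(covarianceBilin γ f f + 2 * t * covarianceBilin γ f g
        + t ^ 2 * covarianceBilin γ g g) / 2)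
      (-(covarianceBilin γ f g + t * covarianceBilin γ g g)) t := by
    have h3 := (((((hasDerivAt_id t).const_mul 2).mul_const (covarianceBilin γ f g)).const_add
      (covarianceBilin γ f f)).add
        (((hasDerivAt_id t).pow 2).mul_const (covarianceBilin γ g g))).neg.div_const 2
    convert! h3 using 1
    simp
    ring
  convert! h2.exp.ofReal_comp using 1
  push_cast
  ring

lemma integral_inner_sq_mul_cexp (f g : H) :
    ∫ x, ((⟪g, x⟫ ^ 2 : ℝ) : ℂ) * Complex.exp (Complex.I * (⟪f, x⟫ : ℝ)) ∂γ
      = (((covarianceBilin γ g g - covarianceBilin γ f g ^ 2) *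
        Real.exp (-covarianceBilin γ f f / 2) : ℝ) : ℂ) := by
  have hi : Integrable (fun x ↦ ((⟪g, x⟫ ^ 2 : ℝ) : ℂ)) γ := by
    simpa using (integrable_inner_pow_mul_pow (γ := γ) g g 2 0).ofReal (𝕜 := ℂ)
  have h1 := hasDerivAt_integral_mul_cexp (μ := γ) (w := fun x ↦ Complex.I * ((⟪g, x⟫ : ℝ) * 1))
    (α := fun x ↦ ⟪f, x⟫)
    (β := fun x ↦ ⟪g, x⟫) (by fun_prop) (by fun_prop) (by fun_prop)
    (by
      have h := (integrable_inner_pow_mul_pow (γ := γ) g g 1 0).ofReal (𝕜 := ℂ)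
      simpa using h.const_mul Complex.I)
    (by
      refine (hi.const_mul Complex.I).congr (ae_of_all _ fun x ↦ ?_)
      push_cast
      ring) 0
  simp only [integral_inner_mul_cexp hγ] at h1
  have h2 : HasDerivAt (fun t : ℝ ↦ -(covarianceBilin γ f f + 2 * t * covarianceBilin γ f g
        + t ^ 2 * covarianceBilin γ g g) / 2) (-covarianceBilin γ f g) 0 := by
    have h3 := (((((hasDerivAt_id (0 : ℝ)).const_mul 2).mul_const
      (covarianceBilin γ f g)).const_add (covarianceBilin γ f f)).add
        (((hasDerivAt_id (0 : ℝ)).pow 2).mul_const (covarianceBilin γ g g))).neg.div_const 2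
    convert! h3 using 1
    simp
    ring
  have h4 : HasDerivAt (fun t : ℝ ↦ -(covarianceBilin γ f g + t * covarianceBilin γ g g))
      (-covarianceBilin γ g g) 0 := by
    have h := (((hasDerivAt_id (0 : ℝ)).mul_const (covarianceBilin γ g g)).const_add
      (covarianceBilin γ f g)).neg
    rw [one_mul] at h
    exact h
  have h5 := h1.unique (h4.mul h2.exp).ofReal_comp
  have e : ∫ x, ((⟪g, x⟫ ^ 2 : ℝ) : ℂ) * Complex.exp (Complex.I * (⟪f, x⟫ : ℝ)) ∂γ
      = -∫ x, (Complex.I * ((⟪g, x⟫ : ℝ) * (Complex.I * ((⟪g, x⟫ : ℝ) * 1)))) *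
        Complex.exp (Complex.I * (⟪f, x⟫ + 0 * ⟪g, x⟫ : ℝ)) ∂γ := by
    rw [← integral_neg]
    refine integral_congr_ae (ae_of_all _ fun x ↦ ?_)
    simp only [zero_mul, add_zero]
    push_cast
    linear_combination ((⟪g, x⟫ : ℝ) : ℂ) ^ 2 * Complex.exp (Complex.I * (⟪f, x⟫ : ℝ))
      * Complex.I_sq
  rw [e, h5, ← Complex.ofReal_neg]
  congr 1
  simp
  ring

/-- The mixed third and fourth moments of a centred Gaussian law. -/
lemma hasMean_inner_mul_inner_sq (f g : H) :
    HasMean γ (fun x ↦ ⟪f, x⟫ * ⟪g, x⟫ ^ 2) 0 ∧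
      HasMean γ (fun x ↦ ⟪f, x⟫ ^ 2 * ⟪g, x⟫ ^ 2)
        (covarianceBilin γ f f * covarianceBilin γ g g + 2 * covarianceBilin γ f g ^ 2) := by
  set p := covarianceBilin γ f f with hp
  set q := covarianceBilin γ g g with hq
  set c := covarianceBilin γ f g with hc
  have hi2 : Integrable (fun x ↦ ((⟪g, x⟫ ^ 2 : ℝ) : ℂ)) γ := by
    simpa using (integrable_inner_pow_mul_pow (γ := γ) g g 2 0).ofReal (𝕜 := ℂ)
  have hi12 : Integrable (fun x ↦ ((⟪f, x⟫ * ⟪g, x⟫ ^ 2 : ℝ) : ℂ)) γ := by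
    have h := integrable_inner_pow_mul_pow (γ := γ) f g 1 2
    simp only [pow_one] at h
    exact h.ofReal (𝕜 := ℂ)
  have hi22 : Integrable (fun x ↦ ((⟪f, x⟫ ^ 2 * ⟪g, x⟫ ^ 2 : ℝ) : ℂ)) γ :=
    (integrable_inner_pow_mul_pow (γ := γ) f g 2 2).ofReal (𝕜 := ℂ)
  -- Put `s • f` for `f` in the moment weighted by `⟪g, x⟫²`. Its first and second derivatives at `s
  -- = 0` give the mixed third and fourth moments.
  have h0 (s : ℝ) : ∫ x, ((⟪g, x⟫ ^ 2 : ℝ) : ℂ) * Complex.exp (Complex.I *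
      ((fun _ : H ↦ (0 : ℝ)) x + s * ⟪f, x⟫ : ℝ)) ∂γ
      = (((q - s ^ 2 * c ^ 2) * Real.exp (-(s ^ 2 * p) / 2) : ℝ) : ℂ) := by
    have h := integral_inner_sq_mul_cexp hγ (s • f) g
    simp only [real_inner_smul_left, map_smul, smul_apply, smul_eq_mul,
      ← hp, ← hq, ← hc] at h
    simp only [zero_add]
    rw [h]
    congr 4 <;> ring
  have hderE (s : ℝ) : HasDerivAt (fun s : ℝ ↦ -(s ^ 2 * p) / 2) (-(s * p)) s := by
    have h := (((hasDerivAt_id s).pow 2).mul_const p).neg.div_const 2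
    convert! h using 1
    simp
    ring
  have hderP (s : ℝ) : HasDerivAt (fun s : ℝ ↦ q - s ^ 2 * c ^ 2) (-(2 * s * c ^ 2)) s := by
    have h := (((hasDerivAt_id s).pow 2).mul_const (c ^ 2)).const_sub q
    convert! h using 1
    simp
  have h1 (s : ℝ) : ∫ x, (Complex.I * ((⟪f, x⟫ : ℝ) * ((⟪g, x⟫ ^ 2 : ℝ) : ℂ))) *
      Complex.exp (Complex.I * ((fun _ : H ↦ (0 : ℝ)) x + s * ⟪f, x⟫ : ℝ)) ∂γ
      = ((-(2 * s * c ^ 2) * Real.exp (-(s ^ 2 * p) / 2) +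
        (q - s ^ 2 * c ^ 2) * (Real.exp (-(s ^ 2 * p) / 2) * -(s * p)) : ℝ) : ℂ) := by
    have h := hasDerivAt_integral_mul_cexp (μ := γ) (w := fun x ↦ ((⟪g, x⟫ ^ 2 : ℝ) : ℂ))
      (α := fun _ ↦ 0) (β := fun x ↦ ⟪f, x⟫) (by fun_prop) (by fun_prop) (by fun_prop) hi2
      (by simpa only [Complex.ofReal_mul] using hi12) s
    simp only [h0] at h
    exact h.unique ((hderP s).mul (hderE s).exp).ofReal_comp
  have h2 := hasDerivAt_integral_mul_cexp (μ := γ)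
      (w := fun x ↦ Complex.I * ((⟪f, x⟫ : ℝ) * ((⟪g, x⟫ ^ 2 : ℝ) : ℂ)))
      (α := fun _ ↦ 0) (β := fun x ↦ ⟪f, x⟫) (by fun_prop) (by fun_prop) (by fun_prop)
      (by simpa only [Complex.ofReal_mul] using hi12.const_mul Complex.I)
      (by
        refine (hi22.const_mul Complex.I).congr (ae_of_all _ fun x ↦ ?_)
        push_cast
        ring) 0
  simp only [h1] at h2
  have hlin (k : ℝ) : HasDerivAt (fun s : ℝ ↦ s * k) k 0 := by
    simpa using (hasDerivAt_id (0 : ℝ)).mul_const k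
  have h3 : HasDerivAt (fun s : ℝ ↦ -(2 * s * c ^ 2) * Real.exp (-(s ^ 2 * p) / 2) +
        (q - s ^ 2 * c ^ 2) * (Real.exp (-(s ^ 2 * p) / 2) * -(s * p)))
      (-(2 * c ^ 2) - q * p) 0 := by
    have h4 : HasDerivAt (fun s : ℝ ↦ -(2 * s * c ^ 2)) (-(2 * c ^ 2)) 0 := by
      have := (hlin (2 * c ^ 2)).neg
      convert! this using 1
      ext s
      simp
      ring
    have h5 := (h4.mul (hderE 0).exp).add
      ((hderP 0).mul ((hderE 0).exp.mul (hlin p).neg))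
    convert! h5 using 1
    simp
    ring
  have h6 := h2.unique h3.ofReal_comp
  have h7 := h1 0
  refine ⟨⟨?_, ?_⟩, integrable_inner_pow_mul_pow f g 2 2, ?_⟩
  · simpa using integrable_inner_pow_mul_pow (γ := γ) f g 1 2
  · have e : ∫ x, (Complex.I * ((⟪f, x⟫ : ℝ) * ((⟪g, x⟫ ^ 2 : ℝ) : ℂ))) *
        Complex.exp (Complex.I * ((fun _ : H ↦ (0 : ℝ)) x + (0 : ℝ) * ⟪f, x⟫ : ℝ)) ∂γ
        = Complex.I * ((∫ x, ⟪f, x⟫ * ⟪g, x⟫ ^ 2 ∂γ : ℝ) : ℂ) := by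
      rw [← integral_complex_ofReal, ← integral_const_mul]
      refine integral_congr_ae (ae_of_all _ fun x ↦ ?_)
      simp
    rw [e] at h7
    have h8 := congrArg Complex.im h7
    simpa using h8
  · have e : ∫ x, (Complex.I * ((⟪f, x⟫ : ℝ) *
          (Complex.I * ((⟪f, x⟫ : ℝ) * ((⟪g, x⟫ ^ 2 : ℝ) : ℂ))))) *
        Complex.exp (Complex.I * ((fun _ : H ↦ (0 : ℝ)) x + (0 : ℝ) * ⟪f, x⟫ : ℝ)) ∂γ
        = -((∫ x, ⟪f, x⟫ ^ 2 * ⟪g, x⟫ ^ 2 ∂γ : ℝ) : ℂ) := by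
      rw [← integral_complex_ofReal, ← integral_neg]
      refine integral_congr_ae (ae_of_all _ fun x ↦ ?_)
      simp
      linear_combination ((⟪f, x⟫ : ℝ) : ℂ) ^ 2 * ((⟪g, x⟫ : ℝ) : ℂ) ^ 2 * Complex.I_sq
    rw [e] at h6
    have h8 : -(∫ x, ⟪f, x⟫ ^ 2 * ⟪g, x⟫ ^ 2 ∂γ) = -(2 * c ^ 2) - q * p := by exact_mod_cast h6
    linarith

end GaussianMixedMoments

/-! ### Covariance of the influence functions. -/

section ScoreCovariance

variable {H : Type*} [NormedAddCommGroup H] [InnerProductSpace ℝ H] [MeasurableSpace H]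
  [BorelSpace H] [SecondCountableTopology H] [CompleteSpace H] {γ : Measure H} [IsGaussian γ]

lemma hasMean_mul_cos_add_sin {α : Type*} [MeasurableSpace α] {μ : Measure α} {w a : α → ℝ}
    (h : Integrable (fun x ↦ (w x : ℂ) * Complex.exp (Complex.I * (a x : ℝ))) μ) {z : ℂ}
    (hz : ∫ x, (w x : ℂ) * Complex.exp (Complex.I * (a x : ℝ)) ∂μ = z) :
    HasMean μ (fun x ↦ w x * (Real.cos (a x) + Real.sin (a x))) (z.re + z.im) := by
  have e (x : α) : reAddIm ((w x : ℂ) * Complex.exp (Complex.I * (a x : ℝ)))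
      = w x * (Real.cos (a x) + Real.sin (a x)) := by
    rw [reAddIm_apply, Complex.re_ofReal_mul, Complex.im_ofReal_mul, mul_comm Complex.I,
      Complex.exp_ofReal_mul_I_re, Complex.exp_ofReal_mul_I_im]
    ring
  refine HasMean.congr (f := fun x ↦ reAddIm ((w x : ℂ) * Complex.exp (Complex.I * (a x : ℝ))))
    ⟨reAddIm.integrable_comp h, ?_⟩ e rfl
  rw [reAddIm.integral_comp_comm h, hz, reAddIm_apply]

lemma hasMean_inner_mul_inner (hγ : ∫ x, x ∂γ = 0) (f g : H) :
    HasMean γ (fun x ↦ ⟪f, x⟫ * ⟪g, x⟫) (covarianceBilin γ f g) := by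
  refine ⟨?_, (covarianceBilin_of_mean_zero IsGaussian.memLp_two_id hγ f g).symm⟩
  simpa using integrable_inner_pow_mul_pow (γ := γ) f g 1 1

lemma hasMean_inner (hγ : ∫ x, x ∂γ = 0) (f : H) : HasMean γ (fun x ↦ ⟪f, x⟫) 0 := by
  refine ⟨by simpa using integrable_inner_pow_mul_pow (γ := γ) f f 1 0, ?_⟩
  rw [integral_inner (𝕜 := ℝ) (f := fun x ↦ x) IsGaussian.integrable_id, hγ, inner_zero_right]

/-- Mixed moments of a trigonometric and a polynomial function of a centred Gaussian element. -/
lemma hasMean_cos_add_sin_inner (hγ : ∫ x, x ∂γ = 0) (f g : H) :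
    HasMean γ (fun x ↦ 1 * (Real.cos ⟪f, x⟫ + Real.sin ⟪f, x⟫))
        (Real.exp (-covarianceBilin γ f f / 2)) ∧
      HasMean γ (fun x ↦ ⟪g, x⟫ * (Real.cos ⟪f, x⟫ + Real.sin ⟪f, x⟫))
        (covarianceBilin γ f g * Real.exp (-covarianceBilin γ f f / 2)) ∧
      HasMean γ (fun x ↦ ⟪g, x⟫ ^ 2 * (Real.cos ⟪f, x⟫ + Real.sin ⟪f, x⟫))
        ((covarianceBilin γ g g - covarianceBilin γ f g ^ 2) *
          Real.exp (-covarianceBilin γ f f / 2)) := by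
  have hi (k : ℕ) : Integrable (fun x ↦ ((⟪g, x⟫ ^ k : ℝ) : ℂ) *
      Complex.exp (Complex.I * (⟪f, x⟫ : ℝ))) γ := by
    simpa using integrable_inner_pow_mul_cexp (γ := γ) g g k 0 (fun x ↦ ⟪f, x⟫) (by fun_prop)
  refine ⟨?_, ?_, ?_⟩
  · refine (hasMean_mul_cos_add_sin (w := fun _ ↦ 1) (a := fun x ↦ ⟪f, x⟫) ?_
      (z := ((Real.exp (-covarianceBilin γ f f / 2) : ℝ) : ℂ)) ?_).congr (fun x ↦ rfl) ?_
    · simpa using hi 0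
    · simpa using integral_cexp_inner hγ f
    · rw [Complex.ofReal_re, Complex.ofReal_im, add_zero]
  · refine (hasMean_mul_cos_add_sin (w := fun x ↦ ⟪g, x⟫) (a := fun x ↦ ⟪f, x⟫) ?_
      (z := ((covarianceBilin γ f g * Real.exp (-covarianceBilin γ f f / 2) : ℝ) : ℂ) *
        Complex.I) ?_).congr (fun x ↦ rfl) ?_
    · simpa using hi 1
    · have h := integral_inner_mul_cexp hγ f g 0
      simp only [zero_mul, add_zero, mul_one, mul_zero, ne_eq, OfNat.ofNat_ne_zero,
        not_false_eq_true, zero_pow, mul_assoc] at h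
      rw [integral_const_mul] at h
      refine mul_left_cancel₀ Complex.I_ne_zero (h.trans ?_)
      push_cast
      linear_combination (-((covarianceBilin γ f g : ℝ) : ℂ) *
        Complex.exp (-(covarianceBilin γ f f : ℝ) / 2)) * Complex.I_sq
    · rw [Complex.re_ofReal_mul, Complex.im_ofReal_mul, Complex.I_re, Complex.I_im]
      ring
  · refine (hasMean_mul_cos_add_sin (w := fun x ↦ ⟪g, x⟫ ^ 2) (a := fun x ↦ ⟪f, x⟫) (hi 2)
      (integral_inner_sq_mul_cexp hγ f g)).congr (fun x ↦ rfl) ?_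
    rw [Complex.ofReal_re, Complex.ofReal_im, add_zero]

/-- Half the sum and half the difference of the identities for `f` and `-f` isolate cosine and sine.
-/
lemma hasMean_cos_inner (hγ : ∫ x, x ∂γ = 0) (f : H) :
    HasMean γ (fun x ↦ Real.cos ⟪f, x⟫) (Real.exp (-covarianceBilin γ f f / 2)) ∧
      HasMean γ (fun x ↦ Real.sin ⟪f, x⟫) 0 := by
  have h1 := (hasMean_cos_add_sin_inner hγ f f).1
  have h2 := (hasMean_cos_add_sin_inner hγ (-f) f).1
  simp only [inner_neg_left, Real.cos_neg, Real.sin_neg, map_neg, neg_apply, neg_neg] at h2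
  exact ⟨((h1.add h2).const_mul (1 / 2)).congr (fun x ↦ by ring) (by ring),
    ((h1.sub h2).const_mul (1 / 2)).congr (fun x ↦ by ring) (by ring)⟩

/-- The product equals `cos ⟪f - g, x⟫ + sin ⟪f + g, x⟫`, and the sine has mean zero. -/
lemma hasMean_cos_add_sin_mul (hγ : ∫ x, x ∂γ = 0) (f g : H) :
    HasMean γ (fun x ↦ (Real.cos ⟪f, x⟫ + Real.sin ⟪f, x⟫) * (Real.cos ⟪g, x⟫ + Real.sin ⟪g, x⟫))
      (Real.exp (-(covarianceBilin γ f f + covarianceBilin γ g g) / 2 + covarianceBilin γ f g)) := by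
  refine ((hasMean_cos_inner hγ (f - g)).1.add (hasMean_cos_inner hγ (f + g)).2).congr
    (fun x ↦ ?_) ?_
  · rw [inner_sub_left, inner_add_left, Real.cos_sub, Real.sin_add]
    ring
  · rw [add_zero]
    congr 1
    simp only [map_sub, sub_apply, covarianceBilin_comm g f]
    ring

lemma hasMean_score (hγ : ∫ x, x ∂γ = 0) (f : H) :
    HasMean γ (fun x ↦ score (covarianceBilin γ f f) ⟪f, x⟫) 0 := by
  refine ((hasMean_cos_add_sin_inner hγ f f).1.sub
    ((((hasMean_const 1).add (hasMean_inner hγ f)).sub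
      (((hasMean_inner_mul_inner hγ f f).sub (hasMean_const (covarianceBilin γ f f))).const_mul
        (1 / 2))).const_mul (Real.exp (-covarianceBilin γ f f / 2)))).congr (fun x ↦ ?_) ?_
  · rw [score]
    ring
  · ring

/-- The covariances of the influence functions are given by the limiting kernel. -/
lemma hasMean_score_mul_score (hγ : ∫ x, x ∂γ = 0) (f g : H) :
    HasMean γ (fun x ↦ score (covarianceBilin γ f f) ⟪f, x⟫ * score (covarianceBilin γ g g) ⟪g, x⟫)
      (Real.exp (-(1 / 2) * (covarianceBilin γ f f + covarianceBilin γ g g)) *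
        (Real.exp (covarianceBilin γ f g) - 1 - covarianceBilin γ f g
          - (1 / 2) * covarianceBilin γ f g ^ 2)) := by
  obtain ⟨u0, u1, u2⟩ := hasMean_cos_add_sin_inner hγ f g
  obtain ⟨w0, w1, w2⟩ := hasMean_cos_add_sin_inner hγ g f
  have hT := hasMean_cos_add_sin_mul hγ f g
  have a1 := hasMean_inner hγ f
  have b1 := hasMean_inner hγ g
  have a2 := hasMean_inner_mul_inner hγ f f
  have b2 := hasMean_inner_mul_inner hγ g g
  have ab := hasMean_inner_mul_inner hγ f g
  obtain ⟨ab2, a2b2⟩ := hasMean_inner_mul_inner_sq hγ f g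
  have ba2 := (hasMean_inner_mul_inner_sq hγ g f).1
  rw [covarianceBilin_comm g f] at w1 w2
  set p := covarianceBilin γ f f
  set q := covarianceBilin γ g g
  set c := covarianceBilin γ f g
  set Ep := Real.exp (-p / 2) with hEp
  set Eq := Real.exp (-q / 2) with hEq
  have e1 : Real.exp (-(p + q) / 2 + c) = Ep * Eq * Real.exp c := by
    rw [hEp, hEq, ← Real.exp_add, ← Real.exp_add]
    ring_nf
  have e2 : Real.exp (-(1 / 2) * (p + q)) = Ep * Eq := by
    rw [hEp, hEq, ← Real.exp_add]
    ring_nf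
  -- `m1` and `m2` collect the products of a trigonometric with a polynomial part, `m3` the product
  -- of the two polynomials, with `1 + a - (a² - p)/2` written as `(1 + p/2) + a - a²/2`.
  have m1 := ((u0.const_mul (1 + q / 2)).add u1).sub (u2.const_mul (1 / 2))
  have m2 := ((w0.const_mul (1 + p / 2)).add w1).sub (w2.const_mul (1 / 2))
  have m3 := ((((((((hasMean_const (μ := γ) ((1 + p / 2) * (1 + q / 2))).add
    (b1.const_mul (1 + p / 2))).sub (b2.const_mul ((1 + p / 2) / 2))).add
    (a1.const_mul (1 + q / 2))).add ab).sub (ab2.const_mul (1 / 2))).sub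
    (a2.const_mul ((1 + q / 2) / 2))).sub (ba2.const_mul (1 / 2))).add (a2b2.const_mul (1 / 4))
  refine (((hT.sub (m1.const_mul Eq)).sub (m2.const_mul Ep)).add
    (m3.const_mul (Ep * Eq))).congr (fun x ↦ ?_) ?_
  · rw [score, score, ← hEp, ← hEq]
    ring
  · rw [e1, e2]
    ring

end ScoreCovariance

/-! ### The influence function as a random element of `L²(Q)`. -/

section ScoreMap

/-- Stated in the unscaled argument: for fixed `x` the influence function grows at most like `‖f‖²`,
so the fourth moment of `Q` puts it in `L²(Q)`. -/
lemma abs_score_le {v : ℝ} (hv : 0 ≤ v) (a : ℝ) : |score v a| ≤ 5 + a ^ 2 := by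
  have h1 := Real.abs_cos_le_one a
  have h2 := Real.abs_sin_le_one a
  have he : 0 < Real.exp (-v / 2) := Real.exp_pos _
  have he1 : Real.exp (-v / 2) ≤ 1 := Real.exp_le_one_iff.2 (by linarith)
  have hev : Real.exp (-v / 2) * v ≤ 2 := by
    have h3 := Real.add_one_le_exp (v / 2)
    have h4 : Real.exp (-v / 2) * Real.exp (v / 2) = 1 := by
      rw [← Real.exp_add, neg_div, neg_add_cancel, Real.exp_zero]
    nlinarith
  have hev0 : 0 ≤ Real.exp (-v / 2) * v := by positivity
  have h5 : |Real.exp (-v / 2) * (1 + a - a ^ 2 / 2)| ≤ 2 + a ^ 2 := by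
    rw [abs_mul, abs_of_pos he]
    calc _ ≤ 1 * |1 + a - a ^ 2 / 2| := by gcongr
      _ ≤ 2 + a ^ 2 := by
        rw [one_mul, abs_le]
        constructor <;> nlinarith [sq_nonneg (a - 1), sq_nonneg (a + 1)]
  have e : score v a = Real.cos a + Real.sin a - Real.exp (-v / 2) * (1 + a - a ^ 2 / 2)
      - Real.exp (-v / 2) * v / 2 := by
    rw [score]; ring
  rw [e]
  rw [abs_le] at *
  constructor <;> linarith [h1.1, h1.2, h2.1, h2.2, h5.1, h5.2]

lemma abs_score_sub_score_le {v : ℝ} (hv : 0 ≤ v) (a b : ℝ) :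
    |score v a - score v b| ≤ |a - b| * (3 + (|a| + |b|) / 2) := by
  have h1 := Real.abs_cos_sub_cos_le a b
  have h2 := Real.abs_sin_sub_sin_le a b
  have he : 0 < Real.exp (-v / 2) := Real.exp_pos _
  have he1 : Real.exp (-v / 2) ≤ 1 := Real.exp_le_one_iff.2 (by linarith)
  have e : score v a - score v b = (Real.cos a - Real.cos b) + (Real.sin a - Real.sin b)
      - Real.exp (-v / 2) * ((a - b) * (1 - (a + b) / 2)) := by
    rw [score, score]; ring
  have h3 : |Real.exp (-v / 2) * ((a - b) * (1 - (a + b) / 2))|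
      ≤ |a - b| * (1 + (|a| + |b|) / 2) := by
    rw [abs_mul, abs_mul, abs_of_pos he]
    calc _ ≤ 1 * (|a - b| * |1 - (a + b) / 2|) := by gcongr
      _ ≤ _ := by
        rw [one_mul]
        gcongr
        rw [abs_le]
        have := neg_abs_le a
        have := neg_abs_le b
        have := le_abs_self a
        have := le_abs_self b
        constructor <;> linarith
  rw [e]
  refine (abs_sub _ _).trans ?_
  have h4 := abs_add_le (Real.cos a - Real.cos b) (Real.sin a - Real.sin b)
  linarith

variable {H : Type*} [NormedAddCommGroup H] [InnerProductSpace ℝ H] [MeasurableSpace H]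
  [BorelSpace H] [SecondCountableTopology H] [CompleteSpace H]

/-- The influence function of the limiting process for the law `γ`. -/
def scoreAt (γ : Measure H) (x f : H) : ℝ := score (covarianceBilin γ f f) ⟪f, x⟫

/-- The covariance kernel of the influence functions. -/
def scoreKernel (γ : Measure H) (f g : H) : ℝ :=
  Real.exp (-(1 / 2) * (covarianceBilin γ f f + covarianceBilin γ g g)) *
    (Real.exp (covarianceBilin γ f g) - 1 - covarianceBilin γ f g
      - (1 / 2) * covarianceBilin γ f g ^ 2)

lemma continuous_scoreAt (γ : Measure H) : Continuous fun p : H × H ↦ scoreAt γ p.1 p.2 := by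
  unfold scoreAt
  fun_prop

lemma continuous_scoreKernel (γ : Measure H) :
    Continuous fun p : H × H ↦ scoreKernel γ p.1 p.2 := by
  unfold scoreKernel
  fun_prop

variable {Q : Measure H} [IsProbabilityMeasure Q]

lemma memLp_two_norm_sq (hQ : Integrable (fun f ↦ ‖f‖ ^ 4) Q) :
    MemLp (fun f ↦ ‖f‖ ^ 2) 2 Q := by
  rw [memLp_two_iff_integrable_sq (by fun_prop)]
  simpa only [← pow_mul] using hQ

lemma memLp_two_norm (hQ : Integrable (fun f ↦ ‖f‖ ^ 4) Q) : MemLp (fun f : H ↦ ‖f‖) 2 Q := by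
  rw [memLp_two_iff_integrable_sq (by fun_prop)]
  exact (memLp_two_norm_sq hQ).integrable (by norm_num)

lemma memLp_two_scoreAt (hQ : Integrable (fun f ↦ ‖f‖ ^ 4) Q) (γ : Measure H) (x : H) :
    MemLp (scoreAt γ x) 2 Q := by
  have hc : Continuous fun f ↦ scoreAt γ x f := by
    unfold scoreAt
    fun_prop
  refine ((memLp_const (5 : ℝ)).add ((memLp_two_norm_sq hQ).const_mul (‖x‖ ^ 2))).mono
    hc.aestronglyMeasurable (ae_of_all _ fun f ↦ ?_)
  rw [Real.norm_eq_abs]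
  refine (abs_score_le (covarianceBilin_self_nonneg f) _).trans ?_
  rw [Real.norm_eq_abs, Pi.add_apply, ← mul_pow, mul_comm]
  refine le_trans ?_ (le_abs_self _)
  gcongr 5 + ?_
  rw [← sq_abs]
  gcongr
  exact abs_real_inner_le_norm f x

/-- The influence function as an element of `L²(Q)`. -/
def scoreMap (hQ : Integrable (fun f ↦ ‖f‖ ^ 4) Q) (γ : Measure H) (x : H) : Lp ℝ 2 Q :=
  (memLp_two_scoreAt hQ γ x).toLp

lemma coeFn_scoreMap (hQ : Integrable (fun f ↦ ‖f‖ ^ 4) Q) (γ : Measure H) (x : H) :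
    scoreMap hQ γ x =ᵐ[Q] scoreAt γ x := MemLp.coeFn_toLp _

/-- The increment from `y` to `x` is at most a factor vanishing as `x → y` times `‖f‖ + ‖f‖²`, which
lies in `L²(Q)`. -/
lemma continuous_scoreMap (hQ : Integrable (fun f ↦ ‖f‖ ^ 4) Q) (γ : Measure H) :
    Continuous (scoreMap hQ γ) := by
  have hN := (memLp_two_norm hQ).add (memLp_two_norm_sq hQ)
  have hb (x y : H) : ‖scoreMap hQ γ x - scoreMap hQ γ y‖
      ≤ (‖x - y‖ * (3 + (‖x‖ + ‖y‖) / 2)) * ‖hN.toLp‖ := by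
    refine Lp.norm_le_mul_norm_of_ae_le_mul ?_
    filter_upwards [Lp.coeFn_sub (scoreMap hQ γ x) (scoreMap hQ γ y), coeFn_scoreMap hQ γ x,
      coeFn_scoreMap hQ γ y, hN.coeFn_toLp] with f h1 h2 h3 h4
    rw [h1, Pi.sub_apply, h2, h3, h4, Real.norm_eq_abs]
    refine (abs_score_sub_score_le (covarianceBilin_self_nonneg f) _ _).trans ?_
    rw [← inner_sub_right, Pi.add_apply, Real.norm_of_nonneg (by positivity)]
    calc _ ≤ (‖f‖ * ‖x - y‖) * (3 + (‖f‖ * ‖x‖ + ‖f‖ * ‖y‖) / 2) := by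
          gcongr <;> exact abs_real_inner_le_norm _ _
      _ ≤ _ := by
          have h5 : 0 ≤ ‖f‖ * ‖x - y‖ * (‖x‖ + ‖y‖) := by positivity
          have h6 : 0 ≤ ‖f‖ ^ 2 * ‖x - y‖ := by positivity
          nlinarith
  rw [continuous_iff_continuousAt]
  intro y
  refine tendsto_iff_norm_sub_tendsto_zero.2 ?_
  have hc : Continuous fun x ↦ (‖x - y‖ * (3 + (‖x‖ + ‖y‖) / 2)) * ‖hN.toLp‖ := by fun_prop
  refine squeeze_zero (fun x ↦ norm_nonneg _) (fun x ↦ hb x y) ?_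
  simpa using hc.tendsto y

lemma inner_scoreMap (hQ : Integrable (fun f ↦ ‖f‖ ^ 4) Q) (γ : Measure H) (Φ : Lp ℝ 2 Q) (x : H) :
    ⟪Φ, scoreMap hQ γ x⟫ = ∫ f, Φ f * scoreAt γ x f ∂Q := by
  rw [L2.inner_def]
  refine integral_congr_ae ?_
  filter_upwards [coeFn_scoreMap hQ γ x] with f hf
  rw [hf, RCLike.inner_apply, conj_trivial, mul_comm]

lemma norm_scoreMap_sq (hQ : Integrable (fun f ↦ ‖f‖ ^ 4) Q) (γ : Measure H) (x : H) :
    ‖scoreMap hQ γ x‖ ^ 2 = ∫ f, scoreAt γ x f ^ 2 ∂Q := by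
  rw [← real_inner_self_eq_norm_sq, inner_scoreMap]
  refine integral_congr_ae ?_
  filter_upwards [coeFn_scoreMap hQ γ x] with f hf
  rw [hf, sq]

variable {γ : Measure H} [IsGaussian γ]

lemma map_inner_eq_gaussianReal (hγ : ∫ x, x ∂γ = 0) (f : H) :
    γ.map (fun x ↦ ⟪f, x⟫) = gaussianReal 0 (covarianceBilin γ f f).toNNReal := by
  have h := IsGaussian.map_eq_gaussianReal (μ := γ) (innerSL ℝ f)
  simp only [innerSL_apply_apply] at h
  rw [(hasMean_inner hγ f).2] at h
  rw [covarianceBilin_self IsGaussian.memLp_two_id]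
  exact h

lemma integral_scoreAt_pow_four_le (hγ : ∫ x, x ∂γ = 0) (f : H) :
    Integrable (fun x ↦ scoreAt γ x f ^ 4) γ ∧ ∫ x, scoreAt γ x f ^ 4 ∂γ ≤ scoreBound := by
  have h1 := integrable_score_pow_four (covarianceBilin γ f f).toNNReal
  have h2 := integral_score_pow_four_le (covarianceBilin γ f f).toNNReal
  have hm : Measurable fun x ↦ score (covarianceBilin γ f f) x ^ 4 := by fun_prop
  rw [Real.coe_toNNReal _ (covarianceBilin_self_nonneg f), ← map_inner_eq_gaussianReal hγ] at h1 h2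
  rw [integral_map (by fun_prop) hm.aestronglyMeasurable] at h2
  rw [integrable_map_measure hm.aestronglyMeasurable (by fun_prop)] at h1
  exact ⟨h1, h2⟩

lemma hasMean_scoreAt_mul (hγ : ∫ x, x ∂γ = 0) (f g : H) :
    HasMean γ (fun x ↦ scoreAt γ x f * scoreAt γ x g) (scoreKernel γ f g) :=
  hasMean_score_mul_score hγ f g

/-- `s² ≤ 1 + s⁴` and the uniform fourth moment bound. Independence of `f` and `γ` is what later
permits dominated convergence along varying laws. -/
lemma scoreKernel_self_le (hγ : ∫ x, x ∂γ = 0) (f : H) : scoreKernel γ f f ≤ 1 + scoreBound := by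
  obtain ⟨h1, h2⟩ := integral_scoreAt_pow_four_le hγ f
  have h := hasMean_scoreAt_mul hγ f f
  rw [← h.2]
  have m := (hasMean_const (μ := γ) 1).add ⟨h1, rfl⟩
  refine (integral_mono h.1 m.1 fun x ↦ ?_).trans (m.2.le.trans (by gcongr))
  simp only
  nlinarith [sq_nonneg (scoreAt γ x f ^ 2 - 1), sq_nonneg (scoreAt γ x f)]

lemma integral_abs_scoreAt_mul_le (hγ : ∫ x, x ∂γ = 0) (f g : H) :
    ∫ x, |scoreAt γ x f * scoreAt γ x g| ∂γ ≤ 1 + scoreBound := by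
  have m := ((hasMean_scoreAt_mul hγ f f).add (hasMean_scoreAt_mul hγ g g)).const_mul (1 / 2)
  refine (integral_mono (hasMean_scoreAt_mul hγ f g).1.abs m.1 fun x ↦ ?_).trans (m.2.le.trans ?_)
  · simp only
    rw [abs_le]
    constructor <;> nlinarith [sq_nonneg (scoreAt γ x f - scoreAt γ x g),
      sq_nonneg (scoreAt γ x f + scoreAt γ x g)]
  · linarith [scoreKernel_self_le hγ f, scoreKernel_self_le hγ g]

lemma abs_scoreKernel_le (hγ : ∫ x, x ∂γ = 0) (f g : H) : |scoreKernel γ f g| ≤ 1 + scoreBound := by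
  rw [← (hasMean_scoreAt_mul hγ f g).2]
  exact (abs_integral_le_integral_abs).trans (integral_abs_scoreAt_mul_le hγ f g)

lemma scoreBound_nonneg : 0 ≤ scoreBound := integral_nonneg fun x ↦ by positivity

lemma integrable_scoreAt_pow_four (hγ : ∫ x, x ∂γ = 0) :
    Integrable (fun p : H × H ↦ scoreAt γ p.1 p.2 ^ 4) (γ.prod Q) := by
  have hc : Continuous fun p : H × H ↦ scoreAt γ p.1 p.2 ^ 4 := (continuous_scoreAt γ).pow 4
  rw [integrable_prod_iff' hc.aestronglyMeasurable]
  refine ⟨ae_of_all _ fun f ↦ (integral_scoreAt_pow_four_le hγ f).1, ?_⟩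
  refine Integrable.mono' (integrable_const scoreBound) ?_ (ae_of_all _ fun f ↦ ?_)
  · exact (hc.norm.stronglyMeasurable.integral_prod_left' (μ := γ)).aestronglyMeasurable
  · rw [Real.norm_of_nonneg (integral_nonneg fun x ↦ norm_nonneg _)]
    refine le_trans (le_of_eq ?_) (integral_scoreAt_pow_four_le hγ f).2
    refine integral_congr_ae (ae_of_all _ fun x ↦ ?_)
    simp only
    rw [Real.norm_of_nonneg (by positivity)]

lemma memLp_two_scoreAt_prod (hγ : ∫ x, x ∂γ = 0) :
    MemLp (fun p : H × H ↦ scoreAt γ p.1 p.2) 2 (γ.prod Q) :=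
  (memLp_four_of_integrable (continuous_scoreAt γ).aemeasurable
    (integrable_scoreAt_pow_four hγ)).mono_exponent (by norm_num)

/-- Jensen under `Q` bounds the fourth power of the norm by the `Q`-integral of the fourth power;
Fubini then leaves a fourth moment at each `f`. -/
lemma integral_norm_scoreMap_pow_four (hQ : Integrable (fun f ↦ ‖f‖ ^ 4) Q)
    (hγ : ∫ x, x ∂γ = 0) :
    Integrable (fun x ↦ ‖scoreMap hQ γ x‖ ^ 4) γ ∧
      ∫ x, ‖scoreMap hQ γ x‖ ^ 4 ∂γ ≤ scoreBound := by
  have h := integrable_scoreAt_pow_four (Q := Q) hγ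
  have hb : ∀ᵐ x ∂γ, ‖scoreMap hQ γ x‖ ^ 4 ≤ ∫ f, scoreAt γ x f ^ 4 ∂Q := by
    filter_upwards [h.prod_right_ae] with x hx
    have h1 := sq_integral_sq_le (memLp_four_of_integrable
      (memLp_two_scoreAt hQ γ x).1.aemeasurable hx)
    rw [show ‖scoreMap hQ γ x‖ ^ 4 = (‖scoreMap hQ γ x‖ ^ 2) ^ 2 by ring, norm_scoreMap_sq]
    exact h1
  have hi : Integrable (fun x ↦ ‖scoreMap hQ γ x‖ ^ 4) γ := by
    refine h.integral_prod_left.mono' ((continuous_scoreMap hQ γ).norm.pow 4).aestronglyMeasurable ?_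
    filter_upwards [hb] with x hx
    rwa [Real.norm_of_nonneg (by positivity)]
  refine ⟨hi, (integral_mono_ae hi h.integral_prod_left hb).trans ?_⟩
  rw [integral_integral_swap h]
  calc _ ≤ ∫ _f : H, scoreBound ∂Q :=
        integral_mono h.integral_prod_right (integrable_const _)
          fun f ↦ (integral_scoreAt_pow_four_le hγ f).2
    _ = scoreBound := by simp

/-- The law of the influence function under `γ`. -/
def scoreLaw (hQ : Integrable (fun f ↦ ‖f‖ ^ 4) Q) (γ : Measure H) : Measure (Lp ℝ 2 Q) :=
  γ.map (scoreMap hQ γ)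

lemma measurable_scoreMap (hQ : Integrable (fun f ↦ ‖f‖ ^ 4) Q) (γ : Measure H) :
    Measurable (scoreMap hQ γ) := (continuous_scoreMap hQ γ).measurable

instance (hQ : Integrable (fun f ↦ ‖f‖ ^ 4) Q) : IsProbabilityMeasure (scoreLaw hQ γ) :=
  Measure.isProbabilityMeasure_map (measurable_scoreMap hQ γ).aemeasurable


lemma memLp_scoreMap (hQ : Integrable (fun f ↦ ‖f‖ ^ 4) Q) (hγ : ∫ x, x ∂γ = 0) :
    MemLp (scoreMap hQ γ) 4 γ := by
  rw [← integrable_norm_rpow_iff (measurable_scoreMap hQ γ).aestronglyMeasurable (by norm_num) (by norm_num)]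
  refine (integral_norm_scoreMap_pow_four hQ hγ).1.congr (ae_of_all _ fun ω ↦ ?_)
  have : (4 : ℝ≥0∞).toReal = (4 : ℕ) := by norm_num
  simp only [this, Real.rpow_natCast]

lemma memLp_id_scoreLaw (hQ : Integrable (fun f ↦ ‖f‖ ^ 4) Q) (hγ : ∫ x, x ∂γ = 0) :
    MemLp id 3 (scoreLaw hQ γ) := by
  rw [scoreLaw, memLp_map_measure_iff (by fun_prop) (measurable_scoreMap hQ γ).aemeasurable]
  exact (memLp_scoreMap hQ hγ).mono_exponent (by norm_num)

lemma integral_norm_pow_three_scoreLaw_le (hQ : Integrable (fun f ↦ ‖f‖ ^ 4) Q)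
    (hγ : ∫ x, x ∂γ = 0) : ∫ y, ‖y‖ ^ 3 ∂(scoreLaw hQ γ) ≤ 1 + scoreBound := by
  obtain ⟨h1, h2⟩ := integral_norm_scoreMap_pow_four hQ hγ
  rw [scoreLaw, integral_map (measurable_scoreMap hQ γ).aemeasurable (by fun_prop)]
  have m := (hasMean_const (μ := γ) 1).add ⟨h1, rfl⟩
  have h3 : MemLp (scoreMap hQ γ) ((3 : ℕ) : ℝ≥0∞) γ :=
    (memLp_scoreMap hQ hγ).mono_exponent (by norm_num)
  refine (integral_mono h3.integrable_norm_pow' m.1 fun x ↦ ?_).trans (m.2.le.trans (by gcongr))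
  simp only
  have h := norm_nonneg (scoreMap hQ γ x)
  nlinarith [sq_nonneg (‖scoreMap hQ γ x‖ ^ 2 - ‖scoreMap hQ γ x‖), sq_nonneg (‖scoreMap hQ γ x‖ - 1),
    sq_nonneg (‖scoreMap hQ γ x‖ ^ 2 - 1)]

lemma integral_scoreLaw (hQ : Integrable (fun f ↦ ‖f‖ ^ 4) Q) (hγ : ∫ x, x ∂γ = 0) :
    ∫ y, y ∂(scoreLaw hQ γ) = 0 := by
  rw [scoreLaw, integral_map (measurable_scoreMap hQ γ).aemeasurable (by fun_prop)]
  refine ext_inner_left ℝ fun Φ ↦ ?_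
  rw [← integral_inner ((memLp_scoreMap hQ hγ).integrable (by norm_num)), inner_zero_right]
  simp only [inner_scoreMap]
  have h := ((Lp.memLp Φ).comp_snd γ).integrable_mul (memLp_two_scoreAt_prod (Q := Q) hγ)
  rw [integral_integral_swap h]
  simp only [integral_const_mul]
  refine integral_eq_zero_of_ae (ae_of_all _ fun f ↦ ?_)
  have := (hasMean_score hγ f).2
  simp only [Pi.zero_apply]
  unfold scoreAt
  rw [this, mul_zero]

/-- Fubini on `γ × (Q × Q)`, justified by the uniform bound on absolute cross moments; the inner
integral over `γ` is the kernel. -/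
lemma covarianceBilin_scoreLaw (hQ : Integrable (fun f ↦ ‖f‖ ^ 4) Q) (hγ : ∫ x, x ∂γ = 0)
    (Φ Ψ : Lp ℝ 2 Q) : covarianceBilin (scoreLaw hQ γ) Φ Ψ
      = ∫ p : H × H, scoreKernel γ p.1 p.2 * (Φ p.1 * Ψ p.2) ∂(Q.prod Q) := by
  rw [covarianceBilin_of_mean_zero ((memLp_id_scoreLaw hQ hγ).mono_exponent (by norm_num))
    (integral_scoreLaw hQ hγ), scoreLaw,
    integral_map (measurable_scoreMap hQ γ).aemeasurable (by fun_prop)]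
  simp only [inner_scoreMap, ← integral_prod_mul]
  have hΦ := (Lp.memLp Φ).integrable (by norm_num)
  have hΨ := (Lp.memLp Ψ).integrable (by norm_num)
  have hΦΨ := hΦ.mul_prod hΨ
  have hc2 : Continuous fun z : H × (H × H) ↦ scoreAt γ z.1 z.2.1 * scoreAt γ z.1 z.2.2 := by
    unfold scoreAt
    fun_prop
  have hm : AEStronglyMeasurable (fun z : H × (H × H) ↦
      (scoreAt γ z.1 z.2.1 * scoreAt γ z.1 z.2.2) * (Φ z.2.1 * Ψ z.2.2)) (γ.prod (Q.prod Q)) :=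
    hc2.aestronglyMeasurable.mul hΦΨ.1.comp_snd
  have hi : Integrable (fun z : H × (H × H) ↦
      (scoreAt γ z.1 z.2.1 * scoreAt γ z.1 z.2.2) * (Φ z.2.1 * Ψ z.2.2)) (γ.prod (Q.prod Q)) := by
    rw [integrable_prod_iff' hm]
    refine ⟨ae_of_all _ fun p ↦ (hasMean_scoreAt_mul hγ p.1 p.2).1.mul_const (Φ p.1 * Ψ p.2), ?_⟩
    refine (hΦΨ.norm.const_mul (1 + scoreBound)).mono' ?_ (ae_of_all _ fun p ↦ ?_)
    · exact hm.norm.prod_swap.integral_prod_right'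
    · rw [Real.norm_of_nonneg (integral_nonneg fun x ↦ norm_nonneg _)]
      simp only [norm_mul (_ * _) (_ * _)]
      rw [integral_mul_const]
      gcongr
      exact integral_abs_scoreAt_mul_le hγ p.1 p.2
  calc _ = ∫ x, ∫ p : H × H, (scoreAt γ x p.1 * scoreAt γ x p.2) * (Φ p.1 * Ψ p.2)
        ∂(Q.prod Q) ∂γ := by
        refine integral_congr_ae (ae_of_all _ fun x ↦ integral_congr_ae (ae_of_all _ fun p ↦ ?_))
        simp only
        ring
    _ = _ := by
        rw [integral_integral_swap hi]
        refine integral_congr_ae (ae_of_all _ fun p ↦ ?_)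
        simp only
        rw [integral_mul_const, (hasMean_scoreAt_mul hγ p.1 p.2).2]

lemma integral_norm_sq_scoreLaw (hQ : Integrable (fun f ↦ ‖f‖ ^ 4) Q) (hγ : ∫ x, x ∂γ = 0) :
    ∫ y, ‖y‖ ^ 2 ∂(scoreLaw hQ γ) = ∫ f, scoreKernel γ f f ∂Q := by
  rw [scoreLaw, integral_map (measurable_scoreMap hQ γ).aemeasurable (by fun_prop)]
  simp only [norm_scoreMap_sq]
  rw [integral_integral_swap ((memLp_two_iff_integrable_sq
    (continuous_scoreAt γ).aestronglyMeasurable).1 (memLp_two_scoreAt_prod (Q := Q) hγ))]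
  refine integral_congr_ae (ae_of_all _ fun f ↦ ?_)
  simp only [sq]
  exact (hasMean_scoreAt_mul hγ f f).2

lemma covarianceBilin_scoreLaw_eq_kernelForm (hQ : Integrable (fun f ↦ ‖f‖ ^ 4) Q)
    (hγ : ∫ x, x ∂γ = 0) (Φ Ψ : Lp ℝ 2 Q) :
    covarianceBilin (scoreLaw hQ γ) Φ Ψ = kernelForm Q (scoreKernel γ) Φ Ψ := by
  rw [covarianceBilin_scoreLaw hQ hγ, integral_prod]
  · simp only [kernelForm, mul_assoc]
  · refine (((Lp.memLp Φ).integrable (by norm_num)).mul_prod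
      ((Lp.memLp Ψ).integrable (by norm_num))).bdd_mul (c := 1 + scoreBound)
      (continuous_scoreKernel γ).aestronglyMeasurable (ae_of_all _ fun p ↦ ?_)
    exact abs_scoreKernel_le hγ p.1 p.2

/-- The score laws depend continuously on the covariance form. -/
lemma tendsto_scoreLaw (hQ : Integrable (fun f ↦ ‖f‖ ^ 4) Q) {γs : ℕ → Measure H}
    [∀ n, IsGaussian (γs n)] (hγs : ∀ n, ∫ x, x ∂(γs n) = 0) (hγ : ∫ x, x ∂γ = 0)
    (hcov : ∀ f g, Tendsto (fun n ↦ covarianceBilin (γs n) f g) atTop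
      (𝓝 (covarianceBilin γ f g))) :
    (∀ Φ, Tendsto (fun n ↦ covarianceBilin (scoreLaw hQ (γs n)) Φ Φ) atTop
        (𝓝 (covarianceBilin (scoreLaw hQ γ) Φ Φ))) ∧
      Tendsto (fun n ↦ ∫ y, ‖y‖ ^ 2 ∂(scoreLaw hQ (γs n))) atTop
        (𝓝 (∫ y, ‖y‖ ^ 2 ∂(scoreLaw hQ γ))) := by
  have hK (f g : H) : Tendsto (fun n ↦ scoreKernel (γs n) f g) atTop (𝓝 (scoreKernel γ f g)) := by
    unfold scoreKernel
    have h1 := hcov f f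
    have h2 := hcov g g
    have h3 := hcov f g
    exact ((h1.add h2).const_mul _).rexp.mul
      (((h3.rexp.sub_const 1).sub h3).sub ((h3.pow 2).const_mul _))
  refine ⟨fun Φ ↦ ?_, ?_⟩
  · simp only [covarianceBilin_scoreLaw hQ (hγs _), covarianceBilin_scoreLaw hQ hγ]
    have hΦ := (Lp.memLp Φ).integrable (by norm_num)
    have hΦΦ := hΦ.mul_prod hΦ
    refine tendsto_integral_of_dominated_convergence
      (fun p ↦ (1 + scoreBound) * ‖Φ p.1 * Φ p.2‖) (fun n ↦ ?_) (hΦΦ.norm.const_mul _)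
      (fun n ↦ ae_of_all _ fun p ↦ ?_) (ae_of_all _ fun p ↦ (hK p.1 p.2).mul_const _)
    · exact (continuous_scoreKernel _).aestronglyMeasurable.mul hΦΦ.1
    · rw [norm_mul]
      gcongr
      exact abs_scoreKernel_le (hγs n) p.1 p.2
  · simp only [integral_norm_sq_scoreLaw hQ (hγs _), integral_norm_sq_scoreLaw hQ hγ]
    refine tendsto_integral_of_dominated_convergence (fun _ ↦ 1 + scoreBound) (fun n ↦ ?_)
      (integrable_const _) (fun n ↦ ae_of_all _ fun f ↦ abs_scoreKernel_le (hγs n) f f)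
      (ae_of_all _ fun f ↦ hK f f)
    have hc : Continuous fun f : H ↦ scoreKernel (γs n) f f := by
      unfold scoreKernel
      fun_prop
    exact hc.aestronglyMeasurable

end ScoreMap

/-! ### The statistic as a squared norm, and its linearization. -/

section TestStatistic

lemma norm_sampleDev_le {n : ℕ} (a : Fin n → ℝ) : ‖sampleDev a‖ ≤ 2 := by
  have hn (s : ℝ) : ‖Complex.exp (Complex.I * (s : ℝ))‖ = 1 := by
    rw [mul_comm, Complex.norm_exp_ofReal_mul_I]
  have h1 : ‖(n : ℂ)⁻¹ * ∑ j, Complex.exp (Complex.I * (a j : ℝ))‖ ≤ 1 := by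
    rw [norm_mul, norm_inv, Complex.norm_natCast]
    have h2 : ‖∑ j, Complex.exp (Complex.I * (a j : ℝ))‖ ≤ n := by
      refine (norm_sum_le _ _).trans ?_
      simp [hn]
    calc _ ≤ (n : ℝ)⁻¹ * n := by gcongr
      _ ≤ 1 := inv_mul_le_one
  have hv : 0 ≤ (n : ℝ)⁻¹ * ∑ j, (a j - (n : ℝ)⁻¹ * ∑ j, a j) ^ 2 :=
    mul_nonneg (by positivity) (Finset.sum_nonneg fun j _ ↦ sq_nonneg _)
  refine (norm_sub_le _ _).trans ?_
  have h3 : ‖Complex.exp (Complex.I * ((n : ℝ)⁻¹ * ∑ j, a j : ℝ) -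
      ((n : ℝ)⁻¹ * ∑ j, (a j - (n : ℝ)⁻¹ * ∑ j, a j) ^ 2 : ℝ) / 2)‖ ≤ 1 := by
    set m := (n : ℝ)⁻¹ * ∑ j, a j
    set v := (n : ℝ)⁻¹ * ∑ j, (a j - m) ^ 2
    rw [Complex.norm_exp, Real.exp_le_one_iff,
      show Complex.I * (m : ℝ) - (v : ℝ) / 2 = ((-v / 2 : ℝ) : ℂ) + (m : ℝ) * Complex.I by
        push_cast; ring]
    simp only [Complex.add_re, Complex.ofReal_re, Complex.re_ofReal_mul, Complex.I_re]
    linarith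
  linarith

/-- Reflection changes the sign of the sample mean and keeps the sample variance. -/
lemma sampleDev_neg {n : ℕ} (a : Fin n → ℝ) :
    sampleDev (fun j ↦ -a j) = (starRingEnd ℂ) (sampleDev a) := by
  have e (j : Fin n) : (-a j - (n : ℝ)⁻¹ * -∑ j, a j) ^ 2 = (a j - (n : ℝ)⁻¹ * ∑ j, a j) ^ 2 := by
    ring
  simp only [sampleDev, Finset.sum_neg_distrib, e, map_sub, map_mul, map_inv₀, map_natCast,
    map_sum, ← Complex.exp_conj, Complex.conj_I, Complex.conj_ofReal, map_div₀, map_ofNat]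
  push_cast
  simp only [mul_neg, neg_mul]

variable {H : Type*} [NormedAddCommGroup H] [InnerProductSpace ℝ H]

/-- Only the projections on `f` matter, which reduces everything at fixed `f` to a real sample. -/
lemma empCharFun_sub_gaussCharFun {n : ℕ} (x : Fin n → H) (f : H) :
    empCharFun x f - gaussCharFun (sampleMean x) (sampleCovOp x) f
      = sampleDev fun j ↦ ⟪f, x j⟫ := by
  have h1 : ⟪sampleMean x, f⟫ = (n : ℝ)⁻¹ * ∑ j, ⟪f, x j⟫ := by
    rw [sampleMean, real_inner_smul_left, sum_inner]
    simp only [real_inner_comm]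
  have h2 : ⟪sampleCovOp x f, f⟫
      = (n : ℝ)⁻¹ * ∑ j, (⟪f, x j⟫ - (n : ℝ)⁻¹ * ∑ j, ⟪f, x j⟫) ^ 2 := by
    rw [sampleCovOp, real_inner_smul_left, sum_inner]
    simp only [real_inner_smul_left, inner_sub_left, h1]
    congr 1
    refine Finset.sum_congr rfl fun j _ ↦ ?_
    rw [real_inner_comm]
    ring
  rw [empCharFun, gaussCharFun, h1, h2, sampleDev]

variable [MeasurableSpace H] [BorelSpace H] [SecondCountableTopology H]
  {Q : Measure H} [IsProbabilityMeasure Q] {n : ℕ}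

lemma continuous_sampleDev_inner :
    Continuous fun p : (Fin n → H) × H ↦ sampleDev fun j ↦ ⟪p.2, p.1 j⟫ :=
  continuous_sampleDev.comp (by fun_prop)

lemma continuous_sampleDev_inner_right (x : Fin n → H) :
    Continuous fun f : H ↦ sampleDev fun j ↦ ⟪f, x j⟫ :=
  continuous_sampleDev.comp (by fun_prop)

lemma memLp_reAddIm_sampleDev (x : Fin n → H) :
    MemLp (fun f ↦ reAddIm (sampleDev fun j ↦ ⟪f, x j⟫)) 2 Q := by
  refine MemLp.of_bound (C := 4) (reAddIm.continuous.comp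
    (continuous_sampleDev_inner_right x)).aestronglyMeasurable (ae_of_all _ fun f ↦ ?_)
  have h1 := norm_sampleDev_le fun j ↦ ⟪f, x j⟫
  have h2 := reAddIm_sq_le (sampleDev fun j ↦ ⟪f, x j⟫)
  rw [Real.norm_eq_abs]
  refine abs_le_of_sq_le_sq (h2.trans ?_) (by norm_num)
  nlinarith [norm_nonneg (sampleDev fun j ↦ ⟪f, x j⟫)]

/-- For symmetric weights, the statistic is a squared norm in a real `L²` space. -/
lemma testStat_eq (hQs : Q.map (fun f ↦ -f) = Q) (x : Fin n → H) :
    testStat Q x = ∫ f, reAddIm (sampleDev fun j ↦ ⟪f, x j⟫) ^ 2 ∂Q := by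
  set z : H → ℂ := fun f ↦ sampleDev fun j ↦ ⟪f, x j⟫ with hz
  have hc : Continuous z := continuous_sampleDev_inner_right x
  have hcm : Continuous fun f ↦ (z f).re * (z f).im := by fun_prop
  have hi : Integrable (fun f ↦ (z f).re * (z f).im) Q := by
    refine Integrable.mono' (integrable_const 4) hcm.aestronglyMeasurable (ae_of_all _ fun f ↦ ?_)
    rw [norm_mul]
    have h1 := norm_sampleDev_le fun j ↦ ⟪f, x j⟫
    calc _ ≤ ‖z f‖ * ‖z f‖ := by
          gcongr
          · exact Complex.abs_re_le_norm _
          · exact Complex.abs_im_le_norm _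
      _ ≤ 4 := by nlinarith [norm_nonneg (z f)]
  -- The cross term of `(Re z + Im z)²` is odd in `f`, so the symmetric `Q` annihilates it.
  have h0 : ∫ f, (z f).re * (z f).im ∂Q = 0 := by
    have h : ∫ f, (z f).re * (z f).im ∂Q = ∫ f, (z (-f)).re * (z (-f)).im ∂Q := by
      conv_lhs => rw [← hQs]
      exact integral_map (by fun_prop) hcm.aestronglyMeasurable
    have hzn (f : H) : z (-f) = (starRingEnd ℂ) (z f) := by
      simp only [hz, inner_neg_left, sampleDev_neg]
    simp only [hzn, Complex.conj_re, Complex.conj_im, mul_neg, integral_neg] at h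
    linarith
  have hn : Integrable (fun f ↦ ‖z f‖ ^ 2) Q := by
    refine Integrable.mono' (integrable_const 4) (hc.norm.pow 2).aestronglyMeasurable
      (ae_of_all _ fun f ↦ ?_)
    have h1 := norm_sampleDev_le fun j ↦ ⟪f, x j⟫
    rw [norm_pow, norm_norm]
    nlinarith [norm_nonneg (z f)]
  have m := (HasMean.const_mul ⟨hi, h0⟩ 2).add ⟨hn, rfl⟩
  rw [testStat]
  simp only [empCharFun_sub_gaussCharFun]
  refine Eq.trans ?_ (m.2.symm.trans ?_)
  · rw [mul_zero, zero_add]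
  · refine integral_congr_ae (ae_of_all _ fun f ↦ ?_)
    simp only
    rw [reAddIm_apply, Complex.sq_norm, Complex.normSq_apply]
    ring

lemma measurable_testStat (hQs : Q.map (fun f ↦ -f) = Q) :
    Measurable fun x : Fin n → H ↦ testStat Q x := by
  simp only [testStat_eq hQs]
  have hc : Continuous fun p : (Fin n → H) × H ↦ reAddIm (sampleDev fun j ↦ ⟪p.2, p.1 j⟫) ^ 2 :=
    (reAddIm.continuous.comp continuous_sampleDev_inner).pow 2
  exact (hc.stronglyMeasurable.integral_prod_right' (ν := Q)).measurable

variable [CompleteSpace H]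

lemma coeFn_normSum_scoreMap (hQ : Integrable (fun f ↦ ‖f‖ ^ 4) Q) (γ : Measure H)
    (x : Fin n → H) : (normSum (fun j ↦ scoreMap hQ γ (x j)) : Lp ℝ 2 Q) =ᵐ[Q]
      fun f ↦ (√(n : ℝ))⁻¹ * ∑ j, scoreAt γ (x j) f := by
  have h : ∀ᵐ f ∂Q, ∀ j, scoreMap hQ γ (x j) f = scoreAt γ (x j) f :=
    ae_all_iff.2 fun j ↦ coeFn_scoreMap hQ γ (x j)
  filter_upwards [h, Lp.coeFn_smul (√(n : ℝ))⁻¹ (∑ j, scoreMap hQ γ (x j)),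
    Lp.coeFn_finsetSum Finset.univ fun j ↦ scoreMap hQ γ (x j)] with f h1 h2 h3
  rw [normSum, h2, Pi.smul_apply, h3, Finset.sum_apply, smul_eq_mul]
  simp only [h1]

lemma two_mul_abs_mul_le {ε : ℝ} (hε : 0 < ε) (a b : ℝ) :
    2 * |a * b| ≤ 1 / ε * a ^ 2 + ε * b ^ 2 := by
  have h : 1 / ε * |a| ^ 2 + ε * |b| ^ 2 - 2 * (|a| * |b|) = 1 / ε * (|a| - ε * |b|) ^ 2 := by
    field_simp
    ring
  have h0 : 0 ≤ 1 / ε * (|a| - ε * |b|) ^ 2 := by positivity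
  rw [abs_mul, ← sq_abs a, ← sq_abs b]
  linarith

/-- The statistic is approximated by the squared norm of a normalized sum. -/
lemma abs_testStat_sub_le (hQs : Q.map (fun f ↦ -f) = Q) (hQ : Integrable (fun f ↦ ‖f‖ ^ 4) Q)
    (γ : Measure H) (x : Fin n → H) {ε : ℝ} (hε : 0 < ε) :
    |n * testStat Q x - ‖normSum fun j ↦ scoreMap hQ γ (x j)‖ ^ 2|
      ≤ (1 + 1 / ε) * ∫ f, linError (covarianceBilin γ f f) (fun j ↦ ⟪f, x j⟫) ^ 2 ∂Q
        + ε * ‖normSum fun j ↦ scoreMap hQ γ (x j)‖ ^ 2 := by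
  set S := normSum fun j ↦ scoreMap hQ γ (x j) with hS
  set U : H → ℝ := fun f ↦ √(n : ℝ) * reAddIm (sampleDev fun j ↦ ⟪f, x j⟫) with hU
  have hUm : MemLp U 2 Q := (memLp_reAddIm_sampleDev x).const_mul _
  have hSm : MemLp S 2 Q := Lp.memLp S
  have hD : (fun f ↦ linError (covarianceBilin γ f f) fun j ↦ ⟪f, x j⟫) =ᵐ[Q] U - S := by
    filter_upwards [coeFn_normSum_scoreMap hQ γ x] with f hf
    rw [Pi.sub_apply, hf, hU]
    rfl
  have hU2 : (n : ℝ) * testStat Q x = ∫ f, U f ^ 2 ∂Q := by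
    rw [testStat_eq hQs, ← integral_const_mul]
    refine integral_congr_ae (ae_of_all _ fun f ↦ ?_)
    simp only [hU]
    rw [mul_pow, Real.sq_sqrt (Nat.cast_nonneg n)]
  have hS2 : ‖S‖ ^ 2 = ∫ f, S f ^ 2 ∂Q := by
    rw [← real_inner_self_eq_norm_sq, L2.inner_def]
    refine integral_congr_ae (ae_of_all _ fun f ↦ ?_)
    simp only
    rw [real_inner_self_eq_norm_sq, Real.norm_eq_abs, sq_abs]
  have hD2 : ∫ f, linError (covarianceBilin γ f f) (fun j ↦ ⟪f, x j⟫) ^ 2 ∂Q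
      = ∫ f, (U f - S f) ^ 2 ∂Q := by
    refine integral_congr_ae ?_
    filter_upwards [hD] with f hf
    rw [hf, Pi.sub_apply]
  have iU : HasMean Q (fun f ↦ U f ^ 2) (∫ f, U f ^ 2 ∂Q) := ⟨hUm.integrable_sq, rfl⟩
  have iS : HasMean Q (fun f ↦ S f ^ 2) (∫ f, S f ^ 2 ∂Q) := ⟨hSm.integrable_sq, rfl⟩
  have iD : HasMean Q (fun f ↦ (U f - S f) ^ 2) (∫ f, (U f - S f) ^ 2 ∂Q) :=
    ⟨(hUm.sub hSm).integrable_sq, rfl⟩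
  rw [hU2, hD2, hS2]
  have m1 := iU.sub iS
  have m2 := (iD.const_mul (1 + 1 / ε)).add (iS.const_mul ε)
  rw [← m1.2, ← m2.2]
  refine abs_integral_le_integral_abs.trans (integral_mono m1.1.abs m2.1 fun f ↦ ?_)
  simp only
  set u := U f
  set s := S f
  -- `u² - s² = (u - s)² + 2 (u - s) s`; the weight `ε` makes the part in `s²` small, so a bounded
  -- mean of `‖S‖²` will suffice.
  have h1 := two_mul_abs_mul_le hε (u - s) s
  rw [show u ^ 2 - s ^ 2 = (u - s) ^ 2 + 2 * ((u - s) * s) by ring]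
  refine (abs_add_le _ _).trans ?_
  rw [abs_mul 2, abs_of_nonneg (sq_nonneg (u - s)), abs_of_nonneg (by norm_num : (0 : ℝ) ≤ 2)]
  linarith

lemma linBound_nonneg : 0 ≤ linBound := by
  have h1 : 0 ≤ ∫ x, x ^ 4 ∂(gaussianReal 0 1) := integral_nonneg fun x ↦ by positivity
  have h2 : 0 ≤ ∫ x, (x ^ 2 - 1) ^ 2 ∂(gaussianReal 0 1) := integral_nonneg fun x ↦ by positivity
  have h3 : 0 ≤ ∫ x, (x ^ 2 - 1) ^ 4 ∂(gaussianReal 0 1) := integral_nonneg fun x ↦ by positivity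
  unfold linBound
  positivity

section Sample

variable {Ω : Type*} [MeasurableSpace Ω] {P : Measure Ω} [IsProbabilityMeasure P]
  {γ : Measure H} [IsGaussian γ] {X : Fin n → Ω → H}

/-- The mean square of the linearization error at a single point. -/
lemma integral_linError_inner_sq_le (hn : n ≠ 0) (hγ : ∫ x, x ∂γ = 0) (hind : iIndepFun X P)
    (hX : ∀ j, AEMeasurable (X j) P) (hlaw : ∀ j, P.map (X j) = γ) (f : H) {v : ℝ}
    (hv : covarianceBilin γ f f ≤ v) :
    Integrable (fun ω ↦ linError (covarianceBilin γ f f) (fun j ↦ ⟪f, X j ω⟫) ^ 2) P ∧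
      ∫ ω, linError (covarianceBilin γ f f) (fun j ↦ ⟪f, X j ω⟫) ^ 2 ∂P
        ≤ linBound * (v + v ^ 2) ∧
      ∫ ω, linError (covarianceBilin γ f f) (fun j ↦ ⟪f, X j ω⟫) ^ 2 ∂P
        ≤ linBound * (v ^ 2 + v ^ 4) / n := by
  have h0 := covarianceBilin_self_nonneg (μ := γ) f
  have hm : Measurable fun x : H ↦ ⟪f, x⟫ := by fun_prop
  have h := integral_linError_sq_le hn (v := (covarianceBilin γ f f).toNNReal) (P := P)
    (a := fun j ω ↦ ⟪f, X j ω⟫) (fun j ↦ hm.comp_aemeasurable (hX j))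
    (hind.comp (fun _ x ↦ ⟪f, x⟫) fun _ ↦ hm) (fun j ↦ by
      rw [← map_inner_eq_gaussianReal hγ, ← hlaw j, AEMeasurable.map_map_of_aemeasurable
        hm.aemeasurable (hX j)]
      rfl)
  rw [Real.coe_toNNReal _ h0] at h
  have := linBound_nonneg
  refine ⟨h.1, h.2.1.trans ?_, h.2.2.trans ?_⟩ <;> gcongr

/-- The linearization error is square integrable with respect to the product measure. -/
lemma integrable_linError_prod (hn : n ≠ 0) (hQ : Integrable (fun f ↦ ‖f‖ ^ 4) Q)
    (hγ : ∫ x, x ∂γ = 0) (hind : iIndepFun X P)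
    (hX : ∀ j, AEMeasurable (X j) P) (hlaw : ∀ j, P.map (X j) = γ) {M : ℝ}
    (hM : ∀ f, covarianceBilin γ f f ≤ M * ‖f‖ ^ 2) :
    Integrable (fun p : Ω × H ↦
      linError (covarianceBilin γ p.2 p.2) (fun j ↦ ⟪p.2, X j p.1⟫) ^ 2) (P.prod Q) := by
  have hc : Continuous fun p : (Fin n → H) × H ↦
      linError (covarianceBilin γ p.2 p.2) (fun j ↦ ⟪p.2, p.1 j⟫) ^ 2 :=
    (continuous_linError (by fun_prop) (by fun_prop)).pow 2
  have hXm : AEMeasurable (fun ω j ↦ X j ω) P := aemeasurable_pi_lambda _ hX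
  have hm : AEStronglyMeasurable (fun p : Ω × H ↦
      linError (covarianceBilin γ p.2 p.2) (fun j ↦ ⟪p.2, X j p.1⟫) ^ 2) (P.prod Q) :=
    (hc.measurable.comp_aemeasurable
      ((hXm.comp_fst (ν := Q)).prodMk measurable_snd.aemeasurable)).aestronglyMeasurable
  rw [integrable_prod_iff' hm]
  refine ⟨ae_of_all _ fun f ↦ (integral_linError_inner_sq_le hn hγ hind hX hlaw f (hM f)).1, ?_⟩
  have hi : Integrable (fun f : H ↦ linBound * (M * ‖f‖ ^ 2 + M ^ 2 * ‖f‖ ^ 4)) Q :=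
    ((((memLp_two_norm_sq hQ).integrable (by norm_num)).const_mul M).add
      (hQ.const_mul (M ^ 2))).const_mul _
  refine hi.mono' hm.norm.prod_swap.integral_prod_right' (ae_of_all _ fun f ↦ ?_)
  rw [Real.norm_of_nonneg (integral_nonneg fun x ↦ norm_nonneg _)]
  simp only [norm_pow, Real.norm_eq_abs, sq_abs]
  refine (integral_linError_inner_sq_le hn hγ hind hX hlaw f (hM f)).2.1.trans_eq ?_
  ring

end Sample

/-- The linearization error vanishes in the limit. -/
lemma tendsto_integral_linError (hQ : Integrable (fun f ↦ ‖f‖ ^ 4) Q)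
    {Ωb : ℕ → Type*} [∀ n, MeasurableSpace (Ωb n)]
    {Pb : (n : ℕ) → Measure (Ωb n)} [∀ n, IsProbabilityMeasure (Pb n)]
    {X : (n : ℕ) → Fin n → Ωb n → H} (hind : ∀ n, iIndepFun (X n) (Pb n))
    (hX : ∀ n j, AEMeasurable (X n j) (Pb n)) {γs : ℕ → Measure H}
    [∀ n, IsGaussian (γs n)] (hγs : ∀ n, ∫ x, x ∂(γs n) = 0)
    (hlaw : ∀ n j, (Pb n).map (X n j) = γs n) {M : ℝ}
    (hM : ∀ n f, covarianceBilin (γs n) f f ≤ M * ‖f‖ ^ 2) :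
    Tendsto (fun n ↦ ∫ ω, ∫ f, linError (covarianceBilin (γs n) f f)
      (fun j ↦ ⟪f, X n j ω⟫) ^ 2 ∂Q ∂(Pb n)) atTop (𝓝 0) := by
  have hswap : ∀ᶠ n in atTop, ∫ f, ∫ ω, linError (covarianceBilin (γs n) f f)
      (fun j ↦ ⟪f, X n j ω⟫) ^ 2 ∂(Pb n) ∂Q = ∫ ω, ∫ f, linError (covarianceBilin (γs n) f f)
      (fun j ↦ ⟪f, X n j ω⟫) ^ 2 ∂Q ∂(Pb n) := by
    filter_upwards [eventually_ne_atTop 0] with n hn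
    exact (integral_integral_swap (integrable_linError_prod hn hQ (hγs n) (hind n) (hX n) (hlaw n)
      (hM n))).symm
  refine Tendsto.congr' hswap ?_
  rw [← integral_zero H ℝ (μ := Q)]
  have hi : Integrable (fun f : H ↦ linBound * (M * ‖f‖ ^ 2 + M ^ 2 * ‖f‖ ^ 4)) Q :=
    ((((memLp_two_norm_sq hQ).integrable (by norm_num)).const_mul M).add
      (hQ.const_mul (M ^ 2))).const_mul _
  -- The estimate without `n` is the majorant, integrable by the fourth moment of `Q`; the `1/n`
  -- estimate gives the pointwise limit.
  refine tendsto_integral_filter_of_dominated_convergence _ ?_ ?_ hi (ae_of_all _ fun f ↦ ?_)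
  · filter_upwards [eventually_ne_atTop 0] with n hn
    exact (integrable_linError_prod hn hQ (hγs n) (hind n) (hX n) (hlaw n)
      (hM n)).integral_prod_right.aestronglyMeasurable
  · filter_upwards [eventually_ne_atTop 0] with n hn
    refine ae_of_all _ fun f ↦ ?_
    rw [Real.norm_of_nonneg (integral_nonneg fun x ↦ sq_nonneg _)]
    refine (integral_linError_inner_sq_le hn (hγs n) (hind n) (hX n) (hlaw n) f
      (hM n f)).2.1.trans_eq ?_
    ring
  · refine tendsto_of_tendsto_of_tendsto_of_le_of_le' tendsto_const_nhds
      (tendsto_const_div_atTop_nhds_zero_nat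
        (linBound * ((M * ‖f‖ ^ 2) ^ 2 + (M * ‖f‖ ^ 2) ^ 4)))
      (Eventually.of_forall fun n ↦ integral_nonneg fun x ↦ sq_nonneg _) ?_
    filter_upwards [eventually_ne_atTop 0] with n hn
    exact (integral_linError_inner_sq_le hn (hγs n) (hind n) (hX n) (hlaw n) f (hM n f)).2.2

end TestStatistic

/-! ### Limit law for Gaussian samples with converging covariances. -/

section Limit

variable {H : Type*} [NormedAddCommGroup H] [InnerProductSpace ℝ H] [MeasurableSpace H]
  [BorelSpace H] [SecondCountableTopology H] [CompleteSpace H]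

lemma integral_norm_sq_eq_of_covarianceBilin_eq {μ ν : Measure H} [IsProbabilityMeasure μ]
    [IsProbabilityMeasure ν] (hμ : MemLp id 2 μ) (hν : MemLp id 2 ν) (hμ0 : ∫ x, x ∂μ = 0)
    (hν0 : ∫ x, x ∂ν = 0) (h : covarianceBilin μ = covarianceBilin ν) :
    ∫ x, ‖x‖ ^ 2 ∂μ = ∫ x, ‖x‖ ^ 2 ∂ν := by
  obtain ⟨w, b, hw⟩ := exists_countable_hilbertBasis H
  have h1 := hasSum_integral_inner_sq hμ b
  have h2 := hasSum_integral_inner_sq hν b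
  simp only [sq ⟪b _, _⟫, ← covarianceBilin_of_mean_zero hμ hμ0, h] at h1
  simp only [sq ⟪b _, _⟫, ← covarianceBilin_of_mean_zero hν hν0] at h2
  exact h1.unique h2

/-- The statistic of Gaussian samples whose covariances converge converges in distribution. -/
theorem tendstoInDistribution_testStat {Q : Measure H} [IsProbabilityMeasure Q]
    (hQs : Q.map (fun f ↦ -f) = Q) (hQ : Integrable (fun f ↦ ‖f‖ ^ 4) Q)
    {Ωb : ℕ → Type*} [∀ n, MeasurableSpace (Ωb n)]
    {Pb : (n : ℕ) → Measure (Ωb n)} [∀ n, IsProbabilityMeasure (Pb n)]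
    {X : (n : ℕ) → Fin n → Ωb n → H} (hind : ∀ n, iIndepFun (X n) (Pb n))
    (hX : ∀ n j, AEMeasurable (X n j) (Pb n)) {γs : ℕ → Measure H}
    [∀ n, IsGaussian (γs n)] (hγs : ∀ n, ∫ x, x ∂(γs n) = 0)
    (hlaw : ∀ n j, (Pb n).map (X n j) = γs n) {M : ℝ}
    (hM : ∀ n f, covarianceBilin (γs n) f f ≤ M * ‖f‖ ^ 2) {γ : Measure H} [IsGaussian γ]
    (hγ : ∫ x, x ∂γ = 0)
    (hcov : ∀ f g, Tendsto (fun n ↦ covarianceBilin (γs n) f g) atTop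
      (𝓝 (covarianceBilin γ f g)))
    {V : Measure (Lp ℝ 2 Q)} [IsGaussian V] (hV : ∫ x, x ∂V = 0)
    (hVcov : covarianceBilin V = covarianceBilin (scoreLaw hQ γ)) :
    TendstoInDistribution (fun (n : ℕ) ω ↦ (n : ℝ) * testStat Q fun j ↦ X n j ω) atTop
      (fun w ↦ ‖w‖ ^ 2) Pb V := by
  have hYm (n : ℕ) (j : Fin n) : AEMeasurable (fun ω ↦ scoreMap hQ (γs n) (X n j ω)) (Pb n) :=
    (measurable_scoreMap hQ (γs n)).comp_aemeasurable (hX n j)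
  have hYlaw (n : ℕ) (j : Fin n) :
      (Pb n).map (fun ω ↦ scoreMap hQ (γs n) (X n j ω)) = scoreLaw hQ (γs n) := by
    rw [scoreLaw, ← hlaw n j, AEMeasurable.map_map_of_aemeasurable
      (measurable_scoreMap hQ _).aemeasurable (hX n j)]
    rfl
  have hYind (n : ℕ) : iIndepFun (fun j ω ↦ scoreMap hQ (γs n) (X n j ω)) (Pb n) :=
    (hind n).comp (fun _ ↦ scoreMap hQ (γs n)) fun _ ↦ measurable_scoreMap hQ (γs n)
  have h2 (n : ℕ) : MemLp id 2 (scoreLaw hQ (γs n)) :=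
    (memLp_id_scoreLaw hQ (hγs n)).mono_exponent (by norm_num)
  obtain ⟨ht1, ht2⟩ := tendsto_scoreLaw hQ hγs hγ hcov
  have hclt := tendstoInDistribution_norm_normSum_sq (γ := V) hYind hYm hYlaw
    (fun n ↦ memLp_id_scoreLaw hQ (hγs n)) (fun n ↦ integral_scoreLaw hQ (hγs n))
    (fun n ↦ integral_norm_pow_three_scoreLaw_le hQ (hγs n)) hV
    (fun Φ ↦ by rw [hVcov]; exact ht1 Φ)
    (by
      rw [integral_norm_sq_eq_of_covarianceBilin_eq IsGaussian.memLp_two_id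
        ((memLp_id_scoreLaw hQ hγ).mono_exponent (by norm_num)) hV (integral_scoreLaw hQ hγ) hVcov]
      exact ht2)
  have hTm (n : ℕ) : AEMeasurable (fun ω ↦ (n : ℝ) * testStat Q fun j ↦ X n j ω) (Pb n) :=
    ((measurable_testStat hQs).comp_aemeasurable (aemeasurable_pi_lambda _ (hX n))).const_mul _
  -- One approximating sequence serves every `ε`: the squared norms of the normalized score sums,
  -- whose limit is already the required one.
  refine tendstoInDistribution_of_approx hTm (by fun_prop) fun ε hε ↦
    ⟨_, _, hclt, ?_, by simp, by simpa using hε.le⟩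
  have hB : 0 < 1 + scoreBound := by linarith [scoreBound_nonneg]
  -- Makes `δ` times the mean squared norm of the normalized sum at most `ε / 2`.
  set δ := ε / (2 * (1 + scoreBound)) with hδ
  have hδ0 : 0 < δ := by positivity
  have hlim := (tendsto_integral_linError hQ hind hX hγs hlaw hM).const_mul (1 + 1 / δ)
  rw [mul_zero] at hlim
  filter_upwards [eventually_ne_atTop 0, hlim.eventually_le_const (half_pos hε)] with n hn hle
  have m1 : HasMean (Pb n) (fun ω ↦ ∫ f, linError (covarianceBilin (γs n) f f)
      (fun j ↦ ⟪f, X n j ω⟫) ^ 2 ∂Q) _ :=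
    ⟨(integrable_linError_prod hn hQ (hγs n) (hind n) (hX n) (hlaw n)
      (hM n)).integral_prod_left, rfl⟩
  have m2 : HasMean (Pb n) (fun ω ↦ ‖normSum fun j ↦ scoreMap hQ (γs n) (X n j ω)‖ ^ 2)
      (∫ f, scoreKernel (γs n) f f ∂Q) := by
    refine ⟨(memLp_normSum (hYm n) (hYlaw n) (h2 n)).integrable_norm_pow two_ne_zero, ?_⟩
    rw [integral_norm_normSum_sq hn (hYind n) (hYm n) (hYlaw n) (h2 n)
      (integral_scoreLaw hQ (hγs n)), integral_norm_sq_scoreLaw hQ (hγs n)]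
  have hK : ∫ f, scoreKernel (γs n) f f ∂Q ≤ 1 + scoreBound := by
    have hc : Continuous fun f : H ↦ scoreKernel (γs n) f f := by
      unfold scoreKernel
      fun_prop
    refine (integral_mono (Integrable.mono' (integrable_const (1 + scoreBound))
      hc.aestronglyMeasurable (ae_of_all _ fun f ↦ abs_scoreKernel_le (hγs n) f f))
      (integrable_const (1 + scoreBound)) fun f ↦ scoreKernel_self_le (hγs n) f).trans_eq ?_
    simp
  have m := (m1.const_mul (1 + 1 / δ)).add (m2.const_mul δ)
  have hb (ω : Ωb n) := abs_testStat_sub_le hQs hQ (γs n) (fun j ↦ X n j ω) hδ0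
  have hi : Integrable (fun ω ↦ (n : ℝ) * testStat Q (fun j ↦ X n j ω)
      - ‖normSum fun j ↦ scoreMap hQ (γs n) (X n j ω)‖ ^ 2) (Pb n) :=
    m.1.mono' ((hTm n).sub m2.1.aemeasurable).aestronglyMeasurable (ae_of_all _ hb)
  refine ⟨hi, (integral_mono hi.abs m.1 hb).trans (m.2.le.trans ?_)⟩
  have h3 : δ * ∫ f, scoreKernel (γs n) f f ∂Q ≤ ε / 2 := by
    calc _ ≤ δ * (1 + scoreBound) := by gcongr
      _ = ε / 2 := by rw [hδ]; field_simp
  linarith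

end Limit

/-! ### Almost sure behaviour of the sample covariance operators. -/

section Data

variable {H : Type*} [NormedAddCommGroup H] [InnerProductSpace ℝ H]

lemma inner_sampleCovOp {n : ℕ} (x : Fin n → H) (f g : H) :
    ⟪sampleCovOp x f, g⟫ = (n : ℝ)⁻¹ * ∑ j, ⟪x j, f⟫ * ⟪x j, g⟫
      - ⟪sampleMean x, f⟫ * ⟪sampleMean x, g⟫ := by
  rcases eq_or_ne n 0 with rfl | hn
  · simp [sampleCovOp, sampleMean]
  have hn' : (n : ℝ) ≠ 0 := Nat.cast_ne_zero.2 hn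
  have hs (u : H) : ∑ j, ⟪x j, u⟫ = n * ⟪sampleMean x, u⟫ := by
    rw [sampleMean, real_inner_smul_left, sum_inner, mul_inv_cancel_left₀ hn']
  rw [sampleCovOp, real_inner_smul_left, sum_inner]
  set m := sampleMean x
  have e (j : Fin n) : ⟪⟪x j - m, f⟫ • (x j - m), g⟫
      = ⟪x j, f⟫ * ⟪x j, g⟫ - ⟪m, g⟫ * ⟪x j, f⟫ - ⟪m, f⟫ * ⟪x j, g⟫ + ⟪m, f⟫ * ⟪m, g⟫ := by
    rw [real_inner_smul_left, inner_sub_left, inner_sub_left]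
    ring
  simp only [e, Finset.sum_add_distrib, Finset.sum_sub_distrib, ← Finset.mul_sum, hs]
  simp only [Finset.sum_const, Finset.card_univ, Fintype.card_fin, nsmul_eq_mul]
  field_simp
  ring

/-- The rank one operator `f ↦ ⟨x, f⟩ x`. -/
def rankOneSelf (x : H) : H →L[ℝ] H := (innerSL ℝ x).smulRight x

lemma rankOneSelf_apply (x f : H) : rankOneSelf x f = ⟪x, f⟫ • x := rfl

lemma continuous_rankOneSelf : Continuous fun x : H ↦ rankOneSelf x := by
  have h : Continuous fun x : H ↦ ContinuousLinearMap.smulRightL ℝ H H (innerSL ℝ x) x := by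
    fun_prop
  exact h

lemma norm_rankOneSelf_le (x : H) : ‖rankOneSelf x‖ ≤ ‖x‖ ^ 2 := by
  refine ContinuousLinearMap.opNorm_le_bound _ (by positivity) fun f ↦ ?_
  rw [rankOneSelf_apply, norm_smul]
  calc _ ≤ (‖x‖ * ‖f‖) * ‖x‖ := by
        gcongr
        exact norm_inner_le_norm _ _
    _ = ‖x‖ ^ 2 * ‖f‖ := by ring

variable [MeasurableSpace H] [BorelSpace H] [SecondCountableTopology H] [CompleteSpace H]
  {Ω : Type*} [MeasurableSpace Ω] {P : Measure Ω} [IsProbabilityMeasure P] {X : Ω → H}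

lemma integrable_rankOneSelf (hX : MemLp X 2 P) : Integrable (fun ω ↦ rankOneSelf (X ω)) P :=
  (hX.integrable_norm_pow two_ne_zero).mono'
    (continuous_rankOneSelf.comp_aestronglyMeasurable hX.1)
    (ae_of_all _ fun _ ↦ norm_rankOneSelf_le _)

lemma inner_integral_rankOneSelf (hX : MemLp X 2 P) (f g : H) :
    ⟪(∫ ω, rankOneSelf (X ω) ∂P) f, g⟫ = ∫ ω, ⟪X ω, f⟫ * ⟪X ω, g⟫ ∂P := by
  have h := integrable_rankOneSelf hX
  rw [ContinuousLinearMap.integral_apply h, real_inner_comm,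
    ← integral_inner (h.apply_continuousLinearMap f)]
  refine integral_congr_ae (ae_of_all _ fun ω ↦ ?_)
  simp only
  rw [rankOneSelf_apply, real_inner_smul_right, real_inner_comm g]

/-- Centring one factor, as `covOp` does, is enough: the centred factor has zero integral against
the constant mean. -/
lemma inner_covOp (hX : MemLp X 2 P) (f g : H) :
    ⟪covOp X P f, g⟫ = ∫ ω, ⟪X ω, f⟫ * ⟪X ω, g⟫ ∂P
        - ⟪∫ ω, X ω ∂P, f⟫ * ⟪∫ ω, X ω ∂P, g⟫ ∧
      covarianceBilin (P.map X) f g = ⟪covOp X P f, g⟫ := by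
  have hXi : Integrable X P := hX.integrable (by norm_num)
  set m := ∫ ω, X ω ∂P with hm
  have h1 (u : H) : HasMean P (fun ω ↦ ⟪X ω, u⟫) ⟪m, u⟫ := by
    refine ⟨hXi.inner_const u, ?_⟩
    simp only [real_inner_comm u]
    rw [integral_inner hXi]
  have h2 : HasMean P (fun ω ↦ ⟪X ω, f⟫ * ⟪X ω, g⟫) (∫ ω, ⟪X ω, f⟫ * ⟪X ω, g⟫ ∂P) := by
    refine ⟨?_, rfl⟩
    have h := ((integrable_rankOneSelf hX).apply_continuousLinearMap f).inner_const (𝕜 := ℝ) g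
    refine h.congr (ae_of_all _ fun ω ↦ ?_)
    simp only
    rw [rankOneSelf_apply, real_inner_smul_left]
  have h3 : HasMean P (fun ω ↦ ⟪⟪X ω - m, f⟫ • X ω, g⟫)
      (∫ ω, ⟪X ω, f⟫ * ⟪X ω, g⟫ ∂P - ⟪m, f⟫ * ⟪m, g⟫) :=
    (h2.sub ((h1 g).const_mul ⟪m, f⟫)).congr
      (fun ω ↦ by rw [real_inner_smul_left, inner_sub_left]; ring) rfl
  have h4 : ⟪covOp X P f, g⟫ = ∫ ω, ⟪X ω, f⟫ * ⟪X ω, g⟫ ∂P - ⟪m, f⟫ * ⟪m, g⟫ := by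
    have hi : Integrable (fun ω ↦ ⟪X ω - m, f⟫ • X ω) P := by
      have h := ((integrable_rankOneSelf hX).apply_continuousLinearMap f).sub
        (hXi.smul ⟪m, f⟫)
      refine h.congr (ae_of_all _ fun ω ↦ ?_)
      simp only [Pi.sub_apply, Pi.smul_apply]
      rw [rankOneSelf_apply, inner_sub_left, sub_smul]
    rw [← h3.2, covOp, real_inner_comm, ← integral_inner hi]
    simp only [real_inner_comm g]
  refine ⟨h4, ?_⟩
  rw [h4, covarianceBilin_apply ((memLp_map_measure_iff (by fun_prop) hX.1.aemeasurable).2 hX)]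
  have hmap : ∫ x, id x ∂(P.map X) = m := by
    rw [integral_map hX.1.aemeasurable (by fun_prop)]
    rfl
  rw [hmap, integral_map hX.1.aemeasurable (by fun_prop)]
  refine (((h2.sub ((h1 g).const_mul ⟪m, f⟫)).sub ((h1 f).const_mul ⟪m, g⟫)).add
    (hasMean_const (⟪m, f⟫ * ⟪m, g⟫))).congr (fun ω ↦ ?_) ?_ |>.2
  · rw [inner_sub_right, inner_sub_right]
    simp only [real_inner_comm]
    ring
  · ring

/-- The sample covariance operators converge almost surely and are uniformly bounded. -/
lemma ae_tendsto_sampleCovOp (hX : MemLp X 2 P) {Xs : ℕ → Ω → H} (hind : iIndepFun Xs P)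
    (hid : ∀ i, IdentDistrib (Xs i) X P P) :
    ∀ᵐ ω ∂P, (∀ f g, Tendsto (fun n : ℕ ↦ ⟪sampleCovOp (fun i : Fin n ↦ Xs i ω) f, g⟫) atTop
        (𝓝 ⟪covOp X P f, g⟫)) ∧
      ∃ M : ℝ, ∀ (n : ℕ) (f : H),
        ⟪sampleCovOp (fun i : Fin n ↦ Xs i ω) f, f⟫ ≤ M * ‖f‖ ^ 2 := by
  have hXs : MemLp (Xs 0) 2 P := (hid 0).memLp_iff.2 hX
  have hid0 (i : ℕ) : IdentDistrib (Xs i) (Xs 0) P P := (hid i).trans (hid 0).symm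
  have hTm : Measurable fun x : H ↦ rankOneSelf x := continuous_rankOneSelf.measurable
  -- The second strong law, below, takes place in the Banach space of bounded operators, so a single
  -- null set serves all `f` and `g`.
  have s1 := strong_law_ae Xs (hXs.integrable (by norm_num)) (fun i j hij ↦ hind.indepFun hij) hid0
  have s2 := strong_law_ae (fun i ω ↦ rankOneSelf (Xs i ω)) (integrable_rankOneSelf hXs)
    (fun i j hij ↦ (hind.indepFun hij).comp hTm hTm) fun i ↦ (hid0 i).comp hTm
  have e1 : ∫ ω, Xs 0 ω ∂P = ∫ ω, X ω ∂P := (hid 0).integral_eq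
  have e2 : ∫ ω, rankOneSelf (Xs 0 ω) ∂P = ∫ ω, rankOneSelf (X ω) ∂P :=
    ((hid 0).comp hTm).integral_eq
  filter_upwards [s1, s2] with ω h1 h2
  rw [e1] at h1
  rw [e2] at h2
  have hmean (n : ℕ) : sampleMean (fun i : Fin n ↦ Xs i ω)
      = (n : ℝ)⁻¹ • ∑ i ∈ Finset.range n, Xs i ω := by
    rw [sampleMean, ← Fin.sum_univ_eq_sum_range (fun i ↦ Xs i ω)]
  have hop (n : ℕ) (f g : H) : (n : ℝ)⁻¹ * ∑ j : Fin n, ⟪Xs j ω, f⟫ * ⟪Xs j ω, g⟫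
      = ⟪((n : ℝ)⁻¹ • ∑ i ∈ Finset.range n, rankOneSelf (Xs i ω)) f, g⟫ := by
    rw [← Fin.sum_univ_eq_sum_range (fun i ↦ rankOneSelf (Xs i ω)), smul_apply,
      real_inner_smul_left, sum_apply, sum_inner]
    simp only [rankOneSelf_apply, real_inner_smul_left]
  simp only [inner_sampleCovOp, hmean, hop]
  refine ⟨fun f g ↦ ?_, ?_⟩
  · rw [(inner_covOp hX f g).1, ← inner_integral_rankOneSelf hX]
    have h3 : Tendsto (fun n : ℕ ↦ ((n : ℝ)⁻¹ • ∑ i ∈ Finset.range n, rankOneSelf (Xs i ω)) f)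
        atTop (𝓝 ((∫ ω, rankOneSelf (X ω) ∂P) f)) :=
      ((ContinuousLinearMap.apply ℝ H f).continuous.tendsto _).comp h2
    exact (h3.inner tendsto_const_nhds).sub
      ((h1.inner tendsto_const_nhds).mul (h1.inner tendsto_const_nhds))
  -- A convergent sequence of operators is norm bounded, and subtracting the squared mean only
  -- lowers the quadratic form.
  · obtain ⟨M, hM⟩ := h2.norm.bddAbove_range
    refine ⟨M, fun n f ↦ ?_⟩
    have h4 := hM (Set.mem_range_self n)
    calc _ ≤ ⟪((n : ℝ)⁻¹ • ∑ i ∈ Finset.range n, rankOneSelf (Xs i ω)) f, f⟫ :=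
          sub_le_self _ (mul_self_nonneg _)
      _ ≤ ‖((n : ℝ)⁻¹ • ∑ i ∈ Finset.range n, rankOneSelf (Xs i ω)) f‖ * ‖f‖ :=
          real_inner_le_norm _ _
      _ ≤ (M * ‖f‖) * ‖f‖ := by
          gcongr
          exact (ContinuousLinearMap.le_opNorm _ _).trans (by gcongr)
      _ = M * ‖f‖ ^ 2 := by ring

end Data

end FunctionalBHEP

end

/-! ### The bootstrap limit theorem. -/

theorem mainTheorem2
    {Ω : Type*} [MeasurableSpace Ω] (P : Measure Ω) [IsProbabilityMeasure P]
    (X : Ω → HilbertL2) (hX2 : MemLp X 2 P)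
    (Xs : ℕ → Ω → HilbertL2) (hindep : iIndepFun Xs P)
    (hident : ∀ i, IdentDistrib (Xs i) X P P)
    (Q : Measure HilbertL2) [IsProbabilityMeasure Q]
    (hQsymm : Q.map (fun f ↦ -f) = Q)
    (hQ4 : Integrable (fun f ↦ ‖f‖ ^ 4) Q) :
    ∃ V : ProbabilityMeasure (Lp ℝ 2 Q),
      IsCentredGaussian (V : Measure (Lp ℝ 2 Q)) (kernelForm Q (limitKernel (covOp X P))) ∧
      ∀ᵐ ω ∂P,
        ∀ (Ωb : ℕ → Type*) [∀ n, MeasurableSpace (Ωb n)]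
          (Pb : (n : ℕ) → Measure (Ωb n)) [∀ n, IsProbabilityMeasure (Pb n)]
          (Xb : (n : ℕ) → Fin n → Ωb n → HilbertL2),
          (∀ n, iIndepFun (Xb n) (Pb n)) →
          (∀ n j, AEMeasurable (Xb n j) (Pb n) ∧
            IsCentredGaussian ((Pb n).map (Xb n j))
              (fun f g ↦ inner ℝ (sampleCovOp (fun i : Fin n ↦ Xs i ω) f) g)) →
          TendstoInDistribution
            (fun n (ωb : Ωb n) ↦ (n : ℝ) * testStat Q (fun j ↦ Xb n j ωb)) atTop
            (fun w : Lp ℝ 2 Q ↦ ‖w‖ ^ 2) Pb (V : Measure (Lp ℝ 2 Q)) := by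
  have := Measure.isProbabilityMeasure_map (μ := P) hX2.1.aemeasurable
  -- `X` need not be Gaussian; the limit depends on its law only through the covariance, so a
  -- Gaussian `γ` with that covariance takes its place.
  obtain ⟨γ, hγG, hγ0, hγc⟩ := exists_isGaussian_covarianceBilin_eq (P.map X)
    ((memLp_map_measure_iff (by fun_prop) hX2.1.aemeasurable).2 hX2)
  have hcov (f g : HilbertL2) : covarianceBilin γ f g = ⟪covOp X P f, g⟫ := by
    rw [hγc, (inner_covOp hX2 f g).2]
  obtain ⟨V, hVG, hV0, hVc⟩ := exists_isGaussian_covarianceBilin_eq (scoreLaw hQ4 γ)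
    ((memLp_id_scoreLaw hQ4 hγ0).mono_exponent (by norm_num))
  have hK : scoreKernel γ = limitKernel (covOp X P) := by
    funext f g
    simp only [scoreKernel, limitKernel, hcov]
  refine ⟨⟨V, inferInstance⟩, ⟨hVG, hV0, fun Φ Ψ ↦ ?_⟩, ?_⟩
  · rw [ProbabilityMeasure.coe_mk, hVc, covarianceBilin_scoreLaw_eq_kernelForm hQ4 hγ0, hK]
  filter_upwards [ae_tendsto_sampleCovOp hX2 hindep hident] with ω hω Ωb _ Pb _ Xb hind hlaw
  obtain ⟨hlim, M, hM⟩ := hω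
  -- For `n = 0` the hypotheses supply no law, so reference laws are chosen for all `n`; the given
  -- laws agree with them because mean and covariance determine a Gaussian law.
  choose γs hγs using fun n : ℕ ↦ exists_isCentredGaussian_sampleCovOp fun i : Fin n ↦ Xs i ω
  have hG (n : ℕ) : IsGaussian (γs n) := (hγs n).isGaussian
  refine tendstoInDistribution_testStat (V := V) hQsymm hQ4 hind (fun n j ↦ (hlaw n j).1)
    (γs := γs) (fun n ↦ (hγs n).mean_eq_zero) (fun n j ↦ ?_) (M := M) (fun n f ↦ ?_) hγ0
    (fun f g ↦ ?_) hV0 hVc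
  · have h := (hlaw n j).2
    have := h.isGaussian
    refine IsGaussian.ext (h.mean_eq_zero.trans (hγs n).mean_eq_zero.symm) ?_
    ext f g
    rw [h.cov_eq, (hγs n).cov_eq]
  · rw [(hγs n).cov_eq]
    exact hM n f
  · simp only [(hγs _).cov_eq, hcov]
    exact hlim f g
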